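/- **Definitions.** An *annotated automaton* is a tuple $\mathcal A=(Q,\Sigma,\Omega,\Delta,q_0,F)$ with finite sets $Q,\Sigma,\Omega$ of states, input letters and output symbols, $q_0\in Q$, $F\subseteq Q$, and a set $\Delta\subseteq (Q\times\Sigma\times Q)\cup(Q\times(\Sigma\times\Omega)\times Q)$ of read transitions $(p,a,q)$ and read-annotate transitions $(p,(a,o),q)$. A run over $d=a_1\cdots a_n\in\Sigma^*$ is a sequence $\rho=q_0\xrightarrow{b_1}q_1\cdots\xrightarrow{b_n}q_n$ such that, for every $i$, $(q_{i-1},b_i,q_i)\in\Delta$ and $b_i=a_i$ or $b_i=(a_i,o)$ for some $o\in\Omega$; it is accepting if $q_n\in F$. Its annotation $\mathrm{ann}(\rho)$ is the concatenation, for $i=1,\dots,n$, of $(o,i)$ if $b_i=(a_i,o)$ and of the empty string if $b_i=a_i$. Let $[\![\mathcal A]\!](d)=\{\mathrm{ann}(\rho)\mid\rho\text{ an accepting run of }\mathcal A\text{ over }d\}$. The automaton is *unambiguous* if for all $d\in\Sigma^*$ and $w\in[\![\mathcal A]\!](d)$ there is exactly one accepting run $\rho$ over $d$ with $\mathrm{ann}(\rho)=w$.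 Let $|\mathcal A|=|Q|+|\Delta|$. A *straight-line program* (SLP) over $\Sigma$ is a context-free grammar $S$ with a finite set $N$ of nonterminals and a start symbol $S_0\in N$, with exactly one rule $B\to R(B)\in(N\cup\Sigma)^*$ for each $B\in N$, and such that the directed graph on $N$ with an edge from $B$ to each nonterminal occurring in $R(B)$ is acyclic; $\mathrm{doc}(S)\in\Sigma^*$ is the unique string derived from $S_0$. Let $|S|=\sum_{B\in N}(|R(B)|+1)$. The computational model is the random access machine with integer registers and memory cells, uniform cost measure, and addition and subtraction as arithmetic operations. **Theorem.** There are a fixed enumeration algorithm, consisting of a preprocessing phase followed by an enumeration phase, and a constant $c$ such that for every unambiguous annotated automaton $\mathcal A$ and every SLP $S$ over its input alphabet, on input $(\mathcal A,S)$: 1. the preprocessing phase prints nothing and takes at most $c\cdot(|\mathcal A|+|S|\cdot|Q|^3)$ steps; 2. the enumeration phase, started in the configuration reached by the preprocessing, prints every element of $[\![\mathcal A]\!](\mathrm{doc}(S))$ exactly once, each followed by a separator, and then halts; 3. the delay is output-linear: for every output $w$, a string of $|w|$ pairs, the number of steps from the preceding separator (or from the start of the enumeration phase) up to and including the separator after $w$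 is at most $c\cdot(|w|+1)$, and the machine halts at most $c$ steps after the last separator (or after the start, if there are no outputs). -/

import Mathlib

/-! ## Annotated automata -/

/-- An annotated automaton with states `Q`, input alphabet `σ` and output alphabet `Ω`.
`(p, a, none, q) ∈ trans` is the read transition `(p, a, q)`;
`(p, a, some o, q) ∈ trans` is the read-annotate transition `(p, (a, o), q)`. -/
structure AnnA (Q σ Ω : Type*) where
  trans : Finset (Q × σ × Option Ω × Q)
  start : Q
  final : Finset Q

namespace AnnA

variable {Q σ Ω : Type*}

/-- `A.IsPath p d ρ q`: the list `ρ = [(b₁, q₁), …, (bₙ, qₙ)]` describes a run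
`p → q₁ → ⋯ → qₙ = q` over the document `d = a₁ ⋯ aₙ`, where the `i`-th step uses the transition
reading `aᵢ` and annotating `bᵢ` (`none`: no annotation). -/
def IsPath (A : AnnA Q σ Ω) : Q → List σ → List (Option Ω × Q) → Q → Prop
  | p, [], [], q => p = q
  | p, a :: d, (b, p₁) :: ρ, q => (p, a, b, p₁) ∈ A.trans ∧ IsPath A p₁ d ρ q
  | _, _, _, _ => False

/-- `ρ` is an accepting run over `d`. -/
def IsAcceptingRun (A : AnnA Q σ Ω) (d : List σ) (ρ : List (Option Ω × Q)) : Prop :=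
  ∃ q ∈ A.final, A.IsPath A.start d ρ q

/-- The annotation of a list of steps whose first step is at position `i`. -/
def annFrom : ℕ → List (Option Ω × Q) → List (Ω × ℕ)
  | _, [] => []
  | i, (none, _) :: ρ => annFrom (i + 1) ρ
  | i, (some o, _) :: ρ => (o, i) :: annFrom (i + 1) ρ

/-- The annotation `ann(ρ)` of a run; positions of the document are counted from `1`. -/
def ann (ρ : List (Option Ω × Q)) : List (Ω × ℕ) := annFrom 1 ρ

/-- The set of all annotations of accepting runs of `A` over `d`. -/
def outputs (A : AnnA Q σ Ω) (d : List σ) : Set (List (Ω × ℕ)) :=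
  {w | ∃ ρ, A.IsAcceptingRun d ρ ∧ ann ρ = w}

/-- Every output over every document is the annotation of exactly one accepting run. -/
def Unambiguous (A : AnnA Q σ Ω) : Prop :=
  ∀ d, ∀ w ∈ A.outputs d, ∃! ρ, A.IsAcceptingRun d ρ ∧ ann ρ = w

/-- The size `|A| = |Q| + |Δ|`. -/
def size [Fintype Q] (A : AnnA Q σ Ω) : ℕ := Fintype.card Q + A.trans.card

end AnnA

/-! ## Straight-line programs -/

/-- A straight-line program with nonterminals `N` over the alphabet `σ`: a grammar with exactly one
rule for each nonterminal and an acyclic dependency graph. In a right-hand side, `Sum.inl a` is a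
terminal and `Sum.inr B` a nonterminal. -/
structure SLP (N σ : Type*) where
  rule : N → List (σ ⊕ N)
  start : N
  acyclic : ∀ B, ¬ Relation.TransGen (fun X Y => Sum.inr X ∈ rule Y) B B

namespace SLP

variable {N σ : Type*}

theorem wf [Finite N] (S : SLP N σ) : WellFounded (fun X Y => Sum.inr X ∈ S.rule Y) := by
  have h : WellFounded (Relation.TransGen (fun X Y => Sum.inr X ∈ S.rule Y)) := by
    have : Std.Irrefl (Relation.TransGen (fun X Y => Sum.inr X ∈ S.rule Y)) := ⟨S.acyclic⟩
    exact Finite.wellFounded_of_trans_of_irrefl _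
  exact Subrelation.wf (fun hxy => Relation.TransGen.single hxy) h

/-- The document derived from a nonterminal. -/
noncomputable def expand [Finite N] (S : SLP N σ) : N → List σ :=
  S.wf.fix fun B ih => (S.rule B).attach.flatMap fun
    | ⟨Sum.inl a, _⟩ => [a]
    | ⟨Sum.inr C, h⟩ => ih C h

theorem expand_eq [Finite N] (S : SLP N σ) (B : N) :
    S.expand B = (S.rule B).flatMap (Sum.elim (fun a => [a]) S.expand) := by
  have h : S.expand B = (S.rule B).attach.flatMap
      (fun x => Sum.elim (fun a => [a]) S.expand x.1) := by
    unfold expand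
    rw [WellFounded.fix_eq]
    congr 1
    funext x
    rcases x with ⟨a | C, hx⟩ <;> rfl
  rw [h, List.flatMap_subtype (g := Sum.elim (fun a => [a]) S.expand) (fun _ _ => rfl),
    List.unattach_attach]

/-- The document `doc(S)` encoded by `S`. -/
noncomputable def doc [Finite N] (S : SLP N σ) : List σ := S.expand S.start

/-- The size `|S|`: the number of symbols in all rules, left-hand sides included.
(Without empty right-hand sides it lies between `∑ |R(B)|` and `2 * ∑ |R(B)|`.) -/
def size [Fintype N] (S : SLP N σ) : ℕ := ∑ B, ((S.rule B).length + 1)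

end SLP

/-! ## Random access machines with uniform cost -/

namespace RAM

/-- Machine state: work registers (a program mentions only finitely many of them) and the memory,
all holding integers. -/
structure State where
  reg : ℕ → ℤ
  mem : ℕ → ℤ

def State.setReg (s : State) (x : ℕ) (v : ℤ) : State := { s with reg := Function.update s.reg x v }

def State.setMem (s : State) (a : ℕ) (v : ℤ) : State := { s with mem := Function.update s.mem a v }

/-- RAM programs in structured form. Addition and subtraction are the only arithmetic operations. -/
inductive Prog where
  /-- `r_x := k` -/
  | const (x : ℕ) (k : ℤ)
  /-- `r_x := r_y + r_z` -/
  | add (x y z : ℕ)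
  /-- `r_x := r_y - r_z` -/
  | sub (x y z : ℕ)
  /-- `r_x := mem[r_y]` -/
  | load (x y : ℕ)
  /-- `mem[r_x] := r_y` -/
  | store (x y : ℕ)
  /-- print the integer `r_x` -/
  | print (x : ℕ)
  /-- print the separator -/
  | printSep
  /-- `p; q` -/
  | seq (p q : Prog)
  /-- `if 0 < r_x then p else q` -/
  | ifPos (x : ℕ) (p q : Prog)
  /-- `while 0 < r_x do p` -/
  | whilePos (x : ℕ) (p : Prog)

/-- What is visible from outside in one step of the machine: nothing (`tick`), a printed integer,
or a printed separator. -/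
inductive Event where
  | tick
  | val (z : ℤ)
  | sep

/-- `Exec p s t s'`: the program `p`, started in state `s`, terminates in state `s'` with trace `t`.
The trace has one entry for each executed instruction and each evaluated test, so its length is the
running time in the uniform cost measure. Access to a negative address aborts (no rule applies). -/
inductive Exec : Prog → State → List Event → State → Prop
  | const (s : State) (x : ℕ) (k : ℤ) : Exec (.const x k) s [.tick] (s.setReg x k)
  | add (s : State) (x y z : ℕ) :
      Exec (.add x y z) s [.tick] (s.setReg x (s.reg y + s.reg z))
  | sub (s : State) (x y z : ℕ) :
      Exec (.sub x y z) s [.tick] (s.setReg x (s.reg y - s.reg z))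
  | load (s : State) (x y : ℕ) (h : 0 ≤ s.reg y) :
      Exec (.load x y) s [.tick] (s.setReg x (s.mem (s.reg y).toNat))
  | store (s : State) (x y : ℕ) (h : 0 ≤ s.reg x) :
      Exec (.store x y) s [.tick] (s.setMem (s.reg x).toNat (s.reg y))
  | print (s : State) (x : ℕ) : Exec (.print x) s [.val (s.reg x)] s
  | printSep (s : State) : Exec .printSep s [.sep] s
  | seq {p q : Prog} {s s' s'' : State} {t t' : List Event} :
      Exec p s t s' → Exec q s' t' s'' → Exec (.seq p q) s (t ++ t') s''
  | if_pos {x : ℕ} {p q : Prog} {s s' : State} {t : List Event} :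
      0 < s.reg x → Exec p s t s' → Exec (.ifPos x p q) s (.tick :: t) s'
  | if_neg {x : ℕ} {p q : Prog} {s s' : State} {t : List Event} :
      s.reg x ≤ 0 → Exec q s t s' → Exec (.ifPos x p q) s (.tick :: t) s'
  | while_pos {x : ℕ} {p : Prog} {s s' s'' : State} {t t' : List Event} :
      0 < s.reg x → Exec p s t s' → Exec (.whilePos x p) s' t' s'' →
        Exec (.whilePos x p) s (.tick :: (t ++ t')) s''
  | while_neg {x : ℕ} {p : Prog} {s : State} :
      s.reg x ≤ 0 → Exec (.whilePos x p) s [.tick] s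

/-- The initial state: the input is stored from address `0` on, everything else is `0`. -/
def init (input : List ℕ) : State where
  reg := fun _ => 0
  mem := fun a => (input.getD a 0 : ℕ)

/-- Nothing is printed. -/
def Silent (t : List Event) : Prop := ∀ e ∈ t, e = .tick

/-- The printed part of a trace. -/
def printed (t : List Event) : List Event :=
  t.filter fun
    | .tick => false
    | _ => true

/-- How an output `(o₁, i₁) ⋯ (oₖ, iₖ)` is printed: the numbers `o₁, i₁, …, oₖ, iₖ`. -/
def printedForm {m : ℕ} (w : List (Fin m × ℕ)) : List Event :=
  w.flatMap fun x => [.val ((x.1 : ℕ) : ℤ), .val (x.2 : ℤ)]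

/-- The trace prints exactly the outputs `w₁, w₂, …` of the list, in this order and each followed
by a separator. It takes at most `c * (|w| + 1)` steps from the preceding separator (or the start)
up to and including the separator after `w`, and at most `c` steps after the last separator
(or from the start, if there is no output) until it halts. -/
def PrintsWithDelay {m : ℕ} (c : ℕ) : List (List (Fin m × ℕ)) → List Event → Prop
  | [], t => Silent t ∧ t.length ≤ c
  | w :: ws, t => ∃ u t', t = u ++ Event.sep :: t' ∧ printed u = printedForm w ∧
      u.length + 1 ≤ c * (w.length + 1) ∧ PrintsWithDelay c ws t'

/-- On the given input, the preprocessing program `pre` terminates silently within `T` steps, and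
the enumeration program `enum`, started in the state that `pre` has reached, prints each element of
`L` exactly once, with output-linear delay with constant `c`, and then halts. -/
def Enumerates {m : ℕ} (pre enum : Prog) (c T : ℕ) (input : List ℕ)
    (L : Set (List (Fin m × ℕ))) : Prop :=
  ∃ (t₁ t₂ : List Event) (s₁ s₂ : State) (ws : List (List (Fin m × ℕ))),
    Exec pre (init input) t₁ s₁ ∧ Silent t₁ ∧ t₁.length ≤ T ∧
    Exec enum s₁ t₂ s₂ ∧ ws.Nodup ∧ (∀ w, w ∈ ws ↔ w ∈ L) ∧ PrintsWithDelay c ws t₂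

end RAM

/-! ## Input encoding

States, letters, output symbols and nonterminals are numbered from `0`. -/

/-- A transition takes four cells; the third is `0` for a read transition and `o + 1` if `o` is
annotated. -/
def encodeTransition {nQ nσ nΩ : ℕ} : Fin nQ × Fin nσ × Option (Fin nΩ) × Fin nQ → List ℕ
  | (p, a, none, q) => [p, a, 0, q]
  | (p, a, some o, q) => [p, a, (o : ℕ) + 1, q]

/-- Terminal `a` is written as `a`, nonterminal `B` as `nσ + B`. -/
def encodeSymbol {nσ nN : ℕ} : Fin nσ ⊕ Fin nN → ℕ
  | Sum.inl a => a
  | Sum.inr B => nσ + B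

/-- The rules in the order of their left-hand sides, each preceded by its length. -/
def encodeSLP {nσ nN : ℕ} (S : SLP (Fin nN) (Fin nσ)) : List ℕ :=
  [nN, (S.start : ℕ)] ++
    (List.finRange nN).flatMap fun B => (S.rule B).length :: (S.rule B).map encodeSymbol

/-- `input` is a description of `A` and `S`; final states and transitions are listed without
repetition, in any order. -/
def Encodes {nQ nσ nΩ nN : ℕ} (A : AnnA (Fin nQ) (Fin nσ) (Fin nΩ)) (S : SLP (Fin nN) (Fin nσ))
    (input : List ℕ) : Prop :=
  ∃ (fs : List (Fin nQ)) (ts : List (Fin nQ × Fin nσ × Option (Fin nΩ) × Fin nQ)),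
    fs.Nodup ∧ (∀ q, q ∈ fs ↔ q ∈ A.final) ∧ ts.Nodup ∧ (∀ e, e ∈ ts ↔ e ∈ A.trans) ∧
    input = [nσ, nΩ, nQ, (A.start : ℕ)] ++ (fs.length :: fs.map Fin.val) ++
      (ts.length :: ts.flatMap encodeTransition) ++ encodeSLP S

set_option linter.unusedSimpArgs false

/-! For a document d and states p, q consider the set of annotations of the runs from p to q over d.
These sets form a |Q| × |Q| matrix. A run over a concatenation splits uniquely at its middle state,
so the matrix of dd' is a product in which "sum" is union over the middle state and "product" is
concatenation, with the positions of the right factor moved by |d| (`paths_append`, `annZ_append`).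
Hence the matrices of all nonterminals below the start symbol arise from those of the letters by one
matrix product per symbol occurrence in a rule, that is, |Q|³ set operations each. A depth-first
search with an explicit stack finds an order in which the factors are always ready
(`visit_nonterminal`).

The sets can be exponentially large, so every set operation must take constant time on an implicit,
shared representation (`Rep`). A node stands for a nonempty list of nonempty outputs. It exposes an
item, which is a single symbol or a product of two nodes, and a rest, which is a linked list of
further nodes. Each pointer carries a shift to be added to all positions below it, so moving a whole
set costs one addition. The union of two nodes keeps the item of the first and inserts the second in
front of its rest (`union_spec`). Only fresh records are written, so old ones can be shared freely.
The empty output is kept outside as a flag. A product of two entries is then the union of at most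
three sets of nonempty outputs (`mulL`, `combine_spec`).

The enumeration reads off outputs from right to left. At a node it saves the rest on a stack of
alternatives and follows the item. At a product it puts the left factor on a continuation and enters
the right one. At a symbol it extends the output and takes up the next continuation. Since no factor
contains the empty output, an output with ℓ symbols meets exactly ℓ symbols and ℓ - 1 products,
which bounds its cost linearly in ℓ (`Rep.explores`, `Cont.run`). Every saved alternative is
nonempty, so no time is spent on dead ends (`find_spec`, `enum_loop`).

Freedom from repetition is tracked on runs and not on outputs: `Cov` says that the listed
annotations come from pairwise distinct runs and miss no nonempty annotation. This is preserved by
disjoint unions and by products for every automaton, even where intermediate sets contain an output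
twice. For the accepting runs, unambiguity turns distinct runs into distinct outputs
(`Cov.outputs`).

The programs are written in a while language whose steps compile to boundedly many machine steps.
The compiled trace only has extra ticks in front of each event, at most a constant number, so all
time and delay bounds survive up to a constant factor (`HExec.exec_comp`,
`PrintsWithDelay.stretch`). -/

namespace RAM

/-! ## A while language over the RAM -/

/-- Expressions of the while language. -/
inductive Expr where
  | var (x : ℕ)
  | lit (k : ℤ)
  | plus (a b : Expr)
  | minus (a b : Expr)
  | get (a : Expr)

/-- Configurations of the while language: variables, and a memory addressed by integers. -/
structure Conf where
  v : ℕ → ℤ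
  m : ℤ → ℤ

/-- Change the value of a function at one point. -/
def upd {α : Type*} [DecidableEq α] (f : α → ℤ) (a : α) (b : ℤ) (x : α) : ℤ :=
  if x = a then b else f x

/-- Write a record of five cells. -/
def block (m : ℤ → ℤ) (h a b c d e : ℤ) : ℤ → ℤ :=
  upd (upd (upd (upd (upd m h a) (h + 1) b) (h + 2) c) (h + 3) d) (h + 4) e

namespace Expr

def eval (s : Conf) : Expr → ℤ
  | var x => s.v x
  | lit k => k
  | plus a b => a.eval s + b.eval s
  | minus a b => a.eval s - b.eval s
  | get a => s.m (a.eval s)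

/-- Put the value of the expression into the register `2 * k + 1`, using only odd registers
from there on. -/
def comp : ℕ → Expr → Prog
  | k, var x => .seq (.const (2 * k + 1) 0) (.add (2 * k + 1) (2 * x) (2 * k + 1))
  | k, lit c => .const (2 * k + 1) c
  | k, plus a b => .seq (comp k a) (.seq (comp (k + 1) b)
      (.add (2 * k + 1) (2 * k + 1) (2 * (k + 1) + 1)))
  | k, minus a b => .seq (comp k a) (.seq (comp (k + 1) b)
      (.sub (2 * k + 1) (2 * k + 1) (2 * (k + 1) + 1)))
  | k, get a => .seq (comp k a) (.seq (.const (2 * (k + 1) + 1) 1)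
      (.seq (.add (2 * (k + 1) + 1) (2 * k + 1) (2 * (k + 1) + 1))
        (.ifPos (2 * (k + 1) + 1) (.load (2 * k + 1) (2 * k + 1)) (.const (2 * k + 1) 0))))

/-- Bound for the running time of the compiled expression. -/
def cost : Expr → ℕ
  | var _ => 2
  | lit _ => 1
  | plus a b => a.cost + b.cost + 1
  | minus a b => a.cost + b.cost + 1
  | get a => a.cost + 4

end Expr

/-- Commands of the while language. `alloc x a b c d e` writes a record of five cells at the address
in variable `0`, which it increases by `5`, and puts its address into `x`. -/
inductive Cmd where
  | skip
  | assign (x : ℕ) (e : Expr)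
  | store (a e : Expr)
  | alloc (x : ℕ) (a b c d e : Expr)
  | print (e : Expr)
  | sep
  | seq (p q : Cmd)
  | ite (e : Expr) (p q : Cmd)
  | loop (e : Expr) (p : Cmd)

/-- Big-step semantics of the while language. -/
inductive HExec : Cmd → Conf → List Event → Conf → Prop
  | skip (s : Conf) : HExec .skip s [.tick] s
  | assign (s : Conf) (x : ℕ) (e : Expr) :
      HExec (.assign x e) s [.tick] ⟨upd s.v x (e.eval s), s.m⟩
  | store (s : Conf) (a e : Expr) (h : 0 ≤ a.eval s) :
      HExec (.store a e) s [.tick] ⟨s.v, upd s.m (a.eval s) (e.eval s)⟩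
  | alloc (s : Conf) (x : ℕ) (a b c d e : Expr) (h : 0 ≤ s.v 0) :
      HExec (.alloc x a b c d e) s [.tick] ⟨upd (upd s.v x (s.v 0)) 0 (s.v 0 + 5),
        block s.m (s.v 0) (a.eval s) (b.eval s) (c.eval s) (d.eval s) (e.eval s)⟩
  | print (s : Conf) (e : Expr) : HExec (.print e) s [.val (e.eval s)] s
  | sep (s : Conf) : HExec .sep s [.sep] s
  | seq {p q : Cmd} {s s' s'' : Conf} {t t' : List Event} :
      HExec p s t s' → HExec q s' t' s'' → HExec (.seq p q) s (t ++ t') s''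
  | ite_pos {e : Expr} {p q : Cmd} {s s' : Conf} {t : List Event} :
      0 < e.eval s → HExec p s t s' → HExec (.ite e p q) s (.tick :: t) s'
  | ite_neg {e : Expr} {p q : Cmd} {s s' : Conf} {t : List Event} :
      e.eval s ≤ 0 → HExec q s t s' → HExec (.ite e p q) s (.tick :: t) s'
  | loop_pos {e : Expr} {p : Cmd} {s s' s'' : Conf} {t t' : List Event} :
      0 < e.eval s → HExec p s t s' → HExec (.loop e p) s' t' s'' →
        HExec (.loop e p) s (.tick :: (t ++ t')) s''
  | loop_neg {e : Expr} {p : Cmd} {s : Conf} :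
      e.eval s ≤ 0 → HExec (.loop e p) s [.tick] s

namespace Cmd

/-- Compilation to the RAM: variable `x` lives in register `2 * x`. -/
def comp : Cmd → Prog
  | skip => .const 1 0
  | assign x e => .seq (e.comp 0) (.seq (.const 3 0) (.add (2 * x) 1 3))
  | store a e => .seq (a.comp 0) (.seq (e.comp 1) (.store 1 3))
  | alloc x a b c d e =>
      .seq (a.comp 0) (.seq (b.comp 1) (.seq (c.comp 2) (.seq (d.comp 3) (.seq (e.comp 4)
      (.seq (.const 11 1) (.seq (.const 13 0) (.seq (.add 13 0 13)
      (.seq (.store 13 1) (.seq (.add 13 13 11)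
      (.seq (.store 13 3) (.seq (.add 13 13 11)
      (.seq (.store 13 5) (.seq (.add 13 13 11)
      (.seq (.store 13 7) (.seq (.add 13 13 11)
      (.seq (.store 13 9) (.seq (.add 13 13 11)
      (.seq (.const 11 0) (.seq (.add (2 * x) 0 11) (.add 0 13 11))))))))))))))))))))
  | print e => .seq (e.comp 0) (.print 1)
  | sep => .printSep
  | seq p q => .seq p.comp q.comp
  | ite e p q => .seq (e.comp 0) (.ifPos 1 p.comp q.comp)
  | loop e p => .seq (e.comp 0) (.whilePos 1 (.seq p.comp (e.comp 0)))

/-- Bound for the number of steps of the compiled program between two steps of the program. -/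
def overhead : Cmd → ℕ
  | skip => 0
  | assign _ e => e.cost + 2
  | store a e => a.cost + e.cost + 1
  | alloc _ a b c d e => a.cost + b.cost + c.cost + d.cost + e.cost + 16
  | print e => e.cost
  | sep => 0
  | seq p q => p.overhead + q.overhead
  | ite e p q => e.cost + p.overhead + q.overhead
  | loop e p => e.cost + p.overhead

end Cmd

/-! ### Correctness of the compilation, and its effect on running time and delay. -/

/-- The register machine state `r` represents the configuration `s`. -/
structure Sim (r : State) (s : Conf) : Prop where
  reg : ∀ x, r.reg (2 * x) = s.v x
  mem : ∀ n : ℕ, r.mem n = s.m n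
  neg : ∀ z < 0, s.m z = 0

theorem Silent.append {t t' : List Event} (h : Silent t) (h' : Silent t') : Silent (t ++ t') := by
  intro e he
  rcases List.mem_append.1 he with he | he
  exacts [h e he, h' e he]

theorem silent_tick : Silent [.tick] := by simp [Silent]

theorem Silent.tick_cons {t : List Event} (h : Silent t) : Silent (.tick :: t) :=
  silent_tick.append h

theorem silent_nil : Silent [] := by simp [Silent]

/-- Variables live in even registers and intermediate values in odd ones. A subexpression evaluated
at level k only touches odd registers from level k on. The last clause of the conclusion is what
lets the first operand survive the evaluation of the second. -/
theorem Expr.exec_comp (e : Expr) (k : ℕ) (r : State) (s : Conf) (h : Sim r s) :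
    ∃ t r', Exec (e.comp k) r t r' ∧ Silent t ∧ t.length ≤ e.cost ∧
      r'.reg (2 * k + 1) = e.eval s ∧ r'.mem = r.mem ∧ (∀ x, r'.reg (2 * x) = r.reg (2 * x)) ∧
      ∀ j < k, r'.reg (2 * j + 1) = r.reg (2 * j + 1) := by
  induction e generalizing k r with
  | var x =>
    refine ⟨_, _, .seq (.const _ _ _) (.add _ _ _ _), by simp [Silent], by simp [cost], ?_, rfl,
      fun y => ?_, fun j hj => ?_⟩
    · have : 2 * x ≠ 2 * k + 1 := by omega
      simp [State.setReg, Function.update_apply, this, eval, h.reg]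
    · have : 2 * y ≠ 2 * k + 1 := by omega
      simp [State.setReg, Function.update_apply, this]
    · have : j ≠ k := by omega
      simp [State.setReg, Function.update_apply, this]
  | lit c =>
    refine ⟨_, _, .const _ _ _, by simp [Silent], by simp [cost], ?_, rfl,
      fun y => ?_, fun j hj => ?_⟩
    · simp [State.setReg, eval]
    · have : 2 * y ≠ 2 * k + 1 := by omega
      simp [State.setReg, Function.update_apply, this]
    · have : j ≠ k := by omega
      simp [State.setReg, Function.update_apply, this]
  | plus a b iha ihb =>
    obtain ⟨t, r1, h1, hs1, hl1, hv1, hm1, hr1, hk1⟩ := iha k r h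
    have hsim : Sim r1 s := ⟨fun x => by rw [hr1, h.reg], fun n => by rw [hm1, h.mem], h.neg⟩
    obtain ⟨t', r2, h2, hs2, hl2, hv2, hm2, hr2, hk2⟩ := ihb (k + 1) r1 hsim
    refine ⟨_, _, .seq h1 (.seq h2 (.add _ _ _ _)), hs1.append (hs2.append silent_tick), ?_, ?_, ?_,
      fun y => ?_, fun j hj => ?_⟩
    · simp [cost]; omega
    · simp [State.setReg, eval, hv2, hk2 k (by omega), hv1]
    · simp [State.setReg, hm2, hm1]
    · have : 2 * y ≠ 2 * k + 1 := by omega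
      simp [State.setReg, Function.update_apply, this, hr2, hr1]
    · have : j ≠ k := by omega
      simp [State.setReg, Function.update_apply, this, hk2 j (by omega), hk1 j hj]
  | minus a b iha ihb =>
    obtain ⟨t, r1, h1, hs1, hl1, hv1, hm1, hr1, hk1⟩ := iha k r h
    have hsim : Sim r1 s := ⟨fun x => by rw [hr1, h.reg], fun n => by rw [hm1, h.mem], h.neg⟩
    obtain ⟨t', r2, h2, hs2, hl2, hv2, hm2, hr2, hk2⟩ := ihb (k + 1) r1 hsim
    refine ⟨_, _, .seq h1 (.seq h2 (.sub _ _ _ _)), hs1.append (hs2.append silent_tick), ?_, ?_, ?_,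
      fun y => ?_, fun j hj => ?_⟩
    · simp [cost]; omega
    · simp [State.setReg, eval, hv2, hk2 k (by omega), hv1]
    · simp [State.setReg, hm2, hm1]
    · have : 2 * y ≠ 2 * k + 1 := by omega
      simp [State.setReg, Function.update_apply, this, hr2, hr1]
    · have : j ≠ k := by omega
      simp [State.setReg, Function.update_apply, this, hk2 j (by omega), hk1 j hj]
  | get a iha =>
    obtain ⟨t, r1, h1, hs1, hl1, hv1, hm1, hr1, hk1⟩ := iha k r h
    -- The compiled code tests address + 1, which is positive exactly for admissible addresses, and
    -- otherwise returns 0. This agrees with `Sim.neg`, so reading never aborts and needs no side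
    -- condition later.
    by_cases hneg : 0 ≤ a.eval s
    · refine ⟨_, _, .seq h1 (.seq (.const _ _ _) (.seq (.add _ _ _ _)
        (.if_pos ?_ (.load _ _ _ ?_)))), hs1.append (by simp [Silent]), ?_, ?_, ?_,
        fun y => ?_, fun j hj => ?_⟩
      · simp [State.setReg, Function.update_apply, hv1]; omega
      · simp [State.setReg, Function.update_apply, hv1, hneg]
      · simp [cost]; omega
      · simp [State.setReg, Function.update_apply, hv1, hm1, eval, h.mem, hneg]
      · simp [State.setReg, hm1]
      · have : 2 * y ≠ 2 * k + 1 := by omega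
        have : 2 * y ≠ 2 * (k + 1) + 1 := by omega
        simp [State.setReg, Function.update_apply, hr1, *]
      · have : j ≠ k := by omega
        have : j ≠ k + 1 := by omega
        simp [State.setReg, Function.update_apply, hk1, *]
    · refine ⟨_, _, .seq h1 (.seq (.const _ _ _) (.seq (.add _ _ _ _)
        (.if_neg ?_ (.const _ _ _)))), hs1.append (by simp [Silent]), ?_, ?_, ?_,
        fun y => ?_, fun j hj => ?_⟩
      · simp [State.setReg, Function.update_apply, hv1]; omega
      · simp [cost]; omega
      · simp [State.setReg, Function.update_apply, eval, h.neg _ (not_le.1 hneg)]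
      · simp [State.setReg, hm1]
      · have : 2 * y ≠ 2 * k + 1 := by omega
        have : 2 * y ≠ 2 * (k + 1) + 1 := by omega
        simp [State.setReg, Function.update_apply, hr1, *]
      · have : j ≠ k := by omega
        have : j ≠ k + 1 := by omega
        simp [State.setReg, Function.update_apply, hk1, *]

/-- `t'` arises from `t` by inserting at most `K` ticks before each event. -/
inductive Stretch (K : ℕ) : List Event → List Event → Prop
  | nil : Stretch K [] []
  | cons {e : Event} {t t' u : List Event} :
      Silent u → u.length ≤ K → Stretch K t t' → Stretch K (e :: t) (u ++ e :: t')

theorem Stretch.mono {K K' : ℕ} (hK : K ≤ K') {t t' : List Event} (h : Stretch K t t') :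
    Stretch K' t t' := by
  induction h with
  | nil => exact .nil
  | cons hu hl _ ih => exact .cons hu (hl.trans hK) ih

theorem Stretch.append {K : ℕ} {t t' u u' : List Event} (h : Stretch K t t')
    (h' : Stretch K u u') : Stretch K (t ++ u) (t' ++ u') := by
  induction h with
  | nil => exact h'
  | cons hu hl _ ih => simpa using Stretch.cons hu hl ih

theorem Stretch.single {K : ℕ} (e : Event) {u : List Event} (h : Silent u) (hl : u.length ≤ K) :
    Stretch K [e] (u ++ [e]) := .cons h hl .nil

theorem Stretch.of_append {K : ℕ} {t u v : List Event} (h : Stretch K (t ++ u) v) :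
    ∃ t' u', v = t' ++ u' ∧ Stretch K t t' ∧ Stretch K u u' := by
  induction t generalizing v with
  | nil => exact ⟨[], v, rfl, .nil, h⟩
  | cons e t ih =>
    cases h with
    | cons hu hl h =>
      obtain ⟨t', u', rfl, h1, h2⟩ := ih h
      exact ⟨_, u', by simp, .cons hu hl h1, h2⟩

theorem Stretch.silent {K : ℕ} {t t' : List Event} (h : Stretch K t t') (hs : Silent t) :
    Silent t' := by
  induction h with
  | nil => exact hs
  | @cons e t t' u hu hl _ ih =>
    have he : e = .tick := hs e (by simp)
    subst he
    exact hu.append (ih fun e he => hs e (by simp [he])).tick_cons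

theorem Stretch.length_le {K : ℕ} {t t' : List Event} (h : Stretch K t t') :
    t'.length ≤ (K + 1) * t.length := by
  induction h with
  | nil => simp
  | cons hu hl _ ih => simp only [List.length_append, List.length_cons]; linarith

theorem Silent.printed_eq {t : List Event} (h : Silent t) : printed t = [] := by
  rw [printed, List.filter_eq_nil_iff]
  intro e he
  simp [h e he]

theorem printed_append (t u : List Event) : printed (t ++ u) = printed t ++ printed u :=
  List.filter_append ..

theorem Stretch.printed_eq {K : ℕ} {t t' : List Event} (h : Stretch K t t') :
    printed t' = printed t := by
  induction h with
  | nil => rfl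
  | @cons e t t' u hu hl _ ih =>
    rw [printed_append, hu.printed_eq, List.nil_append, ← List.singleton_append,
      printed_append, ih, ← printed_append, List.singleton_append]

/-- Inserted ticks precede their event, so those in front of a separator are charged to the output
that this separator ends. Every event of the old trace thus accounts for at most K + 1 events of the
new one, segment by segment. -/
theorem PrintsWithDelay.stretch {n c K : ℕ} {ws : List (List (Fin n × ℕ))} {t t' : List Event}
    (h : PrintsWithDelay c ws t) (hs : Stretch K t t') :
    PrintsWithDelay ((K + 1) * c) ws t' := by
  induction ws generalizing t t' with
  | nil => exact ⟨hs.silent h.1, hs.length_le.trans (Nat.mul_le_mul_left _ h.2)⟩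
  | cons w ws ih =>
    obtain ⟨u, t1, rfl, hp, hl, ht⟩ := h
    obtain ⟨u', v', rfl, hu, hv⟩ := hs.of_append
    cases hv with
    | @cons _ _ t2 y hy hyl hv =>
      refine ⟨u' ++ y, _, by simp, ?_, ?_, ih ht hv⟩
      · rw [printed_append, hy.printed_eq, List.append_nil, hu.printed_eq, hp]
      · have := hu.length_le
        have h1 := Nat.mul_le_mul_left (K + 1) hl
        rw [List.length_append]
        rw [mul_assoc]
        linarith

/-- Induction on the execution. The overhead depends on the program text only, neither on the input
nor on the number of iterations, and it bounds the ticks in front of every single event and not just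
their average. -/
theorem HExec.exec_comp {p : Cmd} {s s' : Conf} {t : List Event} (h : HExec p s t s') :
    ∀ r, Sim r s → ∃ t' r', Exec p.comp r t' r' ∧ Sim r' s' ∧ Stretch p.overhead t t' := by
  induction h with
  | skip s =>
    intro r hr
    refine ⟨_, _, .const _ _ _, ⟨fun x => ?_, hr.mem, hr.neg⟩, .single (u := []) _ silent_nil
      (by simp)⟩
    have : 2 * x ≠ 1 := by omega
    simp [State.setReg, Function.update_apply, this, hr.reg]
  | assign s x e =>
    intro r hr
    obtain ⟨t, r1, h1, hs1, hl1, hv1, hm1, hr1, -⟩ := e.exec_comp 0 r s hr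
    refine ⟨_, _, .seq h1 (.seq (.const _ _ _) (.add _ _ _ _)), ⟨fun y => ?_, fun n => ?_, hr.neg⟩,
      ?_⟩
    · have : 2 * y ≠ 3 := by omega
      simp only [mul_zero, zero_add] at hv1
      simp [State.setReg, Function.update_apply, upd, hv1, hr1, this, hr.reg]
    · simp [State.setReg, hm1, hr.mem]
    · have := Stretch.single (K := (Cmd.assign x e).overhead) (u := t ++ [.tick]) .tick
        (hs1.append silent_tick) (by simp [Cmd.overhead]; omega)
      simpa using this
  | store s a e h =>
    intro r hr
    obtain ⟨t, r1, h1, hs1, hl1, hv1, hm1, hr1, -⟩ := a.exec_comp 0 r s hr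
    have hsim : Sim r1 s := ⟨fun x => by rw [hr1, hr.reg], fun n => by rw [hm1, hr.mem], hr.neg⟩
    obtain ⟨t', r2, h2, hs2, hl2, hv2, hm2, hr2, hk2⟩ := e.exec_comp 1 r1 s hsim
    have hk := hk2 0 (by omega)
    simp only [mul_zero, zero_add, mul_one, Nat.reduceAdd] at hv1 hk hv2
    refine ⟨_, _, .seq h1 (.seq h2 (.store _ _ _ (by rw [hk, hv1]; exact h))),
      ⟨fun y => ?_, fun n => ?_, fun z hz => ?_⟩, ?_⟩
    · simp [State.setMem, hr2, hr1, hr.reg]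
    · simp only [State.setMem, hk, hv1, hv2, hm2, hm1, upd, Function.update_apply, hr.mem]
      congr 1
      exact propext ⟨fun h' => by omega, fun h' => by omega⟩
    · simp only [upd]
      rw [if_neg (by omega), hr.neg z hz]
    · have := Stretch.single (K := (Cmd.store a e).overhead) (u := t ++ t') .tick
        (hs1.append hs2) (by simp [Cmd.overhead]; omega)
      simpa using this
  | alloc s x a b c d e h =>
    intro r hr
    obtain ⟨t1, r1, h1, hs1, hl1, hv1, hm1, hr1, -⟩ := a.exec_comp 0 r s hr
    have hsim1 : Sim r1 s := ⟨fun x => by rw [hr1, hr.reg], fun n => by rw [hm1, hr.mem], hr.neg⟩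
    obtain ⟨t2, r2, h2, hs2, hl2, hv2, hm2, hr2, hk2⟩ := b.exec_comp 1 r1 s hsim1
    have hsim2 : Sim r2 s :=
      ⟨fun x => by rw [hr2, hsim1.reg], fun n => by rw [hm2, hsim1.mem], hr.neg⟩
    obtain ⟨t3, r3, h3, hs3, hl3, hv3, hm3, hr3, hk3⟩ := c.exec_comp 2 r2 s hsim2
    have hsim3 : Sim r3 s :=
      ⟨fun x => by rw [hr3, hsim2.reg], fun n => by rw [hm3, hsim2.mem], hr.neg⟩
    obtain ⟨t4, r4, h4, hs4, hl4, hv4, hm4, hr4, hk4⟩ := d.exec_comp 3 r3 s hsim3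
    have hsim4 : Sim r4 s :=
      ⟨fun x => by rw [hr4, hsim3.reg], fun n => by rw [hm4, hsim3.mem], hr.neg⟩
    obtain ⟨t5, r5, h5, hs5, hl5, hv5, hm5, hr5, hk5⟩ := e.exec_comp 4 r4 s hsim4
    have hsim5 : Sim r5 s :=
      ⟨fun x => by rw [hr5, hsim4.reg], fun n => by rw [hm5, hsim4.mem], hr.neg⟩
    -- The values of the first four arguments survive the evaluation of the later ones, which use
    -- higher odd registers only.
    have g1 := hk5 0 (by omega)
    have g2 := hk5 1 (by omega)
    have g3 := hk5 2 (by omega)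
    have g4 := hk5 3 (by omega)
    rw [hk4 0 (by omega), hk3 0 (by omega), hk2 0 (by omega), hv1] at g1
    rw [hk4 1 (by omega), hk3 1 (by omega), hv2] at g2
    rw [hk4 2 (by omega), hv3] at g3
    rw [hv4] at g4
    have g0 := hsim5.reg 0
    simp only [mul_zero, zero_add, mul_one, Nat.reduceMul, Nat.reduceAdd] at g0 g1 g2 g3 g4 hv5
    refine ⟨_, _, .seq h1 (.seq h2 (.seq h3 (.seq h4 (.seq h5
      (.seq (.const _ _ _) (.seq (.const _ _ _) (.seq (.add _ _ _ _)
      (.seq (.store _ _ _ ?_) (.seq (.add _ _ _ _)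
      (.seq (.store _ _ _ ?_) (.seq (.add _ _ _ _)
      (.seq (.store _ _ _ ?_) (.seq (.add _ _ _ _)
      (.seq (.store _ _ _ ?_) (.seq (.add _ _ _ _)
      (.seq (.store _ _ _ ?_) (.seq (.add _ _ _ _)
      (.seq (.const _ _ _) (.seq (.add _ _ _ _) (.add _ _ _ _)))))))))))))))))))),
      ⟨fun y => ?_, fun n => ?_, fun z hz => ?_⟩, ?_⟩
    · simp [State.setReg, State.setMem, Function.update_apply, g0]; omega
    · simp [State.setReg, State.setMem, Function.update_apply, g0]; omega
    · simp [State.setReg, State.setMem, Function.update_apply, g0]; omega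
    · simp [State.setReg, State.setMem, Function.update_apply, g0]; omega
    · simp [State.setReg, State.setMem, Function.update_apply, g0]; omega
    · have e1 : 2 * y ≠ 11 := by omega
      have e2 : 2 * y ≠ 13 := by omega
      by_cases hx : x = 0
      · subst hx
        simp [State.setReg, State.setMem, Function.update_apply, g0, e1, e2, hsim5.reg, upd]
        split_ifs <;> omega
      · have e3 : 0 ≠ 2 * x := by omega
        have e4 : 13 ≠ 2 * x := by omega
        have e5 : 11 ≠ 2 * x := by omega
        simp [State.setReg, State.setMem, Function.update_apply, g0, e1, e2, e4, e5, hsim5.reg, upd]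
        split_ifs <;> omega
    · simp only [State.setReg, State.setMem, Function.update_apply, g0, g1, g2, g3, g4, hv5, block,
        upd, hsim5.mem]
      simp only [Nat.reduceEqDiff, if_true, if_false, reduceIte, OfNat.zero_ne_ofNat, add_zero,
        OfNat.ofNat_ne_zero, OfNat.one_ne_ofNat]
      have q : ∀ z : ℤ, 0 ≤ z → (n = z.toNat ↔ (n : ℤ) = z) := fun z hz => by omega
      simp only [add_assoc, Int.reduceAdd]
      simp only [q _ h, q (s.v 0 + 1) (by omega), q (s.v 0 + 2) (by omega),
        q (s.v 0 + 3) (by omega), q (s.v 0 + 4) (by omega)]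
    · simp only [block, upd]
      rw [if_neg (by omega), if_neg (by omega), if_neg (by omega), if_neg (by omega),
        if_neg (by omega), hr.neg z hz]
    -- After the five arguments 16 instructions follow; the last one is the tick of the source step
    -- and 15 are inserted before it.
    · have := Stretch.single (K := (Cmd.alloc x a b c d e).overhead)
        (u := t1 ++ (t2 ++ (t3 ++ (t4 ++ (t5 ++ List.replicate 15 .tick))))) .tick
        (hs1.append (hs2.append (hs3.append (hs4.append (hs5.append (by simp [Silent]))))))
        (by simp [Cmd.overhead]; omega)
      simpa [List.replicate] using this
  | print s e =>
    intro r hr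
    obtain ⟨t, r1, h1, hs1, hl1, hv1, hm1, hr1, -⟩ := e.exec_comp 0 r s hr
    have h2 := Exec.print r1 1
    simp only [mul_zero, zero_add] at hv1
    rw [hv1] at h2
    exact ⟨_, _, .seq h1 h2,
      ⟨fun x => by rw [hr1, hr.reg], fun n => by rw [hm1, hr.mem], hr.neg⟩, .single _ hs1 hl1⟩
  | sep s =>
    intro r hr
    exact ⟨_, _, .printSep _, hr, .single (u := []) _ silent_nil (by simp)⟩
  | seq _ _ ih1 ih2 =>
    intro r hr
    obtain ⟨t1, r1, h1, hr1, hs1⟩ := ih1 r hr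
    obtain ⟨t2, r2, h2, hr2, hs2⟩ := ih2 r1 hr1
    exact ⟨_, _, .seq h1 h2, hr2, (hs1.mono (Nat.le_add_right ..)).append
      (hs2.mono (Nat.le_add_left ..))⟩
  | @ite_pos e p q s s' t hpos _ ih =>
    intro r hr
    obtain ⟨t, r1, h1, hs1, hl1, hv1, hm1, hr1, -⟩ := e.exec_comp 0 r s hr
    obtain ⟨t2, r2, h2, hr2, hs2⟩ := ih r1
      ⟨fun x => by rw [hr1, hr.reg], fun n => by rw [hm1, hr.mem], hr.neg⟩
    exact ⟨_, _, .seq h1 (.if_pos (by simpa [← hv1] using hpos) h2), hr2,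
      .cons hs1 (by simp only [Cmd.overhead]; omega)
        (hs2.mono (by simp only [Cmd.overhead]; omega))⟩
  | @ite_neg e p q s s' t hpos _ ih =>
    intro r hr
    obtain ⟨t, r1, h1, hs1, hl1, hv1, hm1, hr1, -⟩ := e.exec_comp 0 r s hr
    obtain ⟨t2, r2, h2, hr2, hs2⟩ := ih r1
      ⟨fun x => by rw [hr1, hr.reg], fun n => by rw [hm1, hr.mem], hr.neg⟩
    exact ⟨_, _, .seq h1 (.if_neg (by simpa [← hv1] using hpos) h2), hr2,
      .cons hs1 (by simp only [Cmd.overhead]; omega)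
        (hs2.mono (by simp only [Cmd.overhead]; omega))⟩
  | @loop_pos e p s s' s'' t t' hpos _ _ ih1 ih2 =>
    intro r hr
    obtain ⟨u, r1, h1, hs1, hl1, hv1, hm1, hr1, -⟩ := e.exec_comp 0 r s hr
    obtain ⟨t1, r2, h2, hr2, hs2⟩ := ih1 r1
      ⟨fun x => by rw [hr1, hr.reg], fun n => by rw [hm1, hr.mem], hr.neg⟩
    obtain ⟨t2, r3, h3, hr3, hs3⟩ := ih2 r2 hr2
    -- The compiled loop evaluates its guard before entry and again at the end of the body. The
    -- guard evaluation with which the remaining loop starts is therefore regrouped into the present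
    -- iteration; the trace itself is the same.
    cases h3 with
    | @seq _ _ _ r4 _ u1 u2 h4 h5 =>
      refine ⟨_, _, .seq h1 (.while_pos (by simpa [← hv1] using hpos) (.seq h2 h4) h5), hr3,
        .cons hs1 (by simp only [Cmd.overhead]; omega) ?_⟩
      rw [List.append_assoc]
      exact (hs2.mono (by simp only [Cmd.overhead]; omega)).append hs3
  | @loop_neg e p s hpos =>
    intro r hr
    obtain ⟨u, r1, h1, hs1, hl1, hv1, hm1, hr1, -⟩ := e.exec_comp 0 r s hr
    exact ⟨_, _, .seq h1 (.while_neg (by simpa [← hv1] using hpos)),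
      ⟨fun x => by rw [hr1, hr.reg], fun n => by rw [hm1, hr.mem], hr.neg⟩,
      .single _ hs1 (by simp only [Cmd.overhead]; omega)⟩

/-! ## Reasoning about silent programs -/

/-- Started in `s`, the program terminates silently within `n` steps in a configuration that
satisfies `Q`. -/
def Tri (p : Cmd) (s : Conf) (n : ℕ) (Q : Conf → Prop) : Prop :=
  ∃ t s', HExec p s t s' ∧ Silent t ∧ t.length ≤ n ∧ Q s'

theorem Tri.mono {p : Cmd} {s : Conf} {n n' : ℕ} {Q Q' : Conf → Prop} (h : Tri p s n Q)
    (hn : n ≤ n') (hQ : ∀ s, Q s → Q' s) : Tri p s n' Q' := by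
  obtain ⟨t, s', h1, h2, h3, h4⟩ := h
  exact ⟨t, s', h1, h2, h3.trans hn, hQ _ h4⟩

/-- The postcondition of the first program is the specification of the second, started where the
first one stops. So facts about intermediate configurations can be used without formulating
assertions. -/
theorem Tri.seq {p q : Cmd} {s : Conf} {n n' : ℕ} {Q : Conf → Prop}
    (h : Tri p s n fun s' => Tri q s' n' Q) : Tri (.seq p q) s (n + n') Q := by
  obtain ⟨t, s', h1, h2, h3, t', s'', h4, h5, h6, h7⟩ := h
  exact ⟨_, _, .seq h1 h4, h2.append h5, by simp; omega, h7⟩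

theorem Tri.ite {e : Expr} {p q : Cmd} {s : Conf} {n : ℕ} {Q : Conf → Prop}
    (h1 : 0 < e.eval s → Tri p s n Q) (h2 : e.eval s ≤ 0 → Tri q s n Q) :
    Tri (.ite e p q) s (n + 1) Q := by
  rcases lt_or_ge 0 (e.eval s) with h | h
  · obtain ⟨t, s', h3, h4, h5, h6⟩ := h1 h
    exact ⟨_, _, .ite_pos h h3, h4.tick_cons, by simpa using h5, h6⟩
  · obtain ⟨t, s', h3, h4, h5, h6⟩ := h2 h
    exact ⟨_, _, .ite_neg h h3, h4.tick_cons, by simpa using h5, h6⟩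

namespace Cmd

/-- Weakest precondition of a silent program without loops. -/
def lwp : Cmd → (Conf → Prop) → Conf → Prop
  | skip, Q, s => Q s
  | assign x e, Q, s => Q ⟨upd s.v x (e.eval s), s.m⟩
  | store a e, Q, s => 0 ≤ a.eval s ∧ Q ⟨s.v, upd s.m (a.eval s) (e.eval s)⟩
  | alloc x a b c d e, Q, s => 0 ≤ s.v 0 ∧ Q ⟨upd (upd s.v x (s.v 0)) 0 (s.v 0 + 5),
      block s.m (s.v 0) (a.eval s) (b.eval s) (c.eval s) (d.eval s) (e.eval s)⟩
  | seq p q, Q, s => p.lwp (q.lwp Q) s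
  | ite e p q, Q, s => (0 < e.eval s → p.lwp Q s) ∧ (e.eval s ≤ 0 → q.lwp Q s)
  | _, _, _ => False

/-- Running time of a program without loops. -/
def time : Cmd → ℕ
  | seq p q => p.time + q.time
  | ite _ p q => max p.time q.time + 1
  | _ => 1

theorem tri_of_lwp {p : Cmd} {Q : Conf → Prop} {s : Conf} (h : p.lwp Q s) : Tri p s p.time Q := by
  induction p generalizing Q s with
  | skip => exact ⟨_, _, .skip s, silent_tick, le_rfl, h⟩
  | assign x e => exact ⟨_, _, .assign s x e, silent_tick, le_rfl, h⟩
  | store a e => exact ⟨_, _, .store s a e h.1, silent_tick, le_rfl, h.2⟩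
  | alloc x a b c d e => exact ⟨_, _, .alloc s x a b c d e h.1, silent_tick, le_rfl, h.2⟩
  | seq p q ihp ihq => exact .seq ((ihp h).mono le_rfl fun s hs => ihq hs)
  | ite e p q ihp ihq =>
    exact .ite (fun hs => (ihp (h.1 hs)).mono (le_max_left _ _) fun _ => id)
      (fun hs => (ihq (h.2 hs)).mono (le_max_right _ _) fun _ => id)
  | print | sep | loop => exact h.elim

end Cmd

theorem Tri.of_lwp {p : Cmd} {Q : Conf → Prop} {s : Conf} {n : ℕ} (h : p.lwp Q s)
    (hn : p.time ≤ n) : Tri p s n Q := (Cmd.tri_of_lwp h).mono hn fun _ => id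

/-- `Steps e p s n s'`: from the head of the loop in configuration `s`, the loop `while 0 < e do p`
silently reaches its head in configuration `s'` within `n` steps. -/
inductive Steps (e : Expr) (p : Cmd) : Conf → ℕ → Conf → Prop
  | refl (s : Conf) : Steps e p s 0 s
  | step {s s' s'' : Conf} {t : List Event} {n n' : ℕ} : 0 < e.eval s → HExec p s t s' →
      Silent t → t.length + 1 ≤ n → Steps e p s' n' s'' → Steps e p s (n + n') s''

theorem Steps.trans {e : Expr} {p : Cmd} {s s' s'' : Conf} {n n' : ℕ} (h : Steps e p s n s')
    (h' : Steps e p s' n' s'') : Steps e p s (n + n') s'' := by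
  induction h with
  | refl => simpa using h'
  | step h1 h2 h3 h4 _ ih => rw [add_assoc]; exact .step h1 h2 h3 h4 (ih h')

/-- One more step than the body takes pays for the test of the guard. -/
theorem Tri.steps {e : Expr} {p : Cmd} {s : Conf} {n : ℕ} {Q : Conf → Prop} (he : 0 < e.eval s)
    (h : Tri p s n Q) : ∃ s', Steps e p s (n + 1) s' ∧ Q s' := by
  obtain ⟨t, s', h1, h2, h3, h4⟩ := h
  exact ⟨s', .step (n' := 0) he h1 h2 (by omega) (.refl _), h4⟩

theorem Steps.tri {e : Expr} {p : Cmd} {s s' : Conf} {n : ℕ} (h : Steps e p s n s')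
    (he : e.eval s' ≤ 0) : Tri (.loop e p) s (n + 1) (· = s') := by
  induction h with
  | refl s => exact ⟨_, _, .loop_neg he, silent_tick, le_rfl, rfl⟩
  | step h1 h2 h3 h4 _ ih =>
    obtain ⟨t, s2, h5, h6, h7, h8⟩ := ih he
    exact ⟨_, _, .loop_pos h1 h2 h5, (h3.append h6).tick_cons, by simp; omega, h8⟩

/-- A loop that consumes a list. -/
theorem Tri.loop_list {α : Type*} {e : Expr} {p : Cmd} {n : ℕ} (I : List α → Conf → Prop)
    (h0 : ∀ s, I [] s → e.eval s ≤ 0)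
    (h1 : ∀ x l s, I (x :: l) s → 0 < e.eval s ∧ Tri p s n (I l)) {l : List α} {s : Conf}
    (h : I l s) : Tri (.loop e p) s (l.length * (n + 1) + 1) (I []) := by
  have : ∃ s', Steps e p s (l.length * (n + 1)) s' ∧ I [] s' := by
    induction l generalizing s with
    | nil => exact ⟨s, by simpa using Steps.refl s, h⟩
    | cons x l ih =>
      obtain ⟨s1, h2, h3⟩ := (h1 x l s h).2.steps (h1 x l s h).1
      obtain ⟨s2, h4, h5⟩ := ih h3
      refine ⟨s2, ?_, h5⟩
      rw [List.length_cons, add_mul, one_mul, add_comm]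
      exact h2.trans h4
  obtain ⟨s', h2, h3⟩ := this
  exact (h2.tri (h0 _ h3)).mono le_rfl fun _ h => h ▸ h3

/-- A loop that counts down from `k`. -/
theorem Tri.loop_count {e : Expr} {p : Cmd} {n : ℕ} (I : ℕ → Conf → Prop)
    (h0 : ∀ s, I 0 s → e.eval s ≤ 0)
    (h1 : ∀ j s, I (j + 1) s → 0 < e.eval s ∧ Tri p s n (I j)) {k : ℕ} {s : Conf}
    (h : I k s) : Tri (.loop e p) s (k * (n + 1) + 1) (I 0) := by
  have := Tri.loop_list (e := e) (p := p) (n := n) (fun (l : List Unit) => I l.length) h0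
    (fun x l s hs => h1 _ s (by simpa using hs)) (l := List.replicate k ()) (s := s) (by simpa)
  simpa using this

/-! ## Memory -/

@[simp] theorem upd_same {α : Type*} [DecidableEq α] (f : α → ℤ) (a : α) (b : ℤ) :
    upd f a b a = b := by simp [upd]

theorem upd_of_ne {α : Type*} [DecidableEq α] (f : α → ℤ) {a x : α} (b : ℤ) (h : x ≠ a) :
    upd f a b x = f x := by simp [upd, h]

@[simp] theorem block_0 (m : ℤ → ℤ) (h a b c d e : ℤ) : block m h a b c d e h = a := by
  simp [block, upd]

@[simp] theorem block_1 (m : ℤ → ℤ) (h a b c d e : ℤ) : block m h a b c d e (h + 1) = b := by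
  simp [block, upd]

@[simp] theorem block_2 (m : ℤ → ℤ) (h a b c d e : ℤ) : block m h a b c d e (h + 2) = c := by
  simp [block, upd]

@[simp] theorem block_3 (m : ℤ → ℤ) (h a b c d e : ℤ) : block m h a b c d e (h + 3) = d := by
  simp [block, upd]

@[simp] theorem block_4 (m : ℤ → ℤ) (h a b c d e : ℤ) : block m h a b c d e (h + 4) = e := by
  simp [block, upd]

theorem block_of_lt (m : ℤ → ℤ) {h z : ℤ} (a b c d e : ℤ) (hz : z < h) :
    block m h a b c d e z = m z := by
  unfold block upd
  repeat rw [if_neg (by omega)]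

/-- The two memories agree on the addresses below `hi` in `F`. -/
def Agree (F : Set ℤ) (hi : ℤ) (m m' : ℤ → ℤ) : Prop := ∀ z ∈ F, z < hi → m' z = m z

/-- Lists stored in memory. -/
def At (m : ℤ → ℤ) : ℤ → List ℤ → Prop
  | _, [] => True
  | a, x :: l => m a = x ∧ At m (a + 1) l

theorem at_append {m : ℤ → ℤ} {a : ℤ} {l l' : List ℤ} :
    At m a (l ++ l') ↔ At m a l ∧ At m (a + l.length) l' := by
  induction l generalizing a with
  | nil => simp [At]
  | cons x l ih =>
    simp only [List.cons_append, At, ih, List.length_cons, Nat.cast_add, Nat.cast_one, and_assoc]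
    rw [show a + 1 + (l.length : ℤ) = a + (l.length + 1) by ring]

theorem At.agree {m m' : ℤ → ℤ} {a : ℤ} {l : List ℤ} (h : At m a l)
    (hm : ∀ z, a ≤ z → z < a + l.length → m' z = m z) : At m' a l := by
  induction l generalizing a with
  | nil => trivial
  | cons x l ih =>
    simp only [List.length_cons, Nat.cast_add, Nat.cast_one] at hm
    exact ⟨(hm a le_rfl (by omega)).trans h.1, ih h.2 fun z h1 h2 => hm z (by omega) (by omega)⟩

/-! ## The data structure for sets of outputs -/

/-- Outputs as printed: symbols and positions are integers. -/
abbrev Out := List (ℤ × ℤ)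

/-- Add `k` to all positions. -/
def shift (k : ℤ) (w : Out) : Out := w.map fun x => (x.1, x.2 + k)

/-- A shift stored beside a pointer stands for this operation, so translating a whole set costs one
addition. -/
def shifts (k : ℤ) (L : List Out) : List Out := L.map (shift k)

/-- All concatenations of an element of `X` and an element of `Y`. -/
def prodL (X Y : List Out) : List Out := Y.flatMap fun y => X.map (· ++ y)

@[simp] theorem shift_zero (w : Out) : shift 0 w = w := by simp [shift]

theorem shift_shift (k l : ℤ) (w : Out) : shift k (shift l w) = shift (l + k) w := by
  simp [shift, add_assoc]

theorem shift_append (k : ℤ) (w w' : Out) : shift k (w ++ w') = shift k w ++ shift k w' := by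
  simp [shift]

@[simp] theorem shifts_zero (L : List Out) : shifts 0 L = L := by
  simp [shifts, show shift 0 = id from funext shift_zero]

@[simp] theorem shifts_nil (k : ℤ) : shifts k [] = [] := rfl

theorem shifts_shifts (k l : ℤ) (L : List Out) : shifts k (shifts l L) = shifts (l + k) L := by
  simp [shifts, shift_shift]

theorem shifts_append (k : ℤ) (L L' : List Out) :
    shifts k (L ++ L') = shifts k L ++ shifts k L' := by simp [shifts]

/-- The three kinds of records: an item is a single output symbol or a product of two nodes, a node
is an item followed by a rest, and a rest is empty or a node followed by a rest. -/
inductive Kind where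
  | item
  | node
  | rest

/-- `Rep m F hi κ a L`: in the memory `m`, the record of kind `κ` at address `a` represents the list
`L` of outputs. The record and all records below it are stored in the cells in `F` before `hi`. -/
inductive Rep (m : ℤ → ℤ) (F : Set ℤ) (hi : ℤ) : Kind → ℤ → List Out → Prop
  | leaf {a : ℤ} : (∀ z, a ≤ z → z < a + 5 → z ∈ F) → a + 5 ≤ hi → m a = 0 →
      Rep m F hi .item a [[(m (a + 1), 0)]]
  | prod {a : ℤ} {X Y : List Out} : (∀ z, a ≤ z → z < a + 5 → z ∈ F) → a + 5 ≤ hi → 0 < m a →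
      Rep m F hi .node (m a) X → Rep m F hi .node (m (a + 2)) Y →
      Rep m F hi .item a (prodL (shifts (m (a + 1)) X) (shifts (m (a + 3)) Y))
  | node {a : ℤ} {I R : List Out} : (∀ z, a ≤ z → z < a + 5 → z ∈ F) → a + 5 ≤ hi →
      Rep m F hi .item (m a) I → Rep m F hi .rest (m (a + 2)) R →
      Rep m F hi .node a (shifts (m (a + 1)) I ++ shifts (m (a + 3)) R)
  | nil : Rep m F hi .rest 0 []
  | cell {a : ℤ} {N R : List Out} : 0 < a → (∀ z, a ≤ z → z < a + 5 → z ∈ F) → a + 5 ≤ hi →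
      Rep m F hi .node (m a) N → Rep m F hi .rest (m (a + 2)) R →
      Rep m F hi .rest a (shifts (m (a + 1)) N ++ shifts (m (a + 3)) R)

/-- All cells on which a representation depends lie in F and below hi. It therefore survives
allocation and any writing outside F, which is what makes sharing of records sound. -/
theorem Rep.agree {m m' : ℤ → ℤ} {F F' : Set ℤ} {hi hi' : ℤ} {κ : Kind} {a : ℤ} {L : List Out}
    (h : Rep m F hi κ a L) (hm : Agree F hi m m') (hF : ∀ z ∈ F, z < hi → z ∈ F') (hhi : hi ≤ hi') :
    Rep m' F' hi' κ a L := by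
  induction h with
  | @leaf a h1 h2 h3 =>
    have e : ∀ i, 0 ≤ i → i < 5 → m' (a + i) = m (a + i) :=
      fun i h h' => hm _ (h1 _ (by omega) (by omega)) (by omega)
    have e0 := hm a (h1 _ le_rfl (by omega)) (by omega)
    rw [← e 1 (by omega) (by omega)]
    exact .leaf (fun z h h' => hF _ (h1 z h h') (by omega)) (by omega) (e0.trans h3)
  | @prod a X Y h1 h2 h3 _ _ ih1 ih2 =>
    have e : ∀ i, 0 ≤ i → i < 5 → m' (a + i) = m (a + i) :=
      fun i h h' => hm _ (h1 _ (by omega) (by omega)) (by omega)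
    have e0 := hm a (h1 _ le_rfl (by omega)) (by omega)
    rw [← e0] at ih1
    rw [← e 2 (by omega) (by omega)] at ih2
    rw [← e 1 (by omega) (by omega), ← e 3 (by omega) (by omega)]
    exact .prod (fun z h h' => hF _ (h1 z h h') (by omega)) (by omega) (by omega) ih1 ih2
  | @node a I R h1 h2 _ _ ih1 ih2 =>
    have e : ∀ i, 0 ≤ i → i < 5 → m' (a + i) = m (a + i) :=
      fun i h h' => hm _ (h1 _ (by omega) (by omega)) (by omega)
    have e0 := hm a (h1 _ le_rfl (by omega)) (by omega)
    rw [← e0] at ih1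
    rw [← e 2 (by omega) (by omega)] at ih2
    rw [← e 1 (by omega) (by omega), ← e 3 (by omega) (by omega)]
    exact .node (fun z h h' => hF _ (h1 z h h') (by omega)) (by omega) ih1 ih2
  | nil => exact .nil
  | @cell a I R h0 h1 h2 _ _ ih1 ih2 =>
    have e : ∀ i, 0 ≤ i → i < 5 → m' (a + i) = m (a + i) :=
      fun i h h' => hm _ (h1 _ (by omega) (by omega)) (by omega)
    have e0 := hm a (h1 _ le_rfl (by omega)) (by omega)
    rw [← e0] at ih1
    rw [← e 2 (by omega) (by omega)] at ih2
    rw [← e 1 (by omega) (by omega), ← e 3 (by omega) (by omega)]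
    exact .cell h0 (fun z h h' => hF _ (h1 z h h') (by omega)) (by omega) ih1 ih2

/-! ### References, matrix entries and extensions of configurations. -/

/-- A reference: the zero pointer for the empty list, or the address of a node, and a shift. -/
def Ref (m : ℤ → ℤ) (F : Set ℤ) (hi P k : ℤ) (L : List Out) : Prop :=
  (P = 0 ∧ L = []) ∨ (0 < P ∧ ∃ W, Rep m F hi .node P W ∧ L = shifts k W)

theorem Ref.agree {m m' : ℤ → ℤ} {F F' : Set ℤ} {hi hi' P k : ℤ} {L : List Out}
    (h : Ref m F hi P k L) (hm : Agree F hi m m') (hF : ∀ z ∈ F, z < hi → z ∈ F') (hhi : hi ≤ hi') :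
    Ref m' F' hi' P k L := by
  rcases h with h | ⟨h, W, hW, rfl⟩
  · exact .inl h
  · exact .inr ⟨h, W, hW.agree hm hF hhi, rfl⟩

/-- An entry of a matrix: the flag for the empty output and a reference for the other outputs. -/
def Ent (m : ℤ → ℤ) (F : Set ℤ) (hi x : ℤ) (e : Bool) (L : List Out) : Prop :=
  (0 < m x ↔ e = true) ∧ Ref m F hi (m (x + 1)) (m (x + 2)) L

theorem Ent.agree {m m' : ℤ → ℤ} {F F' : Set ℤ} {hi hi' x : ℤ} {e : Bool} {L : List Out}
    (h : Ent m F hi x e L) (hm : Agree F hi m m') (hx : ∀ z, x ≤ z → z < x + 3 → m' z = m z)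
    (hF : ∀ z ∈ F, z < hi → z ∈ F')
    (hhi : hi ≤ hi') : Ent m' F' hi' x e L := by
  unfold Ent
  rw [hx x le_rfl (by omega), hx (x + 1) (by omega) (by omega), hx (x + 2) (by omega) (by omega)]
  exact ⟨h.1, h.2.agree hm hF hhi⟩

/-- The configuration `s'` extends `s`: below the heap pointer, the memory is not changed in `F`,
and only variables in `X` are changed. -/
structure Ext (X : List ℕ) (F : Set ℤ) (s s' : Conf) : Prop where
  hp : s.v 0 ≤ s'.v 0
  mem : ∀ z ∈ F, z < s.v 0 → s'.m z = s.m z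
  var : ∀ x, x ∉ X → s'.v x = s.v x

theorem Ext.refl (X : List ℕ) (F : Set ℤ) (s : Conf) : Ext X F s s :=
  ⟨le_rfl, fun _ _ _ => rfl, fun _ _ => rfl⟩

theorem Ext.trans {X : List ℕ} {F : Set ℤ} {s s' s'' : Conf} (h : Ext X F s s')
    (h' : Ext X F s' s'') : Ext X F s s'' :=
  ⟨h.hp.trans h'.hp, fun z hF hz => (h'.mem z hF (by have := h.hp; omega)).trans (h.mem z hF hz),
    fun x hx => (h'.var x hx).trans (h.var x hx)⟩

theorem Ext.mono {X Y : List ℕ} {F G : Set ℤ} {s s' : Conf} (h : Ext X F s s') (hXY : X ⊆ Y)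
    (hF : G ⊆ F) : Ext Y G s s' :=
  ⟨h.hp, fun z hz => h.mem z (hF hz), fun x hx => h.var x fun hx' => hx (hXY hx')⟩

theorem Ext.ref {X : List ℕ} {s s' : Conf} {F : Set ℤ} {P k : ℤ} {L : List Out}
    (hs : Ext X F s s') (h : Ref s.m F (s.v 0) P k L) : Ref s'.m F (s'.v 0) P k L :=
  h.agree hs.mem (fun _ h _ => h) hs.hp

/-- The three cells of a matrix entry are in general not part of the footprint F of the records it
refers to, hence the separate hypothesis that they are preserved. -/
theorem Ext.ent {X : List ℕ} {s s' : Conf} {F G : Set ℤ} {x : ℤ} {e : Bool} {L : List Out}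
    (hs : Ext X G s s') (h : Ent s.m F (s.v 0) x e L) (hFG : F ⊆ G)
    (hx : ∀ z, x ≤ z → z < x + 3 → z ∈ G ∧ z < s.v 0) : Ent s'.m F (s'.v 0) x e L :=
  h.agree (fun z hz => hs.mem z (hFG hz))
    (fun z h1 h2 => hs.mem z (hx z h1 h2).1 (hx z h1 h2).2) (fun _ h _ => h) hs.hp

/-! ## Variables of the programs -/

notation "v_hp" => (0 : ℕ)
notation "v_nS" => (1 : ℕ)
notation "v_nQ" => (2 : ℕ)
notation "v_q0" => (3 : ℕ)
notation "v_nF" => (4 : ℕ)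
notation "v_tp" => (5 : ℕ)
notation "v_nT" => (6 : ℕ)
notation "v_rb" => (7 : ℕ)
notation "v_nN" => (8 : ℕ)
notation "v_st" => (9 : ℕ)
notation "v_rt" => (10 : ℕ)
notation "v_mt" => (11 : ℕ)
notation "v_ro" => (12 : ℕ)
notation "v_w" => (13 : ℕ)
notation "v_sz" => (14 : ℕ)
notation "v_zm" => (15 : ℕ)
notation "v_id" => (16 : ℕ)
notation "v_i" => (17 : ℕ)
notation "v_p" => (18 : ℕ)
notation "v_x" => (19 : ℕ)
notation "v_A" => (20 : ℕ)
notation "v_B" => (21 : ℕ)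
notation "v_C" => (22 : ℕ)
notation "v_la" => (23 : ℕ)
notation "v_pa" => (24 : ℕ)
notation "v_pb" => (25 : ℕ)
notation "v_j" => (26 : ℕ)
notation "v_a" => (27 : ℕ)
notation "v_b" => (28 : ℕ)
notation "v_r" => (29 : ℕ)
notation "v_e" => (30 : ℕ)
notation "v_P" => (31 : ℕ)
notation "v_k" => (32 : ℕ)
notation "v_Q" => (33 : ℕ)
notation "v_l" => (34 : ℕ)
notation "v_it" => (35 : ℕ)
notation "v_c" => (36 : ℕ)
notation "v_nb" => (37 : ℕ)
notation "v_pp" => (38 : ℕ)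
notation "v_n" => (39 : ℕ)
notation "v_stk" => (40 : ℕ)
notation "v_sym" => (41 : ℕ)
notation "v_eps" => (42 : ℕ)
notation "v_root" => (43 : ℕ)
notation "v_cur" => (44 : ℕ)
notation "v_off" => (45 : ℕ)
notation "v_cont" => (46 : ℕ)
notation "v_acc" => (47 : ℕ)

namespace Expr

instance : Add Expr := ⟨plus⟩
instance : Sub Expr := ⟨minus⟩
instance (n : ℕ) : OfNat Expr n := ⟨lit n⟩

@[simp] theorem eval_add (s : Conf) (a b : Expr) : (a + b).eval s = a.eval s + b.eval s := rfl
@[simp] theorem eval_sub (s : Conf) (a b : Expr) : (a - b).eval s = a.eval s - b.eval s := rfl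
@[simp] theorem eval_zero (s : Conf) : (0 : Expr).eval s = 0 := rfl
@[simp] theorem eval_one (s : Conf) : (1 : Expr).eval s = 1 := rfl
@[simp] theorem eval_two (s : Conf) : (2 : Expr).eval s = 2 := rfl
@[simp] theorem eval_three (s : Conf) : (3 : Expr).eval s = 3 := rfl
@[simp] theorem eval_four (s : Conf) : (4 : Expr).eval s = 4 := rfl
@[simp] theorem eval_five (s : Conf) : (5 : Expr).eval s = 5 := rfl
@[simp] theorem eval_var (s : Conf) (x : ℕ) : (var x).eval s = s.v x := rfl
@[simp] theorem eval_get (s : Conf) (a : Expr) : (get a).eval s = s.m (a.eval s) := rfl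

end Expr

open RAM.Expr (var get)
open Cmd

/-! ### Union in constant time. -/

/-- Replace the set `(P, k)` by its union with the nonempty set `(Q, l)`. -/
def unionCmd : Cmd :=
  ite (var v_P)
    (seq (alloc v_c (var v_Q) (var v_l) (get (var v_P + 2)) (get (var v_P + 3) + var v_k) 0)
      (seq (alloc v_P (get (var v_P)) (get (var v_P + 1) + var v_k) (var v_c) 0 0)
        (assign v_k 0)))
    (seq (assign v_P (var v_Q)) (assign v_k (var v_l)))

/-- If the first set is a node with item I and rest R, two fresh records are enough: a cell holding
the second set followed by R, and a node with item I whose rest is that cell. The pending shift of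
the first set is pushed into the fields of the new records, so the resulting pointer has shift 0.
The records of both arguments stay valid. -/
theorem union_spec {s : Conf} {F : Set ℤ} {L₁ L₂ : List Out} (hh : 0 < s.v v_hp)
    (hF : ∀ z, s.v v_hp ≤ z → z ∈ F)
    (h₁ : Ref s.m F (s.v v_hp) (s.v v_P) (s.v v_k) L₁)
    (h₂ : Ref s.m F (s.v v_hp) (s.v v_Q) (s.v v_l) L₂) (hQ : 0 < s.v v_Q) :
    Tri unionCmd s 4 fun s' => Ext [v_hp, v_P, v_k, v_c] Set.univ s s' ∧
      ∃ L, L.Perm (L₁ ++ L₂) ∧ Ref s'.m F (s'.v v_hp) (s'.v v_P) (s'.v v_k) L := by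
  refine .of_lwp ?_ le_rfl
  simp only [unionCmd, lwp, Expr.eval_add, Expr.eval_var, Expr.eval_get, Expr.eval_zero,
    Expr.eval_one, Expr.eval_two, Expr.eval_three, upd, Nat.reduceEqDiff, if_true, if_false,
    reduceIte,
    OfNat.ofNat_ne_zero, OfNat.zero_ne_ofNat]
  constructor
  · intro hP
    rcases h₁ with ⟨h0, -⟩ | ⟨-, W, hW, rfl⟩
    · omega
    rcases h₂ with ⟨h0, -⟩ | ⟨-, W₂, hW₂, rfl⟩
    · omega
    generalize s.v v_P = P at *
    cases hW with
    | @node _ I R h1 h2 hI hR =>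
    set hp := s.v v_hp
    generalize hm : block (block s.m hp _ _ _ _ _) (hp + 5) _ _ _ _ _ = m
    have hlt : ∀ z < hp, m z = s.m z := fun z hz => by
      rw [← hm, block_of_lt _ _ _ _ _ _ (by omega), block_of_lt _ _ _ _ _ _ (by omega)]
    have hag : Agree F hp s.m m := fun z _ hz => hlt z hz
    have hc0 : m hp = s.v v_Q := by rw [← hm, block_of_lt _ _ _ _ _ _ (by omega), block_0]
    have hc1 : m (hp + 1) = s.v v_l := by rw [← hm, block_of_lt _ _ _ _ _ _ (by omega), block_1]
    have hc2 : m (hp + 2) = s.m (P + 2) := by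
      rw [← hm, block_of_lt _ _ _ _ _ _ (by omega), block_2]
    have hc3 : m (hp + 3) = s.m (P + 3) + s.v v_k := by
      rw [← hm, block_of_lt _ _ _ _ _ _ (by omega), block_3]
    have hn0 : m (hp + 5) = s.m P := by
      rw [← hm, block_0, block_of_lt _ _ _ _ _ _ (by omega)]
    have hn1 : m (hp + 5 + 1) = s.m (P + 1) + s.v v_k := by
      rw [← hm, block_1, block_of_lt _ _ _ _ _ _ (by omega)]
    have hn2 : m (hp + 5 + 2) = hp := by rw [← hm, block_2]
    have hn3 : m (hp + 5 + 3) = 0 := by rw [← hm, block_3]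
    have hcell : Rep m F (hp + 5 + 5) .rest hp
        (shifts (s.v v_l) W₂ ++ shifts (s.m (P + 3) + s.v v_k) R) := by
      have := Rep.cell (m := m) (F := F) (hi := hp + 5 + 5) (a := hp) (N := W₂) (R := R) hh
        (fun z h _ => hF z h) (by omega)
      rw [hc0, hc1, hc2, hc3] at this
      exact this (hW₂.agree hag (fun _ h _ => h) (by omega))
        (hR.agree hag (fun _ h _ => h) (by omega))
    have hnode := Rep.node (m := m) (F := F) (hi := hp + 5 + 5) (a := hp + 5) (I := I)
      (R := shifts (s.v v_l) W₂ ++ shifts (s.m (P + 3) + s.v v_k) R)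
      (fun z h _ => hF z (by omega)) (by omega)
    rw [hn0, hn1, hn2, hn3] at hnode
    have hnode := hnode (hI.agree hag (fun _ h _ => h) (by omega)) hcell
    refine ⟨hh.le, by omega, ⟨by simp [upd]; omega, fun z _ hz => ?_, fun x hx => ?_⟩, _, ?_,
      .inr ⟨?_, _, by simpa [upd] using hnode, rfl⟩⟩
    · exact hlt z hz
    · simp at hx
      simp [hx, upd]
    -- The second set is inserted between I and R, so only a permutation of the concatenation is
    -- obtained.
    · rw [shifts_zero, shifts_append, shifts_shifts, shifts_shifts, List.append_assoc]
      exact List.Perm.append_left _ List.perm_append_comm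
    · omega
  · intro hP
    rcases h₁ with ⟨h0, rfl⟩ | ⟨h0, -⟩
    · refine ⟨⟨by simp [upd], fun _ _ _ => rfl, fun x hx => ?_⟩, L₂, by simp,
        by simpa [upd] using h₂⟩
      simp at hx
      simp [hx, upd]
    · omega

/-! ## Runs and their annotations -/

section Runs

variable {Q Ω : ℕ}

/-- The annotation of a run as it is printed. -/
def annZ (i : ℕ) (ρ : List (Option (Fin Ω) × Fin Q)) : Out :=
  (AnnA.annFrom i ρ).map fun x => (((x.1 : ℕ) : ℤ), (x.2 : ℤ))

theorem annZ_succ (i : ℕ) (ρ : List (Option (Fin Ω) × Fin Q)) :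
    annZ (i + 1) ρ = shift 1 (annZ i ρ) := by
  induction ρ generalizing i with
  | nil => rfl
  | cons x ρ ih =>
    rcases x with ⟨_ | o, q⟩
    · exact ih (i + 1)
    · have := ih (i + 1)
      simp only [annZ, shift, AnnA.annFrom, List.map_cons] at this ⊢
      rw [this]
      simp

theorem annZ_add (i k : ℕ) (ρ : List (Option (Fin Ω) × Fin Q)) :
    annZ (i + k) ρ = shift k (annZ i ρ) := by
  induction k with
  | zero => simp
  | succ k ih => rw [← add_assoc, annZ_succ, ih, shift_shift]; push_cast; rfl

/-- Positions in the second part are counted on from the end of the first; relative to their own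
document they differ by its length. This is why products of entries need a shift. -/
theorem annZ_append (i : ℕ) (ρ ρ' : List (Option (Fin Ω) × Fin Q)) :
    annZ i (ρ ++ ρ') = annZ i ρ ++ shift ρ.length (annZ i ρ') := by
  rw [← annZ_add]
  induction ρ generalizing i with
  | nil => simp [annZ, AnnA.annFrom]
  | cons x ρ ih =>
    have := ih (i + 1)
    rw [show i + 1 + ρ.length = i + (x :: ρ).length by simp; omega] at this
    rcases x with ⟨_ | o, q⟩
    · exact this
    · simp only [annZ, AnnA.annFrom, List.map_cons, List.cons_append, List.cons.injEq,
        true_and] at this ⊢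
      exact this

/-- `e` tells whether the empty annotation occurs in the set `R` of runs, and `L` lists the nonempty
annotations of the runs in `R`, at most one time for each run. -/
structure Cov (R : Set (List (Option (Fin Ω) × Fin Q))) (e : Bool) (L : List Out) : Prop where
  eps : e = true ↔ ∃ ρ ∈ R, annZ 1 ρ = []
  runs : ∃ l : List (List (Option (Fin Ω) × Fin Q)), l.Nodup ∧ (∀ ρ ∈ l, ρ ∈ R ∧ annZ 1 ρ ≠ []) ∧
    (l.map (annZ 1)).Perm L
  mem : ∀ ρ ∈ R, annZ 1 ρ ≠ [] → annZ 1 ρ ∈ L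

variable {R R₁ R₂ : Set (List (Option (Fin Ω) × Fin Q))} {e e₁ e₂ : Bool} {L L₁ L₂ : List Out}

theorem Cov.perm (h : Cov R e L₁) (hp : L₁.Perm L₂) : Cov R e L₂ := by
  obtain ⟨l, h1, h2, h3⟩ := h.runs
  exact ⟨h.eps, ⟨l, h1, h2, h3.trans hp⟩, fun ρ h4 h5 => hp.mem_iff.1 (h.mem ρ h4 h5)⟩

theorem Cov.empty : Cov (∅ : Set (List (Option (Fin Ω) × Fin Q))) false [] :=
  ⟨by simp, ⟨[], by simp⟩, by simp⟩

/-- Disjointness is required of the sets of runs only; the two lists may share outputs. -/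
theorem Cov.union (h₁ : Cov R₁ e₁ L₁) (h₂ : Cov R₂ e₂ L₂) (hd : ∀ ρ ∈ R₁, ρ ∉ R₂) :
    Cov (R₁ ∪ R₂) (e₁ || e₂) (L₁ ++ L₂) := by
  obtain ⟨l, h1, h2, h3⟩ := h₁.runs
  obtain ⟨l', h1', h2', h3'⟩ := h₂.runs
  refine ⟨?_, ⟨l ++ l', ?_, ?_, ?_⟩, ?_⟩
  · simp [h₁.eps, h₂.eps, or_and_right, exists_or]
  · rw [List.nodup_append]
    refine ⟨h1, h1', fun a ha b hb => ?_⟩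
    rintro rfl
    exact hd _ (h2 _ ha).1 (h2' _ hb).1
  · intro ρ hρ
    rcases List.mem_append.1 hρ with h | h
    · exact ⟨.inl (h2 ρ h).1, (h2 ρ h).2⟩
    · exact ⟨.inr (h2' ρ h).1, (h2' ρ h).2⟩
  · rw [List.map_append]
    exact h3.append h3'
  · rintro ρ (h | h) h'
    · exact List.mem_append_left _ (h₁.mem ρ h h')
    · exact List.mem_append_right _ (h₂.mem ρ h h')

/-- The nonempty outputs of a product of two sets, of which `e₁` and `e₂` tell whether they contain
the empty output. -/
def mulL (e₁ e₂ : Bool) (X Y : List Out) : List Out :=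
  (if e₁ then Y else []) ++ (if e₂ then X else []) ++ prodL X Y

/-- Since all runs in R₁ have length k, concatenation of runs is injective on R₁ × R₂. Splitting
each factor into empty and nonempty annotations gives the three parts of `mulL`. In the parts where
one factor contributes the empty annotation, a single run represents all runs with that annotation.
This keeps the coverage condition "at most one time for each run" while losing no output. -/
theorem Cov.mul (h₁ : Cov R₁ e₁ L₁) (h₂ : Cov R₂ e₂ L₂) (k : ℕ) (hk : ∀ ρ ∈ R₁, ρ.length = k) :
    Cov {ρ | ∃ ρ₁ ∈ R₁, ∃ ρ₂ ∈ R₂, ρ = ρ₁ ++ ρ₂} (e₁ && e₂) (mulL e₁ e₂ L₁ (shifts k L₂)) := by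
  have ha : ∀ ρ₁ ∈ R₁, ∀ ρ₂, annZ 1 (ρ₁ ++ ρ₂) = annZ 1 ρ₁ ++ shift k (annZ 1 ρ₂) := by
    intro ρ₁ h ρ₂
    rw [annZ_append, hk _ h]
  have hs : ∀ w : Out, shift k w = [] ↔ w = [] := by simp [shift]
  refine ⟨?_, ?_, ?_⟩
  · rw [Bool.and_eq_true, h₁.eps, h₂.eps]
    constructor
    · rintro ⟨⟨ρ₁, m1, n1⟩, ρ₂, m2, n2⟩
      exact ⟨_, ⟨ρ₁, m1, ρ₂, m2, rfl⟩, by rw [ha _ m1, n1, n2]; rfl⟩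
    · rintro ⟨_, ⟨ρ₁, m1, ρ₂, m2, rfl⟩, n⟩
      rw [ha _ m1, List.append_eq_nil_iff, hs] at n
      exact ⟨⟨ρ₁, m1, n.1⟩, ρ₂, m2, n.2⟩
  · obtain ⟨l, g1, g2, g3⟩ := h₁.runs
    obtain ⟨l', g1', g2', g3'⟩ := h₂.runs
    -- One representative of the runs with empty annotation, if there is any: the flag records
    -- existence and not multiplicity.
    have hE : ∀ {R : Set (List (Option (Fin Ω) × Fin Q))} {e : Bool} {L : List Out},
        Cov R e L → ∃ E : List (List (Option (Fin Ω) × Fin Q)), E.Nodup ∧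
        (∀ ρ ∈ E, ρ ∈ R ∧ annZ 1 ρ = []) ∧ E.map (annZ 1) = if e then [[]] else [] := by
      intro R e L h
      cases e with
      | false => exact ⟨[], by simp⟩
      | true =>
        obtain ⟨ρ, h1, h2⟩ := h.eps.1 rfl
        exact ⟨[ρ], by simp [h1, h2]⟩
    obtain ⟨E, i1, i2, i3⟩ := hE h₁
    obtain ⟨E', i1', i2', i3'⟩ := hE h₂
    have key : ∀ A B : List (List (Option (Fin Ω) × Fin Q)), (∀ ρ ∈ A, ρ ∈ R₁) →
        ((A ×ˢ B).map fun x => x.1 ++ x.2).map (annZ 1) =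
          (A.map (annZ 1)).flatMap fun w => (shifts k (B.map (annZ 1))).map (w ++ ·) := by
      intro A B hA
      induction A with
      | nil => simp
      | cons ρ A ih =>
        rw [List.product_cons, List.map_append, List.map_append,
          ih fun ρ h => hA ρ (List.mem_cons_of_mem _ h), List.map_cons, List.flatMap_cons]
        congr 1
        simp [shifts, ha ρ (hA ρ (by simp))]
    -- In `prodL` the right factor is the outer loop, as in the enumeration, whereas the product
    -- list of runs has the left factor outside.
    have hperm : ∀ X Y : List Out, (X.flatMap fun w => Y.map (w ++ ·)).Perm (prodL X Y) := by
      intro X Y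
      unfold prodL
      induction X with
      | nil => simp
      | cons w X ih =>
        simp only [List.flatMap_cons, List.map_cons]
        refine ((List.Perm.append_left _ ih)).trans ?_
        rw [← List.flatMap_singleton' Y, List.map_flatMap]
        simp only [List.flatMap_singleton', List.map_cons, List.map_nil]
        exact (List.flatMap_append_perm Y (fun x => [w ++ x]) _).trans (by simp)
    -- The three blocks of pairs are disjoint, since they differ in which factor has the empty
    -- annotation.
    refine ⟨((E ×ˢ l') ++ (l ×ˢ E') ++ (l ×ˢ l')).map fun x => x.1 ++ x.2, ?_, ?_, ?_⟩
    · refine List.Nodup.map_on ?_ ?_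
      · rintro ⟨x, x'⟩ hx ⟨y, y'⟩ hy hxy
        have : ∀ z ∈ (E ×ˢ l') ++ (l ×ˢ E') ++ (l ×ˢ l'), z.1 ∈ R₁ := by
          rintro ⟨z, z'⟩ hz
          simp only [List.mem_append, List.mem_product] at hz
          rcases hz with (hz | hz) | hz
          exacts [(i2 _ hz.1).1, (g2 _ hz.1).1, (g2 _ hz.1).1]
        -- Equal lengths of the left parts make the decomposition of a run unique.
        have := List.append_inj hxy ((hk _ (this _ hx)).trans (hk _ (this _ hy)).symm)
        exact Prod.ext this.1 this.2
      · rw [List.nodup_append, List.nodup_append]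
        refine ⟨⟨i1.product g1', g1.product i1', ?_⟩, g1.product g1', ?_⟩
        · rintro ⟨a, a'⟩ h ⟨b, b'⟩ h' hab
          rw [List.mem_product] at h h'
          cases hab
          exact (g2 _ h'.1).2 (i2 _ h.1).2
        · rintro ⟨a, a'⟩ h ⟨b, b'⟩ h' hab
          rw [List.mem_append, List.mem_product, List.mem_product] at h
          rw [List.mem_product] at h'
          cases hab
          rcases h with h | h
          · exact (g2 _ h'.1).2 (i2 _ h.1).2
          · exact (g2' _ h'.2).2 (i2' _ h.2).2
    · intro ρ hρ
      rw [List.mem_map] at hρ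
      obtain ⟨⟨x, y⟩, hxy, rfl⟩ := hρ
      simp only [List.mem_append, List.mem_product] at hxy
      rcases hxy with (⟨h, h'⟩ | ⟨h, h'⟩) | ⟨h, h'⟩
      · exact ⟨⟨x, (i2 _ h).1, y, (g2' _ h').1, rfl⟩, by
          rw [ha _ (i2 _ h).1]; simp [hs, (g2' _ h').2]⟩
      · exact ⟨⟨x, (g2 _ h).1, y, (i2' _ h').1, rfl⟩, by
          rw [ha _ (g2 _ h).1]; simp [hs, (g2 _ h).2]⟩
      · exact ⟨⟨x, (g2 _ h).1, y, (g2' _ h').1, rfl⟩, by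
          rw [ha _ (g2 _ h).1]; simp [hs, (g2 _ h).2]⟩
    · rw [List.map_append, List.map_append, List.map_append, List.map_append,
        key _ _ fun ρ h => (i2 _ h).1, key _ _ fun ρ h => (g2 _ h).1,
        key _ _ fun ρ h => (g2 _ h).1, i3, i3', mulL]
      refine (List.Perm.append (List.Perm.append ?_ ?_) ?_)
      · cases e₁
        · simp
        · simpa [shifts, Function.comp_def] using g3'.map (shift k)
      · cases e₂
        · simp [shifts]
        · simpa [shifts, show shift (k : ℤ) [] = [] from rfl, List.flatMap_singleton'] using g3
      · refine (hperm _ _).trans ?_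
        exact (List.Perm.flatMap (g3'.map _) fun y _ => g3.map _)
  · rintro _ ⟨ρ₁, m1, ρ₂, m2, rfl⟩ n
    rw [ha _ m1] at n ⊢
    simp only [mulL, List.mem_append]
    by_cases n1 : annZ 1 ρ₁ = []
    · have n2 : annZ 1 ρ₂ ≠ [] := by simpa [n1, hs] using n
      rw [if_pos (h₁.eps.2 ⟨_, m1, n1⟩)]
      exact .inl (.inl (by rw [n1]; exact List.mem_map_of_mem (h₂.mem _ m2 n2)))
    · by_cases n2 : annZ 1 ρ₂ = []
      · rw [if_pos (h₂.eps.2 ⟨_, m2, n2⟩), n2]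
        exact .inl (.inr (by simpa [shift] using h₁.mem _ m1 n1))
      · refine .inr (List.mem_flatMap.2 ⟨_, List.mem_map_of_mem (h₂.mem _ m2 n2), ?_⟩)
        exact List.mem_map_of_mem (f := (· ++ _)) (h₁.mem _ m1 n1)

end Runs

/-! ## Products of matrices -/

/-- Replace `(P, k)` by its union with the set `(Q, l)` computed by the program `p`. -/
def addCmd (p : Cmd) : Cmd := seq p (ite (var v_Q) unionCmd skip)

/-- The program p signals the empty set by a zero pointer, so the union is only carried out with a
nonempty second set, as `union_spec` demands. -/
theorem add_spec {p : Cmd} {n : ℕ} {s : Conf} {F : Set ℤ} {L₁ L₂ : List Out} (hh : 0 < s.v v_hp)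
    (hF : ∀ z, s.v v_hp ≤ z → z ∈ F)
    (h₁ : Ref s.m F (s.v v_hp) (s.v v_P) (s.v v_k) L₁)
    (hp : Tri p s n fun s' => Ext [v_hp, v_Q, v_l, v_it] Set.univ s s' ∧
      Ref s'.m F (s'.v v_hp) (s'.v v_Q) (s'.v v_l) L₂) :
    Tri (addCmd p) s (n + 5) fun s' =>
      Ext [v_hp, v_e, v_P, v_k, v_Q, v_l, v_it, v_c] Set.univ s s' ∧ s'.v v_e = s.v v_e ∧
      ∃ L, L.Perm (L₁ ++ L₂) ∧ Ref s'.m F (s'.v v_hp) (s'.v v_P) (s'.v v_k) L := by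
  refine .seq (hp.mono le_rfl fun s₁ ⟨hx, h₂⟩ => ?_)
  have h₁' := (hx.mono (fun _ h => h) (Set.subset_univ F)).ref h₁
  rw [← hx.var v_P (by decide), ← hx.var v_k (by decide)] at h₁'
  have hx' := hx.mono (Y := [v_hp, v_e, v_P, v_k, v_Q, v_l, v_it, v_c]) (by decide)
    (Set.subset_univ Set.univ)
  have he := hx.var v_e (by decide)
  have h0 := hx.hp
  refine .ite (fun hQ => ?_) (fun hQ => ?_)
  · refine (union_spec (by omega) (fun z hz => hF z (by omega)) h₁' h₂ hQ).mono le_rfl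
      fun s₂ ⟨hy, hL⟩ => ?_
    exact ⟨hx'.trans (hy.mono (by decide) subset_rfl), (hy.var v_e (by decide)).trans he, hL⟩
  · refine .of_lwp ⟨hx', he, L₁, ?_, h₁'⟩ (by decide)
    rcases h₂ with ⟨-, rfl⟩ | ⟨h, -⟩
    · simp
    · exact absurd h (not_lt.2 hQ)

/-- Add the product of the entries at `a` and `b` to the entry held in the variables. -/
def combineCmd : Cmd :=
  seq (ite (get (var v_a)) (ite (get (var v_b)) (assign v_e 1) skip) skip) <|
  seq (addCmd (seq (assign v_Q 0) (ite (get (var v_a))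
    (seq (assign v_Q (get (var v_b + 1))) (assign v_l (get (var v_b + 2) + var v_la))) skip))) <|
  seq (addCmd (seq (assign v_Q 0) (ite (get (var v_b))
    (seq (assign v_Q (get (var v_a + 1))) (assign v_l (get (var v_a + 2)))) skip))) <|
  addCmd (seq (assign v_Q 0) (ite (get (var v_a + 1)) (ite (get (var v_b + 1))
    (seq (alloc v_it (get (var v_a + 1)) (get (var v_a + 2)) (get (var v_b + 1))
        (get (var v_b + 2) + var v_la) 0)
      (seq (alloc v_Q (var v_it) 0 0 0 0) (assign v_l 0))) skip) skip))

theorem Ref.shift {m : ℤ → ℤ} {F : Set ℤ} {hi P k : ℤ} {L : List Out}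
    (h : Ref m F hi P k L) (l : ℤ) : Ref m F hi P (k + l) (shifts l L) := by
  rcases h with ⟨h, rfl⟩ | ⟨h, W, hW, rfl⟩
  · exact .inl ⟨h, rfl⟩
  · exact .inr ⟨h, W, hW, shifts_shifts _ _ _⟩

/-- A constant number of records implements `mulL`: each flag decides whether the other factor is
added as it is, and if both pointers are nonzero, a fresh product item wrapped in a node with empty
rest is added. The right factor is shifted by the length of the left document, held in `v_la`. -/
theorem combine_spec {s : Conf} {F : Set ℤ} {L LA LB : List Out} {e ea eb : Bool}
    (hh : 0 < s.v v_hp) (hF : ∀ z, s.v v_hp ≤ z → z ∈ F)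
    (ha : Ent s.m F (s.v v_hp) (s.v v_a) ea LA) (ha' : s.v v_a + 3 ≤ s.v v_hp)
    (hb : Ent s.m F (s.v v_hp) (s.v v_b) eb LB) (hb' : s.v v_b + 3 ≤ s.v v_hp)
    (he : 0 < s.v v_e ↔ e = true) (hL : Ref s.m F (s.v v_hp) (s.v v_P) (s.v v_k) L) :
    Tri combineCmd s 40 fun s' =>
      Ext [v_hp, v_e, v_P, v_k, v_Q, v_l, v_it, v_c] Set.univ s s' ∧
      (0 < s'.v v_e ↔ (e || (ea && eb)) = true) ∧
      ∃ L', L'.Perm (L ++ mulL ea eb LA (shifts (s.v v_la) LB)) ∧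
        Ref s'.m F (s'.v v_hp) (s'.v v_P) (s'.v v_k) L' := by
  have h1 : Tri (ite (get (var v_a)) (ite (get (var v_b)) (assign v_e 1) skip) skip) s 3
      fun s' => Ext [v_e] Set.univ s s' ∧
        (0 < s'.v v_e ↔ (e || (ea && eb)) = true) := by
    refine .of_lwp ?_ (by decide)
    have hea := ha.1
    have heb := hb.1
    simp only [lwp, Expr.eval_get, Expr.eval_var]
    refine ⟨fun h1 => ⟨fun h2 => ⟨⟨by simp [upd], fun _ _ _ => rfl, fun x hx => ?_⟩, ?_⟩,
      fun h2 => ⟨.refl _ _ _, ?_⟩⟩, fun h1 => ⟨.refl _ _ _, ?_⟩⟩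
    · simp at hx
      simp [upd, hx]
    · simp [hea.1 h1, heb.1 h2]
    · cases eb
      · simpa using he
      · exact absurd (heb.2 rfl) (not_lt.2 h2)
    · cases ea
      · simpa using he
      · exact absurd (hea.2 rfl) (not_lt.2 h1)
  -- the three sets that are added
  have step : ∀ {p : Cmd} {s₁ : Conf} {L₁ L₂ : List Out} (n : ℕ), n ≤ 6 →
      Ext [v_hp, v_e, v_P, v_k, v_Q, v_l, v_it, v_c] Set.univ s s₁ →
      (0 < s₁.v v_e ↔ (e || (ea && eb)) = true) →
      Ref s₁.m F (s₁.v v_hp) (s₁.v v_P) (s₁.v v_k) L₁ →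
      (0 < s₁.v v_hp → (∀ z, s₁.v v_hp ≤ z → z ∈ F) →
        Ent s₁.m F (s₁.v v_hp) (s₁.v v_a) ea LA → s₁.v v_a + 3 ≤ s₁.v v_hp →
        Ent s₁.m F (s₁.v v_hp) (s₁.v v_b) eb LB → s₁.v v_b + 3 ≤ s₁.v v_hp →
        s₁.v v_la = s.v v_la →
        Tri p s₁ n fun s' => Ext [v_hp, v_Q, v_l, v_it] Set.univ s₁ s' ∧
          Ref s'.m F (s'.v v_hp) (s'.v v_Q) (s'.v v_l) L₂) →
      Tri (addCmd p) s₁ 11 fun s' =>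
        Ext [v_hp, v_e, v_P, v_k, v_Q, v_l, v_it, v_c] Set.univ s s' ∧
        (0 < s'.v v_e ↔ (e || (ea && eb)) = true) ∧
        ∃ L', L'.Perm (L₁ ++ L₂) ∧ Ref s'.m F (s'.v v_hp) (s'.v v_P) (s'.v v_k) L' := by
    intro p s₁ L₁ L₂ n hn hx he hL hp
    have h0 := hx.hp
    have ha₁ := hx.ent ha (Set.subset_univ F) fun z _ hz => ⟨trivial, by omega⟩
    have hb₁ := hx.ent hb (Set.subset_univ F) fun z _ hz => ⟨trivial, by omega⟩
    have e1 := hx.var v_a (by decide)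
    have e2 := hx.var v_b (by decide)
    refine (add_spec (by omega) (fun z hz => hF z (by omega)) hL (hp (by omega)
      (fun z hz => hF z (by omega)) (by rwa [e1]) (by omega) (by rwa [e2]) (by omega)
      (hx.var v_la (by decide)))).mono (by omega) fun s₂ ⟨hy, he', hL'⟩ => ?_
    exact ⟨hx.trans hy, by rw [he', he], hL'⟩
  refine (Tri.seq (n := 3) (n' := 33) (h1.mono le_rfl fun s₁ ⟨hx₁, he₁⟩ => ?_)).mono (by omega)
    fun _ h => h
  have hL₁ : Ref s₁.m F (s₁.v v_hp) (s₁.v v_P) (s₁.v v_k) L := by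
    have := (hx₁.mono (fun _ h => h) (Set.subset_univ F)).ref hL
    rwa [← hx₁.var v_P (by decide), ← hx₁.var v_k (by decide)] at this
  replace hx₁ := hx₁.mono (Y := [v_hp, v_e, v_P, v_k, v_Q, v_l, v_it, v_c]) (by decide)
    (Set.subset_univ Set.univ)
  refine Tri.seq (n := 11) (n' := 22) ((step (L₂ := if ea then shifts (s.v v_la) LB else [])
    6 le_rfl hx₁ he₁ hL₁ ?_).mono le_rfl fun s₂ ⟨hx₂, he₂, L₂, p₂, hL₂⟩ => ?_)
  · intro _ _ ha _ hb _ hla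
    refine .of_lwp ?_ (by decide)
    simp only [lwp, Expr.eval_get, Expr.eval_var, Expr.eval_zero, Expr.eval_add, Expr.eval_one,
      Expr.eval_two]
    refine ⟨fun h => ⟨⟨by simp [upd], fun _ _ _ => rfl, fun x hx => ?_⟩, ?_⟩,
      fun h => ⟨⟨by simp [upd], fun _ _ _ => rfl, fun x hx => ?_⟩, .inl ?_⟩⟩
    · simp at hx
      simp [upd, hx]
    · rw [if_pos (ha.1.1 (by simpa [upd] using h)), ← hla]
      simpa [upd] using hb.2.shift _
    · simp at hx
      simp [upd, hx]
    · have : ea ≠ true := fun h' => not_lt.2 h (by simpa [upd] using ha.1.2 h')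
      simp [upd, this]
  refine Tri.seq (n := 11) (n' := 11) ((step (L₂ := if eb then LA else [])
    6 le_rfl hx₂ he₂ hL₂ ?_).mono le_rfl fun s₃ ⟨hx₃, he₃, L₃, p₃, hL₃⟩ => ?_)
  · intro _ _ ha _ hb _ hla
    refine .of_lwp ?_ (by decide)
    simp only [lwp, Expr.eval_get, Expr.eval_var, Expr.eval_zero, Expr.eval_add, Expr.eval_one,
      Expr.eval_two]
    refine ⟨fun h => ⟨⟨by simp [upd], fun _ _ _ => rfl, fun x hx => ?_⟩, ?_⟩,
      fun h => ⟨⟨by simp [upd], fun _ _ _ => rfl, fun x hx => ?_⟩, .inl ?_⟩⟩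
    · simp at hx
      simp [upd, hx]
    · rw [if_pos (hb.1.1 (by simpa [upd] using h))]
      simpa [upd] using ha.2
    · simp at hx
      simp [upd, hx]
    · have : eb ≠ true := fun h' => not_lt.2 h (by simpa [upd] using hb.1.2 h')
      simp [upd, this]
  refine (step (L₂ := prodL LA (shifts (s.v v_la) LB)) 6 le_rfl hx₃ he₃ hL₃ ?_).mono le_rfl
    fun s₄ ⟨hx₄, he₄, L₄, p₄, hL₄⟩ => ⟨hx₄, he₄, L₄, ?_, hL₄⟩
  · intro h0 hF ha ha' hb hb' hla
    refine .of_lwp ?_ (by decide)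
    simp only [lwp, Expr.eval_get, Expr.eval_var, Expr.eval_zero, Expr.eval_add, Expr.eval_one,
      Expr.eval_two]
    simp only [upd_same, upd_of_ne _ _ (show v_a ≠ v_Q by decide),
      upd_of_ne _ _ (show v_b ≠ v_Q by decide), upd_of_ne _ _ (show v_hp ≠ v_Q by decide),
      upd_of_ne _ _ (show v_la ≠ v_Q by decide), upd_of_ne _ _ (show v_it ≠ v_hp by decide)]
    -- A zero pointer means that a factor has no nonempty outputs, so no product record, which would
    -- stand for an empty set, is made.
    have hz : s₃.m (s₃.v v_a + 1) ≤ 0 ∨ s₃.m (s₃.v v_b + 1) ≤ 0 →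
        prodL LA (shifts (s.v v_la) LB) = [] := by
      rintro (h | h)
      · rcases ha.2 with ⟨-, rfl⟩ | ⟨h', -⟩
        · simp [prodL]
        · omega
      · rcases hb.2 with ⟨-, rfl⟩ | ⟨h', -⟩
        · simp [prodL]
        · omega
    refine ⟨fun h => ⟨fun h' => ⟨h0.le, by omega, ?_, ?_⟩, fun h' => ⟨?_, ?_⟩⟩, fun h => ⟨?_, ?_⟩⟩
    · refine ⟨by simp [upd]; omega, fun z _ hz => ?_, fun x hx => ?_⟩
      · dsimp only
        rw [block_of_lt _ _ _ _ _ _ (by omega), block_of_lt _ _ _ _ _ _ (by omega)]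
      · simp at hx
        simp [upd, hx]
    · rcases ha.2 with ⟨h', -⟩ | ⟨-, W, hW, rfl⟩
      · omega
      rcases hb.2 with ⟨h', -⟩ | ⟨-, W', hW', rfl⟩
      · omega
      generalize hm : block (block s₃.m (s₃.v v_hp) _ _ _ _ _) (s₃.v v_hp + 5) _ _ _ _ _ = m
      generalize hpe : s₃.v v_hp = hp at *
      have hlt : ∀ z < hp, m z = s₃.m z := fun z hz => by
        rw [← hm, block_of_lt _ _ _ _ _ _ (by omega), block_of_lt _ _ _ _ _ _ (by omega)]
      have hag : Agree F hp s₃.m m := fun z _ hz => hlt z hz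
      have c0 : m hp = s₃.m (s₃.v v_a + 1) := by
        rw [← hm, block_of_lt _ _ _ _ _ _ (by omega), block_0]
      have c1 : m (hp + 1) = s₃.m (s₃.v v_a + 2) := by
        rw [← hm, block_of_lt _ _ _ _ _ _ (by omega), block_1]
      have c2 : m (hp + 2) = s₃.m (s₃.v v_b + 1) := by
        rw [← hm, block_of_lt _ _ _ _ _ _ (by omega), block_2]
      have c3 : m (hp + 3) = s₃.m (s₃.v v_b + 2) + s₃.v v_la := by
        rw [← hm, block_of_lt _ _ _ _ _ _ (by omega), block_3]
      have d0 : m (hp + 5) = hp := by rw [← hm, block_0]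
      have d1 : m (hp + 5 + 1) = 0 := by rw [← hm, block_1]
      have d2 : m (hp + 5 + 2) = 0 := by rw [← hm, block_2]
      have d3 : m (hp + 5 + 3) = 0 := by rw [← hm, block_3]
      have hprod := Rep.prod (m := m) (F := F) (hi := hp + 5 + 5) (a := hp) (X := W) (Y := W')
        (fun z h _ => hF z h) (by omega)
      rw [c0, c1, c2, c3] at hprod
      have hprod := hprod h (hW.agree hag (fun _ h _ => h) (by omega))
        (hW'.agree hag (fun _ h _ => h) (by omega))
      have hnode := Rep.node (m := m) (F := F) (hi := hp + 5 + 5) (a := hp + 5) (R := [])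
        (I := prodL (shifts (s₃.m (s₃.v v_a + 2)) W) (shifts (s₃.m (s₃.v v_b + 2) + s₃.v v_la) W'))
        (fun z h _ => hF z (by omega)) (by omega)
      rw [d0, d1, d2, d3] at hnode
      have hnode := hnode hprod .nil
      refine .inr ⟨by simp [upd]; omega, _, by simpa [upd] using hnode, ?_⟩
      rw [← hla, shifts_shifts, shifts_zero]
    · refine ⟨by simp [upd], fun z _ hz => rfl, fun x hx => ?_⟩
      simp at hx
      simp [upd, hx]
    · exact .inl ⟨rfl, hz (.inr h')⟩
    · refine ⟨by simp [upd], fun z _ hz => rfl, fun x hx => ?_⟩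
      simp at hx
      simp [upd, hx]
    · exact .inl ⟨rfl, hz (.inl h)⟩
  · refine p₄.trans ?_
    unfold mulL
    rw [← List.append_assoc, ← List.append_assoc]
    exact .append_right _ (p₃.trans (.append_right _ p₂))

section

variable {Q Ω : ℕ}

/-- The entry at `x` represents the annotations of the runs in `R`. -/
def EntC (m : ℤ → ℤ) (F : Set ℤ) (hi x : ℤ) (R : Set (List (Option (Fin Ω) × Fin Q))) : Prop :=
  ∃ e L, Ent m F hi x e L ∧ Cov R e L

theorem EntC.agree {m m' : ℤ → ℤ} {F F' : Set ℤ} {hi hi' x : ℤ}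
    {R : Set (List (Option (Fin Ω) × Fin Q))} (h : EntC m F hi x R) (hm : Agree F hi m m')
    (hx : ∀ z, x ≤ z → z < x + 3 → m' z = m z) (hF : ∀ z ∈ F, z < hi → z ∈ F')
    (hhi : hi ≤ hi') : EntC m' F' hi' x R := by
  obtain ⟨e, L, h1, h2⟩ := h
  exact ⟨e, L, h1.agree hm hx hF hhi, h2⟩

theorem Ext.entC {X : List ℕ} {s s' : Conf} {F : Set ℤ} {x : ℤ}
    {R : Set (List (Option (Fin Ω) × Fin Q))} (hs : Ext X Set.univ s s')
    (h : EntC s.m F (s.v 0) x R) (hx : x + 3 ≤ s.v 0) : EntC s'.m F (s'.v 0) x R :=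
  h.agree (fun z _ hz => hs.mem z trivial hz) (fun z _ hz => hs.mem z trivial (by omega))
    (fun _ h _ => h) hs.hp

/-- Compute an entry of the product. -/
def cellCmd : Cmd :=
  seq (assign v_e 0) <| seq (assign v_P 0) <| seq (assign v_k 0) <| seq (assign v_a (var v_pa)) <|
  seq (assign v_b (var v_pb)) <| seq (assign v_r (var v_nQ)) <|
  loop (var v_r) (seq combineCmd (seq (assign v_a (var v_a + 3))
    (seq (assign v_b (var v_b + var v_w)) (assign v_r (var v_r - 1)))))

theorem Tri.assign {x : ℕ} {e : Expr} {q : Cmd} {s : Conf} {n : ℕ} {T : Conf → Prop}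
    (h : Tri q ⟨upd s.v x (e.eval s), s.m⟩ n T) : Tri (.seq (.assign x e) q) s (1 + n) T :=
  .seq ⟨_, _, .assign s x e, silent_tick, le_rfl, h⟩

theorem Ext.of_var {X : List ℕ} {F : Set ℤ} {s s' : Conf} (hm : s'.m = s.m)
    (h0 : s'.v 0 = s.v 0) (hX : ∀ x, x ∉ X → s'.v x = s.v x) : Ext X F s s' :=
  ⟨h0.ge, fun _ _ _ => by rw [hm], hX⟩

/-- The union over the middle states r. The hypotheses `hl` and `hd` make its members disjoint: a
run determines its prefix of length l, and that prefix determines r. -/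
theorem cell_spec {s : Conf} {F : Set ℤ} {n : ℕ} {l : ℕ}
    {RA RB : ℕ → Set (List (Option (Fin Ω) × Fin Q))}
    (hh : 0 < s.v v_hp) (hF : ∀ z, s.v v_hp ≤ z → z ∈ F) (hn : s.v v_nQ = n)
    (hla : s.v v_la = l)
    (hA : ∀ r < n, EntC s.m F (s.v v_hp) (s.v v_pa + 3 * r) (RA r) ∧
      s.v v_pa + 3 * r + 3 ≤ s.v v_hp)
    (hB : ∀ r < n, EntC s.m F (s.v v_hp) (s.v v_pb + s.v v_w * r) (RB r) ∧
      s.v v_pb + s.v v_w * r + 3 ≤ s.v v_hp)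
    (hl : ∀ r, ∀ ρ ∈ RA r, ρ.length = l)
    (hd : ∀ r r' ρ, ρ ∈ RA r → ρ ∈ RA r' → r = r') :
    Tri cellCmd s (n * 44 + 7) fun s' =>
      Ext [v_hp, v_e, v_P, v_k, v_Q, v_l, v_it, v_c, v_a, v_b, v_r] Set.univ s s' ∧
      ∃ e L, (0 < s'.v v_e ↔ e = true) ∧
        Ref s'.m F (s'.v v_hp) (s'.v v_P) (s'.v v_k) L ∧
        Cov {ρ | ∃ r < n, ∃ ρ₁ ∈ RA r, ∃ ρ₂ ∈ RB r, ρ = ρ₁ ++ ρ₂} e L := by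
  rw [show n * 44 + 7 = 1 + (1 + (1 + (1 + (1 + (1 + (n * (43 + 1) + 1)))))) by ring]
  refine .assign (.assign (.assign (.assign (.assign (.assign ?_)))))
  refine (Tri.loop_count (n := 43) (fun j s' => j ≤ n ∧
    Ext [v_hp, v_e, v_P, v_k, v_Q, v_l, v_it, v_c, v_a, v_b, v_r] Set.univ s s' ∧
      s'.v v_r = j ∧ s'.v v_a = s.v v_pa + 3 * ((n : ℤ) - j) ∧
      s'.v v_b = s.v v_pb + s.v v_w * ((n : ℤ) - j) ∧
      ∃ e L, (0 < s'.v v_e ↔ e = true) ∧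
        Ref s'.m F (s'.v v_hp) (s'.v v_P) (s'.v v_k) L ∧
        Cov {ρ | ∃ r < n - j, ∃ ρ₁ ∈ RA r, ∃ ρ₂ ∈ RB r, ρ = ρ₁ ++ ρ₂} e L) ?_ ?_
        (k := n) ?_).mono le_rfl ?_
  · rintro s' ⟨-, -, h, -⟩
    simp [h]
  · rintro j s' ⟨hj, hx, hr, ha, hb, e, L, he, hL, hc⟩
    refine ⟨by simp only [Expr.eval_var, hr]; omega, ?_⟩
    -- The counter j + 1 is the number of middle states left, so the current one is r = n - j - 1.
    obtain ⟨r, rfl⟩ : ∃ r, n = r + j + 1 := ⟨n - j - 1, by omega⟩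
    have hsub : r + j + 1 - (j + 1) = r := by omega
    rw [hsub] at hc
    push_cast at ha hb
    rw [show (r : ℤ) + j + 1 - (j + 1) = r by ring] at ha hb
    obtain ⟨⟨ea, LA, hEA, hCA⟩, hAb⟩ := hA r (by omega)
    obtain ⟨⟨eb, LB, hEB, hCB⟩, hBb⟩ := hB r (by omega)
    have h0 := hx.hp
    have hEA' := hx.ent hEA (Set.subset_univ F) fun z _ hz => ⟨trivial, by omega⟩
    have hEB' := hx.ent hEB (Set.subset_univ F) fun z _ hz => ⟨trivial, by omega⟩
    rw [← ha] at hEA'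
    rw [← hb] at hEB'
    refine (Tri.seq (n := 40) (n' := 3) ((combine_spec (by omega) (fun z hz => hF z (by omega))
      hEA' (by omega) hEB' (by omega) he hL).mono le_rfl fun s₁ ⟨hy, he₁, L₁, hp₁, hL₁⟩ =>
      .of_lwp ?_ (by decide))).mono (by omega) fun _ h => h
    have hxy := hx.trans (hy.mono (by decide) subset_rfl)
    have e1 := hy.var v_a (by decide)
    have e2 := hy.var v_b (by decide)
    have e3 := hy.var v_r (by decide)
    have e4 := hxy.var v_w (by decide)
    have e5 := hx.var v_la (by decide)
    simp only [lwp, Expr.eval_var, Expr.eval_add, Expr.eval_sub, Expr.eval_one, Expr.eval_three]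
    refine ⟨by omega, hxy.trans (.of_var rfl (by simp [upd]) fun x hx => ?_), ?_, ?_, ?_,
      e || (ea && eb), _, by simpa [upd] using he₁, by simpa [upd] using hL₁, ?_⟩
    · simp at hx
      simp [upd, hx]
    · simp [upd, e3, hr]
    · simp [upd, e1, ha]; ring
    · simp [upd, e2, hb, e4]; ring
    · refine Cov.perm ?_ hp₁.symm
      rw [e5, hla]
      have := hc.union (hCA.mul hCB l (hl r)) ?_
      · convert this using 1
        ext ρ
        simp only [Set.mem_ofPred_eq, Set.mem_union]
        constructor
        · rintro ⟨r', h1, h2⟩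
          rcases (show r' < r ∨ r' = r by omega) with h | rfl
          · exact .inl ⟨r', h, h2⟩
          · exact .inr h2
        · rintro (⟨r', h1, h2⟩ | h)
          · exact ⟨r', by omega, h2⟩
          · exact ⟨r, by omega, h⟩
      -- A run in two members would have the same prefix in `RA r'` and `RA r`, although r' < r.
      · rintro ρ ⟨r', h1, ρ₁, m1, ρ₂, m2, rfl⟩ ⟨ρ₃, m3, ρ₄, m4, h⟩
        have := (List.append_inj h ((hl _ _ m1).trans (hl _ _ m3).symm)).1
        subst this
        have := hd _ _ _ m1 m3
        omega
  · refine ⟨le_rfl, .of_var rfl (by simp [upd]) fun x hx => ?_, by simp [upd, hn], by simp [upd],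
      by simp [upd], false, [], by simp [upd], .inl (by simp [upd]), ?_⟩
    · simp at hx
      simp [upd, hx]
    · simpa using Cov.empty
  · rintro s' ⟨-, hx, -, -, -, h⟩
    exact ⟨hx, by simpa using h⟩

/-- Compute a row of the product. -/
def rowCmd : Cmd :=
  seq (assign v_pb (var v_B + 1)) <| seq (assign v_j (var v_nQ)) <|
  loop (var v_j) (seq cellCmd (seq (store (var v_x) (var v_e)) (seq (store (var v_x + 1) (var v_P))
    (seq (store (var v_x + 2) (var v_k)) (seq (assign v_x (var v_x + 3))
      (seq (assign v_pb (var v_pb + 3)) (assign v_j (var v_j - 1))))))))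

/-- The row is written below the heap pointer while records are allocated above it. Because F avoids
the row (`hFx`), storing an entry disturbs neither the factors nor the records of entries stored
before. -/
theorem row_spec {s : Conf} {F : Set ℤ} {n : ℕ} {l : ℕ}
    {RA : ℕ → Set (List (Option (Fin Ω) × Fin Q))}
    {RB : ℕ → ℕ → Set (List (Option (Fin Ω) × Fin Q))}
    (hh : 0 < s.v v_hp) (hF : ∀ z, s.v v_hp ≤ z → z ∈ F) (hn : s.v v_nQ = n)
    (hla : s.v v_la = l)
    (hA : ∀ r < n, EntC s.m F (s.v v_hp) (s.v v_pa + 3 * r) (RA r) ∧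
      s.v v_pa + 3 * r + 3 ≤ s.v v_x)
    (hB : ∀ r < n, ∀ q < n, EntC s.m F (s.v v_hp) (s.v v_B + 1 + 3 * q + s.v v_w * r) (RB r q) ∧
      s.v v_B + 1 + 3 * q + s.v v_w * r + 3 ≤ s.v v_x)
    (hx0 : 0 ≤ s.v v_x) (hx : s.v v_x + 3 * n ≤ s.v v_hp)
    (hFx : ∀ z ∈ F, z < s.v v_x ∨ s.v v_x + 3 * n ≤ z)
    (hl : ∀ r, ∀ ρ ∈ RA r, ρ.length = l)
    (hd : ∀ r r' ρ, ρ ∈ RA r → ρ ∈ RA r' → r = r') :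
    Tri rowCmd s (n * (n * 44 + 14) + 3) fun s' =>
      Ext [v_hp, v_e, v_P, v_k, v_Q, v_l, v_it, v_c, v_a, v_b, v_r, v_x, v_pb, v_j]
        {z | z < s.v v_x ∨ s.v v_x + 3 * n ≤ z} s s' ∧ s'.v v_x = s.v v_x + 3 * n ∧
      ∀ q < n, EntC s'.m F (s'.v v_hp) (s.v v_x + 3 * q)
        {ρ | ∃ r < n, ∃ ρ₁ ∈ RA r, ∃ ρ₂ ∈ RB r q, ρ = ρ₁ ++ ρ₂} := by
  rw [show n * (n * 44 + 14) + 3 = 1 + (1 + (n * (n * 44 + 13 + 1) + 1)) by ring]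
  refine .assign (.assign ?_)
  refine (Tri.loop_count (n := n * 44 + 13) (fun j s' => j ≤ n ∧
    Ext [v_hp, v_e, v_P, v_k, v_Q, v_l, v_it, v_c, v_a, v_b, v_r, v_x, v_pb, v_j]
        {z | z < s.v v_x ∨ s.v v_x + 3 * n ≤ z} s s' ∧
      s'.v v_j = j ∧ s'.v v_x = s.v v_x + 3 * ((n : ℤ) - j) ∧
      s'.v v_pb = s.v v_B + 1 + 3 * ((n : ℤ) - j) ∧
      ∀ q < n - j, EntC s'.m F (s'.v v_hp) (s.v v_x + 3 * q)
        {ρ | ∃ r < n, ∃ ρ₁ ∈ RA r, ∃ ρ₂ ∈ RB r q, ρ = ρ₁ ++ ρ₂}) ?_ ?_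
        (k := n) ?_).mono le_rfl ?_
  · rintro s' ⟨-, -, h, -⟩
    simp [h]
  · rintro j s' ⟨hj, hy, hjv, hxv, hpb, hE⟩
    refine ⟨by simp only [Expr.eval_var, hjv]; omega, ?_⟩
    obtain ⟨q, rfl⟩ : ∃ q, n = q + j + 1 := ⟨n - j - 1, by omega⟩
    have hsub : q + j + 1 - (j + 1) = q := by omega
    rw [hsub] at hE
    generalize hN : q + j + 1 = n at *
    have hNz : (n : ℤ) - (j + 1) = q := by omega
    push_cast at hxv hpb
    rw [hNz] at hxv hpb
    have h0 := hy.hp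
    have hmem : ∀ z, z < s.v v_x → s'.m z = s.m z := fun z hz =>
      hy.mem z (.inl hz) (by omega)
    have tr : ∀ {x : ℤ} {R : Set (List (Option (Fin Ω) × Fin Q))}, EntC s.m F (s.v v_hp) x R →
        x + 3 ≤ s.v v_x → EntC s'.m F (s'.v v_hp) x R := fun h hx =>
      h.agree (fun z hz hz' => hy.mem z (hFx z hz) hz') (fun z _ h => hmem z (by omega))
        (fun _ h _ => h) h0
    have e1 := hy.var v_pa (by decide)
    have e2 := hy.var v_w (by decide)
    refine (Tri.seq (n := n * 44 + 7) (n' := 6) ((cell_spec (s := s') (F := F) (n := n) (l := l)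
      (RA := RA) (RB := fun r => RB r q) (by omega) (fun z hz => hF z (by omega))
      ((hy.var v_nQ (by decide)).trans hn) ((hy.var v_la (by decide)).trans hla)
      (fun r hr => ?_) (fun r hr => ?_) hl hd).mono le_rfl
      fun s₁ ⟨hz, e, L, he, hL, hc⟩ => .of_lwp ?_ (by decide))).mono (by omega) fun _ h => h
    · rw [e1]
      have := hA r hr
      exact ⟨tr this.1 this.2, by omega⟩
    · rw [hpb, e2]
      have := hB r hr q (by omega)
      exact ⟨tr this.1 this.2, by omega⟩
    have e3 := hz.var v_x (by decide)
    have e4 := hz.var v_pb (by decide)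
    have e5 := hz.var v_j (by decide)
    have h1 := hz.hp
    simp only [lwp, Expr.eval_var, Expr.eval_add, Expr.eval_sub, Expr.eval_one, Expr.eval_two,
      Expr.eval_three, e3, hxv]
    generalize hm : upd (upd (upd s₁.m _ _) _ _) _ _ = m
    have hm0 : ∀ z, z < s.v v_x + 3 * q ∨ s.v v_x + 3 * q + 3 ≤ z → m z = s₁.m z := by
      intro z hz
      rw [← hm, upd_of_ne _ _ (by omega), upd_of_ne _ _ (by omega), upd_of_ne _ _ (by omega)]
    have hmF : Agree F (s₁.v v_hp) s₁.m m := fun z hz _ => hm0 z (by have := hFx z hz; omega)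
    refine ⟨by omega, by omega, by omega, by omega,
      ⟨by simp [upd]; omega, fun z hz' hzl => ?_, fun x hx => ?_⟩, ?_, ?_, ?_, fun q' hq' => ?_⟩
    · rw [← hy.mem z hz' hzl, ← hz.mem z trivial (by omega)]
      refine hm0 z ?_
      rcases hz' with h | h <;> omega
    · rw [← hy.var x hx, ← hz.var x fun h => hx (by revert h; simp; omega)]
      simp at hx
      simp [upd, hx]
    · simp [upd, e5, hjv]
    · simp [upd]; omega
    · simp [upd, e4, hpb]; omega
    · have hhp : ∀ b c d : ℤ, upd (upd (upd s₁.v v_x b) v_pb c) v_j d v_hp = s₁.v v_hp := by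
        intro b c d
        rw [upd_of_ne _ _ (by decide), upd_of_ne _ _ (by decide), upd_of_ne _ _ (by decide)]
      rw [hhp]
      rcases (show q' < q ∨ q' = q by omega) with h | rfl
      · refine (hz.entC (hE q' h) (by omega)).agree hmF (fun z h1 h2 => hm0 z ?_)
          (fun _ h _ => h) le_rfl
        omega
      · refine ⟨e, L, ⟨?_, ?_⟩, hc⟩
        · rw [← hm, upd_of_ne _ _ (by omega), upd_of_ne _ _ (by omega), upd_same]
          exact he
        · have := hL.agree hmF (fun _ h _ => h) le_rfl
          rw [← hm]
          rw [upd_same, upd_of_ne _ _ (show s.v v_x + 3 * (q' : ℤ) + 1 ≠ _ by omega), upd_same]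
          rw [hm]
          exact this
  · refine ⟨le_rfl, .of_var rfl (by simp [upd]) fun x hx => ?_, by simp [upd, hn], by simp [upd],
      by simp [upd], by simp⟩
    simp at hx
    simp [upd, hx]
  · rintro s' ⟨-, hx, -, h, -, h'⟩
    exact ⟨hx, by simpa using h, by simpa using h'⟩

end

section

variable {Q Ω : ℕ}

/-- At `M` there is an `n × n` matrix whose entries represent the annotations of the runs in the
sets `R p q`; the number `len` is stored in front of the entries. -/
structure IsMat (m : ℤ → ℤ) (F : Set ℤ) (hi : ℤ) (n : ℕ) (M len : ℤ)
    (R : ℕ → ℕ → Set (List (Option (Fin Ω) × Fin Q))) : Prop where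
  pos : 0 < M
  cells : ∀ z, M ≤ z → z < M + (3 * (n * n : ℕ) + 1) → z ∈ F
  le : M + (3 * (n * n : ℕ) + 1) ≤ hi
  len : m M = len
  ent : ∀ p < n, ∀ q < n, EntC m F hi (M + 1 + 3 * (n * p + q : ℕ)) (R p q)

theorem mul_add_lt {n p q : ℕ} (hp : p < n) (hq : q < n) : n * p + q + 1 ≤ n * n := by
  have : n * (p + 1) ≤ n * n := Nat.mul_le_mul_left n hp
  rw [mul_add] at this
  omega

theorem IsMat.agree {m m' : ℤ → ℤ} {F F' : Set ℤ} {hi hi' M len : ℤ} {n : ℕ}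
    {R : ℕ → ℕ → Set (List (Option (Fin Ω) × Fin Q))} (h : IsMat m F hi n M len R)
    (hm : Agree F hi m m') (hF : ∀ z ∈ F, z < hi → z ∈ F') (hhi : hi ≤ hi') :
    IsMat m' F' hi' n M len R := by
  have := h.le
  refine ⟨h.pos, fun z h1 h2 => hF z (h.cells z h1 h2) (by omega), by omega, ?_,
    fun p hp q hq => (h.ent p hp q hq).agree hm (fun z h1 h2 => ?_) hF hhi⟩
  · rw [hm M (h.cells M le_rfl (by omega)) (by omega), h.len]
  · have := mul_add_lt hp hq
    refine hm z (h.cells z (by omega) (by omega)) (by omega)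

theorem Ext.isMat {X : List ℕ} {s s' : Conf} {F : Set ℤ} {n : ℕ} {M len : ℤ}
    {R : ℕ → ℕ → Set (List (Option (Fin Ω) × Fin Q))} (hs : Ext X F s s')
    (h : IsMat s.m F (s.v 0) n M len R) : IsMat s'.m F (s'.v 0) n M len R :=
  h.agree hs.mem (fun _ h _ => h) hs.hp

/-- Multiply the matrices at `A` and `B`. -/
def mulCmd : Cmd :=
  seq (assign v_C (var v_hp)) <| seq (assign v_hp (var v_hp + var v_sz)) <|
  seq (assign v_la (get (var v_A))) <|
  seq (assign v_x (var v_C + 1)) <| seq (assign v_pa (var v_A + 1)) <|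
  seq (assign v_i (var v_nQ)) <|
  seq (store (var v_C) (var v_la + get (var v_B))) <|
  loop (var v_i) (seq rowCmd (seq (assign v_pa (var v_pa + var v_w)) (assign v_i (var v_i - 1))))

theorem Tri.store {a e : Expr} {q : Cmd} {s : Conf} {n : ℕ} {T : Conf → Prop} (ha : 0 ≤ a.eval s)
    (h : Tri q ⟨s.v, upd s.m (a.eval s) (e.eval s)⟩ n T) :
    Tri (.seq (.store a e) q) s (1 + n) T :=
  .seq ⟨_, _, .store s a e ha, silent_tick, le_rfl, h⟩

/-- The space of the new matrix is reserved first, by raising the heap pointer by 3n² + 1 cells, and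
is then filled row by row. A footprint without these cells is used meanwhile. The first cell holds
the length of the document, which later products need as a shift. -/
theorem mul_spec {s : Conf} {F : Set ℤ} {n : ℕ} {l : ℕ} {l' : ℤ}
    {RA RB : ℕ → ℕ → Set (List (Option (Fin Ω) × Fin Q))}
    (hh : 0 < s.v v_hp) (hF : ∀ z, s.v v_hp ≤ z → z ∈ F) (hn : s.v v_nQ = n)
    (hw : s.v v_w = 3 * n) (hsz : s.v v_sz = 3 * (n * n : ℕ) + 1)
    (hA : IsMat s.m F (s.v v_hp) n (s.v v_A) l RA)
    (hB : IsMat s.m F (s.v v_hp) n (s.v v_B) l' RB)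
    (hl : ∀ p r, ∀ ρ ∈ RA p r, ρ.length = l)
    (hd : ∀ p r r' ρ, ρ ∈ RA p r → ρ ∈ RA p r' → r = r') :
    Tri mulCmd s (n * (n * (n * 44 + 14) + 6) + 8) fun s' =>
      Ext [v_hp, v_e, v_P, v_k, v_Q, v_l, v_it, v_c, v_a, v_b, v_r, v_x, v_pb, v_j, v_C, v_la,
        v_pa, v_i] Set.univ s s' ∧
      IsMat s'.m F (s'.v v_hp) n (s'.v v_C) (l + l')
        fun p q => {ρ | ∃ r < n, ∃ ρ₁ ∈ RA p r, ∃ ρ₂ ∈ RB r q, ρ = ρ₁ ++ ρ₂} := by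
  rw [show n * (n * (n * 44 + 14) + 6) + 8 =
    1 + (1 + (1 + (1 + (1 + (1 + (1 + (n * (n * (n * 44 + 14) + 5 + 1) + 1))))))) by ring]
  refine .assign (.assign (.assign (.assign (.assign (.assign (.store ?_ ?_))))))
  · simp [upd]; omega
  have hAle := hA.le
  have hBle := hB.le
  have hA0 := hA.pos
  have hB0 := hB.pos
  generalize hs₀ : Conf.mk _ _ = s₀
  have hm₀ : s₀.m = upd s.m (s.v v_hp) (l + l') := by
    rw [← hs₀]; simp [upd, hA.len, hB.len]
  have w0 : s₀.v v_hp = s.v v_hp + (3 * (n * n : ℕ) + 1) := by rw [← hs₀]; simp [upd, hsz]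
  have w1 : s₀.v v_C = s.v v_hp := by rw [← hs₀]; simp [upd]
  have w2 : s₀.v v_la = l := by rw [← hs₀]; simp [upd, hA.len]
  have w3 : s₀.v v_x = s.v v_hp + 1 := by rw [← hs₀]; simp [upd]
  have w4 : s₀.v v_pa = s.v v_A + 1 := by rw [← hs₀]; simp [upd]
  have w5 : s₀.v v_i = n := by rw [← hs₀]; simp [upd, hn]
  have hvar : ∀ x, x ∉ [v_hp, v_C, v_la, v_x, v_pa, v_i] → s₀.v x = s.v x := by
    intro x hx
    simp at hx
    rw [← hs₀]
    simp [upd, hx]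
  have w6 := hvar v_B (by decide)
  have w7 := hvar v_nQ (by decide)
  have w8 := hvar v_w (by decide)
  clear hs₀
  set C := s.v v_hp with hC
  have hn2 : n * n = n * n := rfl
  -- the cells outside of the new matrix
  let G : Set ℤ := {z | z ∈ F ∧ (z < C ∨ C + (3 * (n * n : ℕ) + 1) ≤ z)}
  have hGz : ∀ z ∈ G, z < C ∨ C + (3 * (n * n : ℕ) + 1) ≤ z := fun z hz => hz.2
  have trA : ∀ {x : ℤ} {R : Set (List (Option (Fin Ω) × Fin Q))}, EntC s.m F C x R →
      x + 3 ≤ C → EntC s₀.m G (s₀.v v_hp) x R := fun h hx =>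
    h.agree (fun z _ hz => by rw [hm₀, upd_of_ne _ _ (by omega)])
      (fun z _ hz => by rw [hm₀, upd_of_ne _ _ (by omega)])
      (fun z hz hzC => ⟨hz, .inl hzC⟩) (by omega)
  refine (Tri.loop_count (n := n * (n * 44 + 14) + 5) (fun j s' => j ≤ n ∧
    Ext [v_hp, v_e, v_P, v_k, v_Q, v_l, v_it, v_c, v_a, v_b, v_r, v_x, v_pb, v_j, v_pa, v_i]
        -- The case z = C is included: the length stored there must survive the loop.
        {z | z ≤ C ∨ C + (3 * (n * n : ℕ) + 1) ≤ z} s₀ s' ∧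
      s'.v v_i = j ∧ s'.v v_x = C + 1 + 3 * (n * (n - j) : ℕ) ∧
      s'.v v_pa = s.v v_A + 1 + 3 * (n * (n - j) : ℕ) ∧
      ∀ p < n - j, ∀ q < n, EntC s'.m G (s'.v v_hp) (C + 1 + 3 * (n * p + q : ℕ))
        {ρ | ∃ r < n, ∃ ρ₁ ∈ RA p r, ∃ ρ₂ ∈ RB r q, ρ = ρ₁ ++ ρ₂}) ?_ ?_
        (k := n) ?_).mono le_rfl ?_
  · rintro s' ⟨-, -, h, -⟩
    simp [h]
  · rintro j s' ⟨hj, hy, hjv, hxv, hpa, hE⟩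
    refine ⟨by simp only [Expr.eval_var, hjv]; omega, ?_⟩
    obtain ⟨p, hN⟩ : ∃ p, n = p + j + 1 := ⟨n - j - 1, by omega⟩
    have hsub : n - (j + 1) = p := by omega
    rw [hsub] at hE hxv hpa
    have h0 := hy.hp
    have hpn : n * p + n ≤ n * n := by
      have := Nat.mul_le_mul_left n (show p + 1 ≤ n by omega)
      rwa [mul_add, mul_one] at this
    have tr : ∀ {x : ℤ} {R : Set (List (Option (Fin Ω) × Fin Q))}, EntC s.m F C x R →
        x + 3 ≤ C → EntC s'.m G (s'.v v_hp) x R := fun h hx =>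
      (trA h hx).agree (fun z hz hz' => hy.mem z ((hGz z hz).imp le_of_lt id) hz')
        (fun z _ h => hy.mem z (.inl (by omega)) (by omega)) (fun _ h _ => h) h0
    have e1 := hy.var v_B (by decide)
    have e2 := hy.var v_w (by decide)
    have e3 := hy.var v_nQ (by decide)
    have e4 := hy.var v_la (by decide)
    refine (Tri.seq (n := n * (n * 44 + 14) + 3) (n' := 2) ((row_spec (s := s') (F := G) (n := n)
      (l := l) (RA := RA p) (RB := RB) (by omega)
      (fun z hz => ⟨hF z (by omega), .inr (by omega)⟩) (by omega) (by omega)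
      (fun r hr => ?_) (fun r hr q hq => ?_) (by omega) (by omega) (fun z hz => ?_)
      (hl p) (hd p)).mono le_rfl
      fun s₁ ⟨hz, hxz, hE₁⟩ => .of_lwp ?_ (by decide))).mono (by omega) fun _ h => h
    · have := mul_add_lt (show p < n by omega) hr
      have h1 := tr (hA.ent p (by omega) r hr) (by omega)
      rw [show s'.v v_pa + 3 * (r : ℤ) = s.v v_A + 1 + 3 * (n * p + r : ℕ) by
        rw [hpa]; push_cast; ring]
      exact ⟨h1, by omega⟩
    · have := mul_add_lt hr hq
      have h1 := tr (hB.ent r hr q hq) (by omega)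
      rw [show s'.v v_B + 1 + 3 * (q : ℤ) + s'.v v_w * r = s.v v_B + 1 + 3 * (n * r + q : ℕ) by
        rw [e1, e2, w6, w8, hw]; push_cast; ring]
      exact ⟨h1, by omega⟩
    · have := hGz z hz
      omega
    have e5 := hz.var v_i (by decide)
    have e6 := hz.var v_pa (by decide)
    have e7 := hz.var v_w (by decide)
    simp only [lwp, Expr.eval_var, Expr.eval_add, Expr.eval_sub, Expr.eval_one]
    have hnp : n - j = p + 1 := by omega
    have hnn : n * (p + 1) = n * p + n := by ring
    refine ⟨by omega, (hy.trans ((hz.mono (by decide) ?_))).trans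
      (.of_var rfl (by simp [upd]) fun x hx => ?_), ?_, ?_, ?_, fun p' hp' q hq => ?_⟩
    · rintro z (h | h)
      · exact .inl (by omega)
      · exact .inr (by omega)
    · simp at hx
      simp [upd, hx]
    · simp [upd, e5, hjv]
    · rw [hnp, hnn]
      simp [upd, hxz, hxv]; ring
    · rw [hnp, hnn]
      simp [upd, e6, hpa, e7, e2, w8, hw]; ring
    · have hhp : upd (upd s₁.v v_pa (s₁.v v_pa + s₁.v v_w)) v_i
          (upd s₁.v v_pa (s₁.v v_pa + s₁.v v_w) v_i - 1) v_hp = s₁.v v_hp := by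
        rw [upd_of_ne _ _ (by decide), upd_of_ne _ _ (by decide)]
      rw [hhp]
      rcases (show p' < p ∨ p' = p by omega) with h | rfl
      · have hpp : n * p' + n ≤ n * p := by
          have := Nat.mul_le_mul_left n (show p' + 1 ≤ p by omega)
          rwa [mul_add, mul_one] at this
        refine (hE p' h q hq).agree (fun z hz1 hz2 => hz.mem z ?_ hz2)
          (fun z h1 h2 => hz.mem z (.inl ?_) ?_) (fun _ h _ => h) hz.hp
        · have := hGz z hz1
          rcases this with h | h
          · exact .inl (by omega)
          · exact .inr (by omega)
        · omega
        · omega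
      · have := hE₁ q hq
        rwa [hxv, show C + 1 + 3 * ((n * p' : ℕ) : ℤ) + 3 * q = C + 1 + 3 * (n * p' + q : ℕ) by
          push_cast; ring] at this
  · exact ⟨le_rfl, .refl _ _ _, w5, by simpa using w3, by simpa using w4, by simp⟩
  · rintro s' ⟨-, hx, -, -, -, h⟩
    have h0 := hx.hp
    have hC' : s'.v v_C = C := (hx.var v_C (by decide)).trans w1
    refine ⟨⟨by omega, fun z _ hz => ?_, fun x hx' => ?_⟩, ?_⟩
    · rw [hx.mem z (.inl (by omega)) (by omega), hm₀, upd_of_ne _ _ (by omega)]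
    · rw [hx.var x fun h => hx' (by revert h; simp; omega),
        hvar x fun h => hx' (by revert h; simp; omega)]
    · rw [hC']
      refine ⟨hh, fun z h1 _ => hF z h1, by omega, ?_, fun p hp q hq => ?_⟩
      · rw [hx.mem C (.inl le_rfl) (by omega), hm₀, upd_same]
      · exact (h p (by omega) q hq).agree (fun _ _ _ => rfl) (fun _ _ _ => rfl)
          (fun z hz _ => hz.1) le_rfl

end

/-! ## Sets of runs -/

section Paths

variable {nQ nσ nΩ : ℕ} (A : AnnA (Fin nQ) (Fin nσ) (Fin nΩ))

/-- The runs from state number `p` to state number `q` over `d`. -/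
def paths (d : List (Fin nσ)) (p q : ℕ) : Set (List (Option (Fin nΩ) × Fin nQ)) :=
  {ρ | ∃ (hp : p < nQ) (hq : q < nQ), A.IsPath ⟨p, hp⟩ d ρ ⟨q, hq⟩}

theorem isPath_length {d : List (Fin nσ)} {p q : Fin nQ} {ρ : List (Option (Fin nΩ) × Fin nQ)}
    (h : A.IsPath p d ρ q) : ρ.length = d.length := by
  induction d generalizing p ρ with
  | nil => cases ρ with
    | nil => rfl
    | cons x ρ => exact h.elim
  | cons a d ih => cases ρ with
    | nil => exact h.elim
    | cons x ρ => simpa using ih h.2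

/-- A run lists the states it passes through, so it determines its last state. This is the source of
all disjointness of unions over states. -/
theorem isPath_unique {d : List (Fin nσ)} {p q q' : Fin nQ}
    {ρ : List (Option (Fin nΩ) × Fin nQ)} (h : A.IsPath p d ρ q) (h' : A.IsPath p d ρ q') :
    q = q' := by
  induction d generalizing p ρ with
  | nil => cases ρ with
    | nil => exact Eq.trans (Eq.symm h) h'
    | cons x ρ => exact h.elim
  | cons a d ih => cases ρ with
    | nil => exact h.elim
    | cons x ρ => exact ih h.2 h'.2

theorem isPath_append {d d' : List (Fin nσ)} {p q : Fin nQ}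
    {ρ : List (Option (Fin nΩ) × Fin nQ)} :
    A.IsPath p (d ++ d') ρ q ↔
      ∃ r ρ₁ ρ₂, A.IsPath p d ρ₁ r ∧ A.IsPath r d' ρ₂ q ∧ ρ = ρ₁ ++ ρ₂ := by
  induction d generalizing p ρ with
  | nil =>
    constructor
    · intro h
      exact ⟨p, [], ρ, rfl, h, rfl⟩
    · rintro ⟨r, ρ₁, ρ₂, h1, h2, rfl⟩
      cases ρ₁ with
      | nil => cases (show p = r from h1); exact h2
      | cons x ρ₁ => exact h1.elim
  | cons a d ih =>
    cases ρ with
    | nil =>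
      constructor
      · exact fun h => h.elim
      · rintro ⟨r, ρ₁, ρ₂, h1, h2, h⟩
        obtain ⟨rfl, rfl⟩ := List.append_eq_nil_iff.1 h.symm
        exact h1.elim
    | cons x ρ =>
      constructor
      · rintro ⟨h1, h2⟩
        obtain ⟨r, ρ₁, ρ₂, h3, h4, rfl⟩ := ih.1 h2
        exact ⟨r, x :: ρ₁, ρ₂, ⟨h1, h3⟩, h4, rfl⟩
      · rintro ⟨r, ρ₁, ρ₂, h1, h2, h⟩
        cases ρ₁ with
        | nil => exact h1.elim
        | cons y ρ₁ =>
          cases h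
          exact ⟨h1.1, ih.2 ⟨r, ρ₁, ρ₂, h1.2, h2, rfl⟩⟩

/-- The recursion for the matrices. States are natural numbers here, matching the row and column
indices; numbers outside the range have no runs. -/
theorem paths_append (d d' : List (Fin nσ)) (p q : ℕ) :
    paths A (d ++ d') p q =
      {ρ | ∃ r < nQ, ∃ ρ₁ ∈ paths A d p r, ∃ ρ₂ ∈ paths A d' r q, ρ = ρ₁ ++ ρ₂} := by
  ext ρ
  constructor
  · rintro ⟨hp, hq, h⟩
    obtain ⟨r, ρ₁, ρ₂, h1, h2, h3⟩ := (isPath_append A).1 h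
    exact ⟨r, r.2, ρ₁, ⟨hp, r.2, h1⟩, ρ₂, ⟨r.2, hq, h2⟩, h3⟩
  · rintro ⟨r, hr, ρ₁, ⟨hp, _, h1⟩, ρ₂, ⟨_, hq, h2⟩, h3⟩
    exact ⟨hp, hq, (isPath_append A).2 ⟨⟨r, hr⟩, ρ₁, ρ₂, h1, h2, h3⟩⟩

theorem length_of_mem_paths {d : List (Fin nσ)} {p q : ℕ}
    {ρ : List (Option (Fin nΩ) × Fin nQ)} (h : ρ ∈ paths A d p q) : ρ.length = d.length := by
  obtain ⟨_, _, h⟩ := h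
  exact isPath_length A h

theorem paths_unique {d : List (Fin nσ)} {p q q' : ℕ}
    {ρ : List (Option (Fin nΩ) × Fin nQ)} (h : ρ ∈ paths A d p q) (h' : ρ ∈ paths A d p q') :
    q = q' := by
  obtain ⟨_, _, h⟩ := h
  obtain ⟨_, _, h'⟩ := h'
  simpa using isPath_unique A h h'

theorem paths_nil {p q : ℕ} (hp : p < nQ) :
    paths A [] p q = if p = q then {[]} else ∅ := by
  ext ρ
  constructor
  · rintro ⟨hp, hq, h⟩
    cases ρ with
    | nil =>
      have : p = q := by simpa using (show (⟨p, hp⟩ : Fin nQ) = ⟨q, hq⟩ from h)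
      simp [this]
    | cons x ρ => exact h.elim
  · split_ifs with h
    · rintro rfl
      subst h
      exact ⟨hp, hp, rfl⟩
    · exact fun h => h.elim

/-- The runs of length one from `p` to `q` that use one of the given transitions reading `a`. -/
def single (ts : List (Fin nQ × Fin nσ × Option (Fin nΩ) × Fin nQ)) (a : Fin nσ) (p q : ℕ) :
    Set (List (Option (Fin nΩ) × Fin nQ)) :=
  {ρ | ∃ t ∈ ts, (t.1 : ℕ) = p ∧ t.2.1 = a ∧ (t.2.2.2 : ℕ) = q ∧ ρ = [t.2.2]}

theorem paths_single {ts : List (Fin nQ × Fin nσ × Option (Fin nΩ) × Fin nQ)}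
    (hts : ∀ e, e ∈ ts ↔ e ∈ A.trans) (a : Fin nσ) (p q : ℕ) :
    paths A [a] p q = single ts a p q := by
  ext ρ
  constructor
  · rintro ⟨hp, hq, h⟩
    match ρ, h with
    | [(b, r)], h =>
      obtain rfl : r = ⟨q, hq⟩ := h.2
      exact ⟨_, (hts _).2 h.1, rfl, rfl, rfl, rfl⟩
    | [], h => exact h.elim
    | _ :: _ :: _, h => exact h.2.elim
  · rintro ⟨⟨p', a', b, q'⟩, ht, rfl, rfl, rfl, rfl⟩
    exact ⟨p'.2, q'.2, (hts _).1 ht, rfl⟩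

end Paths

/-! ## Preprocessing: the input and the tables -/

section Pre

variable {nQ nσ nΩ nN : ℕ}

/-- The cells of a transition. -/
def encT (t : Fin nQ × Fin nσ × Option (Fin nΩ) × Fin nQ) : List ℤ :=
  (encodeTransition t).map fun x : ℕ => (x : ℤ)

/-- The cells of a rule. -/
def encR (S : SLP (Fin nN) (Fin nσ)) (B : Fin nN) : List ℤ :=
  ((S.rule B).length : ℤ) :: (S.rule B).map fun x => (encodeSymbol x : ℤ)

/-- The values of the variables that hold the parameters of the input, whose length is `E`. -/
structure Vars (A : AnnA (Fin nQ) (Fin nσ) (Fin nΩ)) (S : SLP (Fin nN) (Fin nσ))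
    (fs : List (Fin nQ)) (ts : List (Fin nQ × Fin nσ × Option (Fin nΩ) × Fin nQ)) (E : ℕ)
    (v : ℕ → ℤ) : Prop where
  hnS : v v_nS = nσ
  hnQ : v v_nQ = nQ
  hq0 : v v_q0 = (A.start : ℕ)
  hnF : v v_nF = fs.length
  htp : v v_tp = 6 + fs.length
  hnT : v v_nT = ts.length
  hrb : v v_rb + ((List.finRange nN).flatMap (encR S)).length = E
  hnN : v v_nN = nN
  hst : v v_st = (S.start : ℕ)
  hw : v v_w = 3 * nQ

/-- The values of the variables for the tables. -/
structure Tabs (nQ nσ nN E : ℕ) (v : ℕ → ℤ) : Prop where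
  rt : v v_rt = E
  mt : v v_mt = E + nN
  ro : v v_ro = E + nN + nσ + nN

/-- The part of the memory that holds the input. -/
structure Inp (S : SLP (Fin nN) (Fin nσ))
    (fs : List (Fin nQ)) (ts : List (Fin nQ × Fin nσ × Option (Fin nΩ) × Fin nQ)) (E : ℕ)
    (m : ℤ → ℤ) : Prop where
  hfs : At m 5 (fs.map fun q : Fin nQ => ((q : ℕ) : ℤ))
  fsle : 5 + fs.length ≤ E
  hts : At m (6 + fs.length) (ts.flatMap encT)
  tsle : 6 + fs.length + (ts.flatMap encT).length ≤ E
  rules : At m (E - ((List.finRange nN).flatMap (encR S)).length)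
    ((List.finRange nN).flatMap (encR S))
  rle : 6 + ((List.finRange nN).flatMap (encR S)).length ≤ E

theorem Inp.agree {S : SLP (Fin nN) (Fin nσ)} {fs : List (Fin nQ)}
    {ts : List (Fin nQ × Fin nσ × Option (Fin nΩ) × Fin nQ)} {E : ℕ} {m m' : ℤ → ℤ}
    (h : Inp S fs ts E m) (hm : ∀ z < (E : ℤ), m' z = m z) : Inp S fs ts E m' := by
  have h1 := h.fsle
  have h2 := h.tsle
  refine ⟨h.hfs.agree fun z _ hz => hm z ?_, h.fsle, h.hts.agree fun z _ hz => hm z ?_, h.tsle,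
    h.rules.agree fun z _ hz => hm z ?_, h.rle⟩
  · rw [List.length_map] at hz; omega
  · omega
  · omega

/-- Read the header of the input. -/
def headCmd : Cmd :=
  seq (assign v_nS (get 0)) <| seq (assign v_nQ (get 2)) <| seq (assign v_q0 (get 3)) <|
  seq (assign v_nF (get 4)) <| seq (assign v_tp (var v_nF + 5 + 1)) <|
  seq (assign v_nT (get (var v_nF + 5))) <|
  seq (assign v_rb (var v_tp + var v_nT + var v_nT + var v_nT + var v_nT + 2)) <|
  seq (assign v_nN (get (var v_rb - 2))) <| seq (assign v_st (get (var v_rb - 1))) <|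
  assign v_w (var v_nQ + var v_nQ + var v_nQ)

/-- The configuration in which the memory holds the input. -/
def initConf (input : List ℕ) : Conf :=
  ⟨fun _ => 0, fun z => if z < 0 then 0 else (input.getD z.toNat 0 : ℕ)⟩

theorem at_initConf (input : List ℕ) :
    At (initConf input).m 0 (input.map fun x : ℕ => (x : ℤ)) := by
  have key : ∀ (l l' : List ℕ),
      At (initConf (l ++ l')).m l.length (l'.map fun x : ℕ => (x : ℤ)) := by
    intro l l'
    induction l' generalizing l with
    | nil => trivial
    | cons x l' ih =>
      refine ⟨by simp [initConf], ?_⟩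
      have := ih (l ++ [x])
      simpa using this
  simpa using key [] input

theorem initConf_zero (input : List ℕ) (z : ℤ) (hz : (input.length : ℤ) ≤ z) :
    (initConf input).m z = 0 := by
  simp only [initConf]
  rw [if_neg (by omega), List.getD_eq_default _ _ (by omega)]
  rfl

theorem sim_initConf (input : List ℕ) : Sim (init input) (initConf input) :=
  ⟨fun _ => rfl, fun n => by simp [init, initConf], fun z hz => by simp [initConf, hz]⟩

theorem length_flatMap_encT (ts : List (Fin nQ × Fin nσ × Option (Fin nΩ) × Fin nQ)) :
    (ts.flatMap encT).length = 4 * ts.length := by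
  induction ts with
  | nil => rfl
  | cons t ts ih =>
    rcases t with ⟨p, a, _ | o, q⟩ <;>
    · simp only [List.flatMap_cons, List.length_append, ih, List.length_cons]
      simp [encT, encodeTransition]
      omega

theorem head_spec {A : AnnA (Fin nQ) (Fin nσ) (Fin nΩ)} {S : SLP (Fin nN) (Fin nσ)}
    {fs : List (Fin nQ)} {ts : List (Fin nQ × Fin nσ × Option (Fin nΩ) × Fin nQ)}
    {input : List ℕ} (h : input = [nσ, nΩ, nQ, (A.start : ℕ)] ++ (fs.length :: fs.map Fin.val) ++
      (ts.length :: ts.flatMap encodeTransition) ++ encodeSLP S) :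
    Tri headCmd (initConf input) 10 fun s => Vars A S fs ts input.length s.v ∧
      Inp S fs ts input.length s.m ∧ s.m = (initConf input).m := by
  have hat := at_initConf input
  set m := (initConf input).m with hm
  have hmap : (input.map fun x : ℕ => (x : ℤ)) = [(nσ : ℤ), nΩ, nQ, (A.start : ℕ)] ++
      ((fs.length : ℤ) :: fs.map fun q : Fin nQ => ((q : ℕ) : ℤ)) ++
      ((ts.length : ℤ) :: ts.flatMap encT) ++
      ([(nN : ℤ), (S.start : ℕ)] ++ (List.finRange nN).flatMap (encR S)) := by
    rw [h, encodeSLP]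
    simp [List.map_flatMap, Function.comp_def]
    rfl
  have hlen : input.length = 8 + fs.length + 4 * ts.length +
      ((List.finRange nN).flatMap (encR S)).length := by
    have := congrArg List.length hmap
    rw [List.length_map] at this
    rw [this]
    simp only [List.length_append, List.length_cons, List.length_map, length_flatMap_encT,
      List.length_nil]
    omega
  rw [hmap] at hat
  simp only [at_append, At, List.length_append, List.length_cons, List.length_map, List.length_nil,
    length_flatMap_encT] at hat
  obtain ⟨⟨⟨⟨a0, a1, a2, a3, -⟩, a4, a5⟩, a6, a7⟩, ⟨a8, a9, -⟩, a10⟩ := hat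
  norm_num [add_assoc] at a0 a1 a2 a3 a4 a5 a6 a7 a8 a9 a10
  replace a6 : m (5 + (fs.length : ℤ)) = ts.length := by rw [← a6]; congr 1; ring
  refine .of_lwp ?_ (by decide)
  simp only [headCmd, lwp, Expr.eval_get, Expr.eval_zero, Expr.eval_one, Expr.eval_two,
    Expr.eval_three, Expr.eval_four, Expr.eval_five, Expr.eval_var, Expr.eval_add, Expr.eval_sub]
  simp only [upd, Nat.reduceEqDiff, if_true, if_false, reduceIte, OfNat.ofNat_ne_zero,
    OfNat.zero_ne_ofNat, OfNat.ofNat_ne_one, OfNat.one_ne_ofNat, ← hm, a0, a2, a3, a4]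
  rw [show (fs.length : ℤ) + 5 = 5 + fs.length by ring, a6]
  have e8 : m (5 + (fs.length : ℤ) + 1 + ts.length + ts.length + ts.length + ts.length + 2 - 2)
      = nN := by
    rw [← a8]; congr 1; ring
  have e9 : m (5 + (fs.length : ℤ) + 1 + ts.length + ts.length + ts.length + ts.length + 2 - 1)
      = (S.start : ℕ) := by
    rw [← a9]; congr 1; ring
  refine ⟨⟨rfl, by simp [upd], by simp [upd], by simp [upd], ?_, by simp [upd], ?_, ?_, ?_, ?_⟩,
    ⟨a5, by omega, ?_, ?_, ?_, by omega⟩, trivial⟩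
  · simp [upd]; ring
  · rw [hlen]
    generalize ((List.finRange nN).flatMap (encR S)).length = R
    simp [upd]
    ring
  · simpa [upd] using e8
  · simpa [upd] using e9
  · simp [upd]; ring
  · convert a7 using 1; ring
  · rw [length_flatMap_encT]; omega
  · convert a10 using 1; rw [hlen]; push_cast; ring

theorem Vars.congr {A : AnnA (Fin nQ) (Fin nσ) (Fin nΩ)} {S : SLP (Fin nN) (Fin nσ)}
    {fs : List (Fin nQ)} {ts : List (Fin nQ × Fin nσ × Option (Fin nΩ) × Fin nQ)} {E : ℕ}
    {v v' : ℕ → ℤ} (h : Vars A S fs ts E v)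
    (hv : ∀ x ∈ [v_nS, v_nQ, v_q0, v_nF, v_tp, v_nT, v_rb, v_nN, v_st, v_w], v' x = v x) :
    Vars A S fs ts E v' := by
  obtain ⟨h1, h2, h3, h4, h5, h6, h7, h8, h9, h10⟩ := h
  constructor <;> rw [hv _ (by decide)] <;> assumption

theorem Tabs.congr {E : ℕ} {v v' : ℕ → ℤ} (h : Tabs nQ nσ nN E v)
    (hv : ∀ x ∈ [v_rt, v_mt, v_ro], v' x = v x) : Tabs nQ nσ nN E v' := by
  obtain ⟨h1, h2, h3⟩ := h
  constructor <;> rw [hv _ (by decide)] <;> assumption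

/-- Find the end of the input and fix the addresses of the tables. -/
def endCmd : Cmd :=
  seq (assign v_p (var v_rb)) <| seq (assign v_i (var v_nN)) <|
  seq (loop (var v_i) (seq (assign v_p (var v_p + get (var v_p) + 1))
    (assign v_i (var v_i - 1)))) <|
  seq (assign v_rt (var v_p)) <| seq (assign v_mt (var v_p + var v_nN)) <|
  seq (assign v_ro (var v_mt + var v_nS + var v_nN)) <| assign v_hp (var v_ro + var v_nQ)

/-- The input does not state its own length. The end is found by hopping over the rules, each of
which starts with its length; all tables are placed behind it, where the memory is still 0. -/
theorem end_spec {A : AnnA (Fin nQ) (Fin nσ) (Fin nΩ)} {S : SLP (Fin nN) (Fin nσ)}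
    {fs : List (Fin nQ)} {ts : List (Fin nQ × Fin nσ × Option (Fin nΩ) × Fin nQ)} {E : ℕ}
    {s : Conf} (hv : Vars A S fs ts E s.v) (hm : Inp S fs ts E s.m) :
    Tri endCmd s (nN * 3 + 7) fun s' => Tabs nQ nσ nN E s'.v ∧
      s'.v v_hp = E + nN + nσ + nN + nQ ∧ s'.m = s.m ∧
      ∀ x, x ∉ [v_hp, v_rt, v_mt, v_ro, v_i, v_p] → s'.v x = s.v x := by
  rw [show nN * 3 + 7 = 1 + (1 + ((nN * (2 + 1) + 1) + 4)) by ring]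
  refine .assign (.assign (.seq ?_))
  have := Tri.loop_list (e := var v_i) (n := 2)
    (p := seq (assign v_p (var v_p + get (var v_p) + 1)) (assign v_i (var v_i - 1)))
    (fun (l : List (Fin nN)) s' => s'.m = s.m ∧ s'.v v_i = l.length ∧
      At s.m (s'.v v_p) (l.flatMap (encR S)) ∧ s'.v v_p + (l.flatMap (encR S)).length = E ∧
      ∀ x, x ∉ [v_i, v_p] → s'.v x = s.v x) ?_ ?_ (l := List.finRange nN)
      (s := ⟨upd (upd s.v v_p ((var v_rb).eval s)) v_i
        ((var v_nN).eval ⟨upd s.v v_p ((var v_rb).eval s), s.m⟩), s.m⟩) ?_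
  · rw [List.length_finRange] at this
    refine this.mono le_rfl ?_
    rintro s₁ ⟨h1, h2, -, h4, h5⟩
    refine .of_lwp ?_ (by decide)
    have h4' : s₁.v v_p = E := by simpa using h4
    have g1 := h5 v_nN (by decide)
    have g2 := h5 v_nS (by decide)
    have g3 := h5 v_nQ (by decide)
    rw [hv.hnN] at g1
    rw [hv.hnS] at g2
    rw [hv.hnQ] at g3
    simp only [lwp, Expr.eval_var, Expr.eval_add]
    refine ⟨⟨?_, ?_, ?_⟩, ?_, h1, fun x hx => ?_⟩
    · simp [upd, h4']
    · simp [upd, h4', g1]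
    · simp [upd, h4', g1, g2]
    · simp [upd, h4', g1, g2, g3]
    · rw [← h5 x (fun h => hx (by revert h; simp; omega))]
      simp at hx
      simp [upd, hx]
  · rintro s' ⟨-, h, -⟩
    simp [h]
  · rintro B l s' ⟨h1, h2, h3, h4, h5⟩
    refine ⟨by simp only [Expr.eval_var, h2, List.length_cons]; omega, .of_lwp ?_ (by decide)⟩
    rw [List.flatMap_cons] at h3 h4
    rw [at_append] at h3
    have h6 : s.m (s'.v v_p) = (S.rule B).length := h3.1.1
    have h7 : ((encR S B).length : ℤ) = (S.rule B).length + 1 := by simp [encR]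
    simp only [lwp, Expr.eval_var, Expr.eval_add, Expr.eval_sub, Expr.eval_one, Expr.eval_get]
    refine ⟨h1, ?_, ?_, ?_, fun x hx => ?_⟩
    · simp [upd, h2]
    · have := h3.2
      rw [h7] at this
      rw [upd_of_ne _ _ (by decide), upd_same, h1, h6]
      convert this using 1; ring
    · rw [List.length_append] at h4
      rw [upd_of_ne _ _ (by decide), upd_same, h1, h6]
      push_cast at h4
      omega
    · rw [← h5 x hx]
      simp at hx
      simp [upd, hx]
  · refine ⟨rfl, ?_, ?_, ?_, fun x hx => ?_⟩
    · simp [upd, hv.hnN]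
    · have h1 := hm.rules
      have h2 := hv.hrb
      have h3 : s.v v_rb = E - ((List.finRange nN).flatMap (encR S)).length := by omega
      dsimp only
      rw [upd_of_ne _ _ (by decide), upd_same, Expr.eval_var, h3]
      exact h1
    · dsimp only
      rw [upd_of_ne _ _ (by decide), upd_same]
      exact hv.hrb
    · simp at hx
      simp [upd, hx]

/-- The addresses of the rules are stored from address `E` on. -/
def RuleTab (S : SLP (Fin nN) (Fin nσ)) (E : ℕ) (m : ℤ → ℤ) (B : Fin nN) : Prop :=
  0 ≤ m (E + (B : ℕ)) ∧ m (E + (B : ℕ)) + (encR S B).length ≤ E ∧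
    At m (m (E + (B : ℕ))) (encR S B)

theorem RuleTab.agree {S : SLP (Fin nN) (Fin nσ)} {E : ℕ} {m m' : ℤ → ℤ} {B : Fin nN}
    (h : RuleTab S E m B) (hm : ∀ z < (E : ℤ) + nN, m' z = m z) : RuleTab S E m' B := by
  obtain ⟨h1, h2, h3⟩ := h
  have := B.2
  have e := hm (E + (B : ℕ)) (by omega)
  unfold RuleTab
  rw [e]
  exact ⟨h1, h2, h3.agree fun z _ hz => hm z (by omega)⟩

/-- Store the addresses of the rules. -/
def scanCmd : Cmd :=
  seq (assign v_p (var v_rb)) <| seq (assign v_i (var v_nN)) <| seq (assign v_x (var v_rt)) <|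
  loop (var v_i) (seq (store (var v_x) (var v_p)) (seq (assign v_p (var v_p + get (var v_p) + 1))
    (seq (assign v_x (var v_x + 1)) (assign v_i (var v_i - 1)))))

/-- A second pass over the rules, now recording their addresses, gives access to the rule of any
nonterminal in constant time. -/
theorem scan_spec {A : AnnA (Fin nQ) (Fin nσ) (Fin nΩ)} {S : SLP (Fin nN) (Fin nσ)}
    {fs : List (Fin nQ)} {ts : List (Fin nQ × Fin nσ × Option (Fin nΩ) × Fin nQ)} {E : ℕ}
    {s : Conf} (hv : Vars A S fs ts E s.v) (ht : Tabs nQ nσ nN E s.v) (hm : Inp S fs ts E s.m) :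
    Tri scanCmd s (nN * 5 + 4) fun s' => (∀ B, RuleTab S E s'.m B) ∧
      (∀ z : ℤ, z < E ∨ (E : ℤ) + nN ≤ z → s'.m z = s.m z) ∧
      ∀ x, x ∉ [v_x, v_i, v_p] → s'.v x = s.v x := by
  rw [show nN * 5 + 4 = 1 + (1 + (1 + (nN * (4 + 1) + 1))) by ring]
  refine .assign (.assign (.assign ?_))
  have := Tri.loop_list (e := var v_i) (n := 4)
    (p := (seq (store (var v_x) (var v_p)) (seq (assign v_p (var v_p + get (var v_p) + 1))
    (seq (assign v_x (var v_x + 1)) (assign v_i (var v_i - 1))))))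
    (fun (l : List (Fin nN)) s' => (∀ z : ℤ, z < E ∨ (E : ℤ) + nN ≤ z → s'.m z = s.m z) ∧
      s'.v v_i = l.length ∧
      At s.m (s'.v v_p) (l.flatMap (encR S)) ∧ s'.v v_p + (l.flatMap (encR S)).length = E ∧
      (∀ x, x ∉ [v_x, v_i, v_p] → s'.v x = s.v x) ∧ 0 ≤ s'.v v_p ∧
      ∃ d, List.finRange nN = d ++ l ∧ s'.v v_x = E + d.length ∧ ∀ B ∈ d, RuleTab S E s'.m B)
    ?_ ?_ (l := List.finRange nN)
    (s := ⟨upd (upd (upd s.v v_p ((var v_rb).eval s)) v_i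
        ((var v_nN).eval ⟨upd s.v v_p ((var v_rb).eval s), s.m⟩)) v_x
        ((var v_rt).eval ⟨upd (upd s.v v_p ((var v_rb).eval s)) v_i
        ((var v_nN).eval ⟨upd s.v v_p ((var v_rb).eval s), s.m⟩), s.m⟩), s.m⟩) ?_
  · rw [List.length_finRange] at this
    refine this.mono le_rfl ?_
    rintro s₁ ⟨h1, h2, -, h4, h5, -, d, h6, -, h7⟩
    rw [List.append_nil] at h6
    exact ⟨fun B => h7 B (h6 ▸ List.mem_finRange B), h1, h5⟩
  · rintro s' ⟨-, h, -⟩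
    simp [h]
  · rintro B l s' ⟨h1, h2, h3, h4, h5, hp0, d, hd, hx, hR⟩
    refine ⟨by simp only [Expr.eval_var, h2, List.length_cons]; omega, .of_lwp ?_ (by decide)⟩
    rw [List.flatMap_cons] at h3 h4
    rw [at_append] at h3
    have h6 : s.m (s'.v v_p) = (S.rule B).length := h3.1.1
    have h7 : ((encR S B).length : ℤ) = (S.rule B).length + 1 := by simp [encR]
    -- Rules come in the order of their left-hand sides, so the rule met after `d.length` others
    -- belongs in the cell for B.
    have hBd : (B : ℕ) = d.length := by
      have h8 : (List.finRange nN)[d.length]? = some B := by simp [hd]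
      rw [List.getElem?_eq_some_iff] at h8
      obtain ⟨h9, h10⟩ := h8
      rw [← h10]
      simp
    have hB := B.2
    rw [List.length_append] at h4
    push_cast at h4
    simp only [lwp, Expr.eval_var, Expr.eval_add, Expr.eval_sub, Expr.eval_one, Expr.eval_get]
    have hmz : ∀ z : ℤ, z < E ∨ (E : ℤ) + nN ≤ z → upd s'.m (s'.v v_x) (s'.v v_p) z = s.m z := by
      intro z hz
      rw [upd_of_ne _ _ (by omega), h1 z hz]
    have hmp := hmz (s'.v v_p) (by omega)
    refine ⟨by omega, hmz, ?_, ?_, ?_, fun x hx => ?_, ?_, d ++ [B], by simp [hd], ?_, ?_⟩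
    · simp [upd, h2]
    · have := h3.2
      rw [h7] at this
      rw [upd_of_ne _ _ (by decide), upd_of_ne _ _ (by decide), upd_same, hmp, h6]
      convert this using 1; ring
    · simp only [hmp, h6]
      simp [upd] at h4 ⊢
      omega
    · rw [← h5 x hx]
      simp at hx
      simp [upd, hx]
    · simp only [hmp, h6]
      simp [upd]
      omega
    · simp [upd, hx]; ring
    · intro B' hB'
      rcases List.mem_append.1 hB' with hBd' | hB'
      · obtain ⟨g1, g2, g3⟩ := hR B' hBd'
        have hne : (B' : ℕ) ≠ d.length := by
          intro h
          have : B' = B := Fin.ext (h.trans hBd.symm)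
          subst this
          have hn : (List.finRange nN).Nodup := List.nodup_finRange nN
          rw [hd, List.nodup_append] at hn
          exact hn.2.2 B' hBd' B' (by simp) rfl
        unfold RuleTab
        rw [upd_of_ne _ _ (show (E : ℤ) + (B' : ℕ) ≠ s'.v v_x by omega)]
        refine ⟨g1, g2, g3.agree fun z _ hz => ?_⟩
        rw [hmz z (by omega), h1 z (by omega)]
      · rw [List.mem_singleton] at hB'
        subst hB'
        unfold RuleTab
        rw [show (E : ℤ) + (B' : ℕ) = s'.v v_x by omega, upd_same]
        refine ⟨hp0, by omega, h3.1.agree fun z _ hz => hmz z (by omega)⟩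
  · have h2 := hv.hrb
    have h3 : s.v v_rb = E - ((List.finRange nN).flatMap (encR S)).length := by omega
    have := hm.rle
    refine ⟨fun _ _ => rfl, ?_, ?_, ?_, fun x hx => ?_, ?_, [], rfl, ?_, by simp⟩
    · simp [upd, hv.hnN]
    · dsimp only
      rw [upd_of_ne _ _ (by decide), upd_of_ne _ _ (by decide), upd_same, Expr.eval_var, h3]
      exact hm.rules
    · dsimp only
      rw [upd_of_ne _ _ (by decide), upd_of_ne _ _ (by decide), upd_same]
      exact hv.hrb
    · simp at hx
      simp [upd, hx]
    · dsimp only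
      rw [upd_of_ne _ _ (by decide), upd_of_ne _ _ (by decide), upd_same, Expr.eval_var, h3]
      omega
    · simp [upd, ht.rt]

/-! ### Row offsets and the two constant matrices. -/

/-- Store the offsets of the rows of a matrix. -/
def offCmd : Cmd :=
  seq (assign v_i (var v_nQ)) <| seq (assign v_p 0) <| seq (assign v_x (var v_ro)) <|
  seq (loop (var v_i) (seq (store (var v_x) (var v_p)) (seq (assign v_p (var v_p + var v_w))
    (seq (assign v_x (var v_x + 1)) (assign v_i (var v_i - 1)))))) <|
  assign v_sz (var v_p + 1)

/-- The machine cannot multiply. The products 3·nQ·p that address the rows, and the size of a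
matrix, are obtained once by repeated addition. -/
theorem off_spec {s : Conf} (hn : s.v v_nQ = nQ) (hw : s.v v_w = 3 * nQ) (hro : 0 ≤ s.v v_ro) :
    Tri offCmd s (nQ * 5 + 5) fun s' =>
      (∀ p < nQ, s'.m (s.v v_ro + p) = 3 * (nQ * p : ℕ)) ∧
      s'.v v_sz = 3 * (nQ * nQ : ℕ) + 1 ∧
      (∀ z, z < s.v v_ro ∨ s.v v_ro + nQ ≤ z → s'.m z = s.m z) ∧
      ∀ x, x ∉ [v_x, v_i, v_p, v_sz] → s'.v x = s.v x := by
  rw [show nQ * 5 + 5 = 1 + (1 + (1 + (nQ * (4 + 1) + 1 + 1))) by ring]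
  refine .assign (.assign (.assign (.seq ?_)))
  refine (Tri.loop_count (n := 4) (fun j s' => j ≤ nQ ∧
      (∀ p < nQ - j, s'.m (s.v v_ro + p) = 3 * (nQ * p : ℕ)) ∧
      s'.v v_i = j ∧ s'.v v_x = s.v v_ro + (nQ - j : ℕ) ∧ s'.v v_p = 3 * (nQ * (nQ - j) : ℕ) ∧
      (∀ z, z < s.v v_ro ∨ s.v v_ro + nQ ≤ z → s'.m z = s.m z) ∧
      ∀ x, x ∉ [v_x, v_i, v_p] → s'.v x = s.v x) ?_ ?_ (k := nQ) ?_).mono le_rfl ?_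
  · rintro s' ⟨-, -, h, -⟩
    simp [h]
  · rintro j s' ⟨hj, hr, hi, hx, hp, hm, hv⟩
    refine ⟨by simp only [Expr.eval_var, hi]; omega, .of_lwp ?_ (by decide)⟩
    obtain ⟨p, hN⟩ : ∃ p, nQ = p + j + 1 := ⟨nQ - j - 1, by omega⟩
    have hsub : nQ - (j + 1) = p := by omega
    have hsub' : nQ - j = p + 1 := by omega
    rw [hsub] at hr hx hp
    rw [hsub']
    have e1 := hv v_w (by decide)
    simp only [lwp, Expr.eval_var, Expr.eval_add, Expr.eval_sub, Expr.eval_one]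
    refine ⟨by omega, by omega, fun p' hp' => ?_, ?_, ?_, ?_, fun z hz => ?_, fun x hx' => ?_⟩
    · rcases (show p' < p ∨ p' = p by omega) with h | rfl
      · rw [upd_of_ne _ _ (by omega), hr p' h]
      · rw [hx, upd_same, hp]
    · simp [upd, hi]
    · simp [upd, hx]; ring
    · simp [upd, hp, e1, hw]; ring
    · rw [upd_of_ne _ _ (by omega), hm z hz]
    · rw [← hv x hx']
      simp at hx'
      simp [upd, hx']
  · refine ⟨le_rfl, by simp, by simp [upd, hn], by simp [upd], by simp [upd], fun _ _ => rfl,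
      fun x hx => ?_⟩
    simp at hx
    simp [upd, hx]
  · rintro s' ⟨-, hr, -, -, hp, hm, hv⟩
    refine .of_lwp ?_ (by decide)
    simp only [lwp, Expr.eval_var, Expr.eval_add, Expr.eval_one]
    refine ⟨by simpa using hr, by simp [hp], hm, fun x hx => ?_⟩
    rw [← hv x (fun h => hx (by revert h; simp; omega))]
    simp at hx
    simp [upd, hx]

/-- Create the matrices for a letter without transitions and for the empty document. -/
def unitCmd : Cmd :=
  seq (assign v_zm (var v_hp)) <| seq (store (var v_hp) 1) <|
  seq (assign v_hp (var v_hp + var v_sz)) <| seq (assign v_id (var v_hp)) <|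
  seq (assign v_hp (var v_hp + var v_sz)) <|
  seq (assign v_x (var v_id + 1)) <| seq (assign v_i (var v_nQ)) <|
  loop (var v_i) (seq (store (var v_x) 1) (seq (assign v_x (var v_x + var v_w + 3))
    (assign v_i (var v_i - 1))))

/-- Uniqueness of division with remainder: different index pairs belong to different cells of a
matrix. -/
theorem mul_add_inj {n p q r t : ℕ} (hq : q < n) (ht : t < n) (h : n * p + q = n * r + t) :
    p = r ∧ q = t := by
  have h1 := congrArg (· % n) h
  have h2 := congrArg (· / n) h
  have hn : 0 < n := by omega
  simp only [Nat.mul_add_mod, Nat.mod_eq_of_lt hq, Nat.mod_eq_of_lt ht] at h1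
  simp only [Nat.mul_add_div hn, Nat.div_eq_of_lt hq, Nat.div_eq_of_lt ht, add_zero] at h2
  exact ⟨h2, h1⟩

theorem EntC.of_zero {m : ℤ → ℤ} {F : Set ℤ} {hi x : ℤ} (h0 : m x = 0) (h1 : m (x + 1) = 0) :
    EntC m F hi x (∅ : Set (List (Option (Fin nΩ) × Fin nQ))) :=
  ⟨false, [], ⟨by simp [h0], .inl ⟨h1, rfl⟩⟩, .empty⟩

/-- Unused memory is 0, and an entry consisting of zeros represents the empty set of runs. So
reserving space already creates an empty matrix, and for the empty document only the diagonal flags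
have to be set. The time is linear in nQ although the matrices have quadratic size. -/
theorem unit_spec (A : AnnA (Fin nQ) (Fin nσ) (Fin nΩ)) {s : Conf} {F : Set ℤ}
    (hn : s.v v_nQ = nQ) (hw : s.v v_w = 3 * nQ) (hsz : s.v v_sz = 3 * (nQ * nQ : ℕ) + 1)
    (hh : 0 < s.v v_hp) (hz : ∀ z, s.v v_hp ≤ z → s.m z = 0) (hF : ∀ z, s.v v_hp ≤ z → z ∈ F) :
    Tri unitCmd s (nQ * 4 + 8) fun s' =>
      IsMat s'.m F (s'.v v_hp) nQ (s'.v v_zm) 1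
        (fun _ _ => (∅ : Set (List (Option (Fin nΩ) × Fin nQ)))) ∧
      IsMat s'.m F (s'.v v_hp) nQ (s'.v v_id) 0 (paths A []) ∧
      Ext [v_hp, v_zm, v_id, v_x, v_i] Set.univ s s' ∧ ∀ z, s'.v v_hp ≤ z → s'.m z = 0 := by
  rw [show nQ * 4 + 8 = 1 + (1 + (1 + (1 + (1 + (1 + (1 + (nQ * (3 + 1) + 1))))))) by ring]
  refine .assign (.store ?_ (.assign (.assign (.assign (.assign (.assign ?_))))))
  · simp [upd]; omega
  generalize hs₀ : Conf.mk _ _ = s₀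
  have hm₀ : s₀.m = upd s.m (s.v v_hp) 1 := by
    rw [← hs₀]; simp [upd]
  -- Two matrices are reserved, one after the other: the empty one and the identity.
  have w0 : s₀.v v_hp = s.v v_hp + 2 * (3 * (nQ * nQ : ℕ) + 1) := by
    rw [← hs₀]; simp [upd, hsz]; ring
  have w1 : s₀.v v_zm = s.v v_hp := by rw [← hs₀]; simp [upd]
  have w2 : s₀.v v_id = s.v v_hp + (3 * (nQ * nQ : ℕ) + 1) := by rw [← hs₀]; simp [upd, hsz]
  have w3 : s₀.v v_x = s₀.v v_id + 1 := by rw [← hs₀]; simp [upd]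
  have w4 : s₀.v v_i = nQ := by rw [← hs₀]; simp [upd, hn]
  have hvar : ∀ x, x ∉ [v_hp, v_zm, v_id, v_x, v_i] → s₀.v x = s.v x := by
    intro x hx
    simp at hx
    rw [← hs₀]
    simp [upd, hx]
  have w5 := hvar v_w (by decide)
  clear hs₀
  set H := s.v v_hp with hH
  set I := s₀.v v_id with hI
  have hpn : ∀ p < nQ, nQ * p + p + 1 ≤ nQ * nQ := fun p hp => mul_add_lt hp hp
  refine (Tri.loop_count (n := 3) (fun j s' => j ≤ nQ ∧
      (∀ p < nQ - j, s'.m (I + 1 + 3 * (nQ * p + p : ℕ)) = 1) ∧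
      s'.v v_i = j ∧ s'.v v_x = I + 1 + 3 * (nQ * (nQ - j) + (nQ - j) : ℕ) ∧
      (∀ z, (∀ p < nQ, z ≠ I + 1 + 3 * (nQ * p + p : ℕ)) → s'.m z = s₀.m z) ∧
      ∀ x, x ∉ [v_x, v_i] → s'.v x = s₀.v x) ?_ ?_ (k := nQ) ?_).mono le_rfl ?_
  · rintro s' ⟨-, -, h, -⟩
    simp [h]
  · rintro j s' ⟨hj, hr, hi, hx, hm, hv⟩
    refine ⟨by simp only [Expr.eval_var, hi]; omega, .of_lwp ?_ (by decide)⟩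
    obtain ⟨p, hN⟩ : ∃ p, nQ = p + j + 1 := ⟨nQ - j - 1, by omega⟩
    have hsub : nQ - (j + 1) = p := by omega
    have hsub' : nQ - j = p + 1 := by omega
    rw [hsub] at hr hx
    rw [hsub']
    have e1 := hv v_w (by decide)
    have := hpn p (by omega)
    simp only [lwp, Expr.eval_var, Expr.eval_add, Expr.eval_sub, Expr.eval_one, Expr.eval_three]
    refine ⟨by omega, by omega, fun p' hp' => ?_, ?_, ?_, fun z hz => ?_, fun x hx' => ?_⟩
    · rcases (show p' < p ∨ p' = p by omega) with h | rfl
      · rw [upd_of_ne, hr p' h]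
        intro h'
        have := mul_add_inj (n := nQ) (p := p') (q := p') (r := p) (t := p) (by omega) (by omega)
          (by omega)
        omega
      · rw [hx, upd_same]
    · simp [upd, hi]
    · simp [upd, hx, e1, w5, hw]; ring
    · rw [upd_of_ne _ _ (by rw [hx]; exact hz p (by omega)), hm z hz]
    · rw [← hv x hx']
      simp at hx'
      simp [upd, hx']
  · refine ⟨le_rfl, by simp, w4, by simpa using w3, fun _ _ => rfl, fun x hx => rfl⟩
  · rintro s' ⟨-, hr, -, -, hm, hv⟩
    have g0 := hv v_hp (by decide)
    have g1 := hv v_zm (by decide)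
    have g2 := hv v_id (by decide)
    rw [← hI] at g2
    rw [g0, g1, g2, w0, w1]
    have hlow : ∀ z ≤ I, s'.m z = upd s.m H 1 z := by
      intro z hz
      rw [hm z (fun p hp => by omega), hm₀]
    refine ⟨⟨hh, fun z h1 _ => hF z h1, by omega, ?_, fun p hp q hq => .of_zero ?_ ?_⟩,
      ⟨by omega, fun z h1 _ => hF z (by omega), by omega, ?_, fun p hp q hq => ?_⟩,
      ⟨by omega, fun z _ hzH => ?_, fun x hx => ?_⟩, fun z hzz => ?_⟩
    · rw [hlow H (by omega), upd_same]
    · have := mul_add_lt hp hq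
      rw [hlow _ (by omega), upd_of_ne _ _ (by omega), hz _ (by omega)]
    · have := mul_add_lt hp hq
      rw [hlow _ (by omega), upd_of_ne _ _ (by omega), hz _ (by omega)]
    · rw [hlow I le_rfl, upd_of_ne _ _ (by omega), hz _ (by omega)]
    · have h1 : s'.m (I + 1 + 3 * (nQ * p + q : ℕ) + 1) = 0 := by
        rw [hm _ (fun p hp => by omega), hm₀, upd_of_ne _ _ (by omega), hz _ (by omega)]
      rw [paths_nil A hp]
      split_ifs with hpq
      · subst hpq
        have h0 := hr p (by omega)
        refine ⟨true, [], ⟨iff_of_true (by rw [h0]; norm_num) rfl, .inl ⟨h1, rfl⟩⟩,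
          ⟨by simp [annZ, AnnA.annFrom],
          ⟨[], by simp⟩, ?_⟩⟩
        rintro ρ rfl h
        exact absurd rfl h
      · refine .of_zero ?_ h1
        rw [hm _ (fun r hr h => hpq ?_), hm₀, upd_of_ne _ _ (by omega), hz _ (by omega)]
        have := mul_add_inj (n := nQ) (p := p) (q := q) (r := r) (t := r) (by omega) (by omega)
          (by omega)
        omega
    · rw [hlow z (by omega), upd_of_ne _ _ (by omega)]
    · rw [hv x (fun h => hx (by revert h; simp; omega)), hvar x hx]
    · rw [hm z (fun p hp => by have := hpn p hp; omega), hm₀, upd_of_ne _ _ (by omega),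
        hz _ (by omega)]

/-! ### The matrices of the letters. -/

/-- The third cell of a transition. -/
def code {nΩ : ℕ} : Option (Fin nΩ) → ℤ
  | none => 0
  | some o => (o : ℕ) + 1

theorem at_encT {m : ℤ → ℤ} {p : ℤ} {t : Fin nQ × Fin nσ × Option (Fin nΩ) × Fin nQ}
    (h : At m p (encT t)) : m p = (t.1 : ℕ) ∧ m (p + 1) = (t.2.1 : ℕ) ∧
      m (p + 2) = code t.2.2.1 ∧ m (p + 3) = (t.2.2.2 : ℕ) := by
  rcases t with ⟨p', a, _ | o, q⟩ <;>
  · simp [encT, encodeTransition, At, add_assoc] at h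
    simp [code, h]

theorem length_encT (t : Fin nQ × Fin nσ × Option (Fin nΩ) × Fin nQ) :
    (encT t).length = 4 := by
  rcases t with ⟨p', a, _ | o, q⟩ <;> rfl

/-- Reserve space for the matrices of the letters that occur in transitions. -/
def letCmd : Cmd :=
  seq (assign v_i (var v_nT)) <| seq (assign v_p (var v_tp)) <|
  loop (var v_i) (seq (assign v_x (var v_mt + get (var v_p + 1)))
    (seq (ite (get (var v_x)) skip (seq (store (var v_x) (var v_hp)) (seq (store (var v_hp) 1)
      (assign v_hp (var v_hp + var v_sz)))))
    (seq (assign v_p (var v_p + 4)) (assign v_i (var v_i - 1)))))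

/-- Between `H` and `hp`, there are empty matrices for the letters, whose addresses are found from
address `T` on. -/
structure LetTab (nQ nσ : ℕ) (T H hp : ℤ) (m : ℤ → ℤ) : Prop where
  region : ∀ a : Fin nσ, m (T + (a : ℕ)) = 0 ∨
    H ≤ m (T + (a : ℕ)) ∧ m (T + (a : ℕ)) + (3 * (nQ * nQ : ℕ) + 1) ≤ hp
  disj : ∀ a b : Fin nσ, a ≠ b → m (T + (a : ℕ)) ≠ 0 → m (T + (b : ℕ)) ≠ 0 →
    m (T + (a : ℕ)) + (3 * (nQ * nQ : ℕ) + 1) ≤ m (T + (b : ℕ)) ∨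
    m (T + (b : ℕ)) + (3 * (nQ * nQ : ℕ) + 1) ≤ m (T + (a : ℕ))
  one : ∀ a : Fin nσ, m (T + (a : ℕ)) ≠ 0 → m (m (T + (a : ℕ))) = 1
  zero : ∀ a : Fin nσ, m (T + (a : ℕ)) ≠ 0 → ∀ z, m (T + (a : ℕ)) < z →
    z < m (T + (a : ℕ)) + (3 * (nQ * nQ : ℕ) + 1) → m z = 0

/-- Again zero memory serves as an empty matrix, so reserving one takes constant time, and only
letters that occur in transitions get one. The time is linear in the number of transitions, free of
nσ and of any factor nQ². A zero entry in the table marks a letter without transitions. -/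
theorem let_spec {A : AnnA (Fin nQ) (Fin nσ) (Fin nΩ)} {S : SLP (Fin nN) (Fin nσ)}
    {fs : List (Fin nQ)} {ts : List (Fin nQ × Fin nσ × Option (Fin nΩ) × Fin nQ)} {E : ℕ}
    {s : Conf} (hv : Vars A S fs ts E s.v) (ht : Tabs nQ nσ nN E s.v) (hm : Inp S fs ts E s.m)
    (hsz : s.v v_sz = 3 * (nQ * nQ : ℕ) + 1) (hh : s.v v_mt + nσ ≤ s.v v_hp)
    (hz : ∀ z, s.v v_hp ≤ z → s.m z = 0) (hT : ∀ a < nσ, s.m (s.v v_mt + a) = 0) :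
    Tri letCmd s (ts.length * 8 + 3) fun s' =>
      LetTab nQ nσ (s.v v_mt) (s.v v_hp) (s'.v v_hp) s'.m ∧
      (∀ t ∈ ts, s'.m (s.v v_mt + (t.2.1 : ℕ)) ≠ 0) ∧ s.v v_hp ≤ s'.v v_hp ∧
      (∀ z, s'.v v_hp ≤ z → s'.m z = 0) ∧
      (∀ z, z < s.v v_mt ∨ s.v v_mt + nσ ≤ z ∧ z < s.v v_hp → s'.m z = s.m z) ∧
      ∀ x, x ∉ [v_hp, v_x, v_i, v_p] → s'.v x = s.v x := by
  rw [show ts.length * 8 + 3 = 1 + (1 + (ts.length * (7 + 1) + 1)) by ring]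
  refine .assign (.assign ?_)
  have hmt : (E : ℤ) ≤ s.v v_mt := by rw [ht.mt]; omega
  refine (Tri.loop_list (n := 7)
    (fun (l : List (Fin nQ × Fin nσ × Option (Fin nΩ) × Fin nQ)) s' =>
      LetTab nQ nσ (s.v v_mt) (s.v v_hp) (s'.v v_hp) s'.m ∧
      s'.v v_i = l.length ∧ At s.m (s'.v v_p) (l.flatMap encT) ∧
      s'.v v_p + (l.flatMap encT).length ≤ E ∧ s.v v_hp ≤ s'.v v_hp ∧
      (∀ z, s'.v v_hp ≤ z → s'.m z = 0) ∧
      (∀ z, z < s.v v_mt ∨ s.v v_mt + nσ ≤ z ∧ z < s.v v_hp → s'.m z = s.m z) ∧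
      (∀ x, x ∉ [v_hp, v_x, v_i, v_p] → s'.v x = s.v x) ∧
      ∃ d, ts = d ++ l ∧ ∀ t ∈ d, s'.m (s.v v_mt + (t.2.1 : ℕ)) ≠ 0) ?_ ?_ (l := ts) ?_).mono
      le_rfl ?_
  · rintro s' ⟨-, h, -⟩
    simp [h]
  · rintro t l s' ⟨hL, hi, hat, hle, hhp, hz', hm', hv', d, hd, hne⟩
    refine ⟨by simp only [Expr.eval_var, hi, List.length_cons]; omega, .of_lwp ?_ (by decide)⟩
    rw [List.flatMap_cons] at hat hle
    rw [at_append] at hat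
    obtain ⟨-, ha, -, -⟩ := at_encT hat.1
    have hlen := length_encT t
    rw [List.length_append, hlen] at hle
    push_cast at hle
    obtain ⟨hat0, hat⟩ := hat
    rw [hlen] at hat
    have ha' : s'.m (s'.v v_p + 1) = (t.2.1 : ℕ) := by rw [hm' _ (.inl (by omega)), ha]
    have haσ := t.2.1.2
    have e1 := hv' v_mt (by decide)
    have e2 := hv' v_sz (by decide)
    have hx0 : (var v_mt + get (var v_p + 1)).eval s' = s.v v_mt + (t.2.1 : ℕ) := by
      simp [e1, ha']
    simp only [lwp, hx0]
    simp only [Expr.eval_var, Expr.eval_add, Expr.eval_sub, Expr.eval_one,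
      Expr.eval_four, Expr.eval_get]
    simp only [upd_same, upd_of_ne _ _ (show v_i ≠ v_x by decide),
      upd_of_ne _ _ (show v_p ≠ v_x by decide), upd_of_ne _ _ (show v_hp ≠ v_x by decide),
      upd_of_ne _ _ (show v_i ≠ v_p by decide), upd_of_ne _ _ (show v_p ≠ v_hp by decide),
      upd_of_ne _ _ (show v_i ≠ v_hp by decide), upd_of_ne _ _ (show v_sz ≠ v_x by decide),
      upd_of_ne _ _ (show v_hp ≠ v_p by decide), upd_of_ne _ _ (show v_hp ≠ v_i by decide),
      upd_of_ne _ _ (show v_p ≠ v_i by decide)]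
    set x := s.v v_mt + ((t.2.1 : ℕ) : ℤ) with hxdef
    refine ⟨fun hpos => ?_, fun hpos => ⟨by omega, by omega, ?_⟩⟩
    · refine ⟨hL, by simp [hi], ?_, by omega, hhp, hz', hm', fun y hy => ?_, d ++ [t], by simp [hd],
        fun t' ht' => ?_⟩
      · exact hat
      · rw [← hv' y hy]
        simp at hy
        simp [upd, hy]
      · rcases List.mem_append.1 ht' with h | h
        · exact hne t' h
        · rw [List.mem_singleton] at h
          subst h
          exact hpos.ne'
    · generalize hmm : upd (upd s'.m x _) _ _ = m
      set h' := s'.v v_hp with hh'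
      have hx00 : s'.m x = 0 := by
        rcases hL.region t.2.1 with h | h
        · exact h
        · rw [← hxdef] at h; omega
      have k0 : m x = h' := by rw [← hmm, upd_of_ne _ _ (by omega), upd_same]
      have k1 : m h' = 1 := by rw [← hmm, upd_same]
      have k2 : ∀ z, z ≠ x → z ≠ h' → m z = s'.m z := fun z h1 h2 => by
        rw [← hmm, upd_of_ne _ _ h2, upd_of_ne _ _ h1]
      have k3 : ∀ a : Fin nσ, a ≠ t.2.1 → m (s.v v_mt + (a : ℕ)) = s'.m (s.v v_mt + (a : ℕ)) := by
        intro a ha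
        have : (a : ℕ) ≠ (t.2.1 : ℕ) := fun h => ha (Fin.ext h)
        have := a.2
        exact k2 _ (by omega) (by omega)
      refine ⟨⟨fun a => ?_, fun a b hab h1 h2 => ?_, fun a h1 => ?_, fun a h1 z h2 h3 => ?_⟩,
        by simp [hi], hat, by omega, by omega, fun z h => ?_, fun z h => ?_, fun y hy => ?_,
        d ++ [t], by simp [hd], fun t' ht' => ?_⟩
      · by_cases ha : a = t.2.1
        · subst ha
          rw [← hxdef, k0]
          exact .inr ⟨by omega, by omega⟩
        · rw [k3 a ha]
          rcases hL.region a with h | h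
          · exact .inl h
          · exact .inr ⟨by omega, by omega⟩
      · by_cases ha : a = t.2.1
        · subst ha
          have hb := k3 b hab.symm
          rw [← hxdef, k0]
          rw [hb] at h2 ⊢
          rcases hL.region b with h | h
          · exact absurd h h2
          · omega
        · have ha' := k3 a ha
          rw [ha'] at h1 ⊢
          by_cases hb : b = t.2.1
          · subst hb
            rw [← hxdef, k0]
            rcases hL.region a with h | h
            · exact absurd h h1
            · omega
          · rw [k3 b hb] at h2 ⊢
            exact hL.disj a b hab h1 h2
      · by_cases ha : a = t.2.1
        · subst ha
          rw [← hxdef, k0, k1]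
        · rw [k3 a ha] at h1 ⊢
          rcases hL.region a with h | h
          · exact absurd h h1
          · rw [k2 _ (by omega) (by omega)]
            exact hL.one a h1
      · by_cases ha : a = t.2.1
        · subst ha
          rw [← hxdef, k0] at h2 h3
          rw [k2 _ (by omega) (by omega)]
          exact hz' z (by omega)
        · rw [k3 a ha] at h1 h2 h3
          rcases hL.region a with h | h
          · exact absurd h h1
          · rw [k2 _ (by omega) (by omega)]
            exact hL.zero a h1 z h2 h3
      · rw [e2, hsz] at h
        rw [k2 _ (by omega) (by omega)]
        exact hz' z (by omega)
      · rw [k2 _ (by omega) (by omega)]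
        exact hm' z h
      · rw [← hv' y hy]
        simp at hy
        simp [upd, hy]
      · rcases List.mem_append.1 ht' with h | h
        · by_cases ha : t'.2.1 = t.2.1
          · rw [ha, ← hxdef, k0]; omega
          · rw [k3 _ ha]
            exact hne t' h
        · rw [List.mem_singleton] at h
          subst h
          rw [← hxdef, k0]
          have := hm.tsle
          omega
  · have h1 := hm.tsle
    have h2 := hv.htp
    refine ⟨⟨fun a => .inl (hT a a.2), fun a b _ h => absurd (hT a a.2) h,
      fun a h => absurd (hT a a.2) h, fun a h => absurd (hT a a.2) h⟩, ?_, ?_, ?_, ?_, ?_,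
      fun _ _ => rfl, fun x hx => ?_, [], rfl, by simp⟩
    · simp [upd, hv.hnT]
    · dsimp only
      rw [upd_same, Expr.eval_var]
      dsimp only
      rw [upd_of_ne _ _ (by decide), h2]
      exact hm.hts
    · dsimp only
      rw [upd_same, Expr.eval_var]
      dsimp only
      rw [upd_of_ne _ _ (by decide), h2]
      omega
    · simp [upd]
    · simpa [upd] using hz
    · simp at hx
      simp [upd, hx]
  · rintro s' ⟨h1, -, -, -, h2, h3, h4, h5, d, h6, h7⟩
    rw [List.append_nil] at h6
    exact ⟨h1, h6 ▸ h7, h2, h3, h4, h5⟩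

/-- Add the run of length one that uses the transition at `p` to the entry at `x`. -/
def addRunCmd : Cmd :=
  ite (get (var v_p + 2))
    (seq (seq (assign v_P (get (var v_x + 1))) (seq (assign v_k (get (var v_x + 2)))
      (seq (alloc v_it 0 (get (var v_p + 2) - 1) 0 0 0)
      (seq (alloc v_Q (var v_it) 0 0 0 0) (assign v_l 1)))))
    (seq unionCmd (seq (store (var v_x + 1) (var v_P)) (store (var v_x + 2) (var v_k)))))
    (store (var v_x) 1)

theorem cov_singleton_none (q : Fin nQ) :
    Cov ({[(none, q)]} : Set (List (Option (Fin nΩ) × Fin nQ))) true [] :=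
  ⟨by simp [annZ, AnnA.annFrom], ⟨[], by simp⟩, by rintro ρ rfl h; exact absurd rfl h⟩

theorem cov_singleton_some (o : Fin nΩ) (q : Fin nQ) :
    Cov ({[(some o, q)]} : Set (List (Option (Fin nΩ) × Fin nQ))) false [[(((o : ℕ) : ℤ), 1)]] :=
  ⟨by simp [annZ, AnnA.annFrom], ⟨[[(some o, q)]], by simp [annZ, AnnA.annFrom]⟩,
    by rintro ρ rfl h; simp [annZ, AnnA.annFrom]⟩

/-- A read transition sets the flag. A read-annotate transition adds a new one-symbol set; its leaf
has position 0 and the pointer has shift 1, as positions count from 1. -/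
theorem addRun_spec {s : Conf} {F : Set ℤ} {R : Set (List (Option (Fin nΩ) × Fin nQ))}
    {b : Option (Fin nΩ)} {q : Fin nQ}
    (hh : 0 < s.v v_hp) (hF : ∀ z, s.v v_hp ≤ z → z ∈ F) (hE : EntC s.m F (s.v v_hp) (s.v v_x) R)
    (hx0 : 0 ≤ s.v v_x) (hx : s.v v_x + 3 ≤ s.v v_hp)
    (hFx : ∀ z ∈ F, z < s.v v_x ∨ s.v v_x + 3 ≤ z)
    (hb : s.m (s.v v_p + 2) = code b)
    (hR : [(b, q)] ∉ R) :
    Tri addRunCmd s 12 fun s' =>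
      EntC s'.m F (s'.v v_hp) (s.v v_x) (R ∪ {[(b, q)]}) ∧
      Ext [v_hp, v_P, v_k, v_Q, v_l, v_it, v_c] {z | z < s.v v_x ∨ s.v v_x + 3 ≤ z} s s' := by
  obtain ⟨e, L, ⟨he, hL⟩, hc⟩ := hE
  refine .ite (fun hpos => ?_) (fun hneg => ?_)
  · obtain ⟨o, rfl⟩ : ∃ o, b = some o := by
      cases b with
      | none => simp [hb, code] at hpos
      | some o => exact ⟨o, rfl⟩
    have h1 : Tri (seq (assign v_P (get (var v_x + 1))) (seq (assign v_k (get (var v_x + 2)))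
        (seq (alloc v_it 0 (get (var v_p + 2) - 1) 0 0 0)
        (seq (alloc v_Q (var v_it) 0 0 0 0) (assign v_l 1))))) s 5 fun s₁ =>
        Ext [v_hp, v_P, v_k, v_Q, v_l, v_it, v_c] Set.univ s s₁ ∧ 0 < s₁.v v_Q ∧
        Ref s₁.m F (s₁.v v_hp) (s₁.v v_P) (s₁.v v_k) L ∧
        Ref s₁.m F (s₁.v v_hp) (s₁.v v_Q) (s₁.v v_l) [[(((o : ℕ) : ℤ), 1)]] := by
      refine .of_lwp ?_ (by decide)
      simp only [lwp, Expr.eval_get, Expr.eval_var, Expr.eval_zero, Expr.eval_add, Expr.eval_one,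
        Expr.eval_two, Expr.eval_sub]
      simp only [upd_same, upd_of_ne _ _ (show v_x ≠ v_P by decide),
        upd_of_ne _ _ (show v_p ≠ v_P by decide), upd_of_ne _ _ (show v_p ≠ v_k by decide),
        upd_of_ne _ _ (show v_hp ≠ v_P by decide), upd_of_ne _ _ (show v_hp ≠ v_k by decide),
        upd_of_ne _ _ (show v_it ≠ v_hp by decide), hb]
      generalize hm : block (block s.m (s.v v_hp) _ _ _ _ _) (s.v v_hp + 5) _ _ _ _ _ = m
      generalize hpe : s.v v_hp = hp at *
      have hlt : ∀ z < hp, m z = s.m z := fun z hz => by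
        rw [← hm, block_of_lt _ _ _ _ _ _ (by omega), block_of_lt _ _ _ _ _ _ (by omega)]
      have c0 : m hp = 0 := by
        rw [← hm, block_of_lt _ _ _ _ _ _ (by omega), block_0]
      have c1 : m (hp + 1) = (o : ℕ) := by
        rw [← hm, block_of_lt _ _ _ _ _ _ (by omega), block_1, code]; ring
      have d0 : m (hp + 5) = hp := by rw [← hm, block_0]
      have d1 : m (hp + 5 + 1) = 0 := by rw [← hm, block_1]
      have d2 : m (hp + 5 + 2) = 0 := by rw [← hm, block_2]
      have d3 : m (hp + 5 + 3) = 0 := by rw [← hm, block_3]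
      have hleaf := Rep.leaf (m := m) (F := F) (hi := hp + 5 + 5) (a := hp)
        (fun z h _ => hF z h) (by omega) c0
      rw [c1] at hleaf
      have hnode := Rep.node (m := m) (F := F) (hi := hp + 5 + 5) (a := hp + 5) (R := [])
        (I := [[(((o : ℕ) : ℤ), 0)]]) (fun z h _ => hF z (by omega)) (by omega)
      rw [d0, d1, d2, d3] at hnode
      have hnode := hnode hleaf .nil
      refine ⟨by omega, by omega, ⟨by simp [upd, hpe]; omega, fun z _ hz => hlt z (by omega),
        fun x hx => ?_⟩, by simp [upd]; omega, ?_, ?_⟩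
      · simp at hx
        simp [upd, hx]
      · simpa [upd] using hL.agree (fun z _ hz => hlt z hz) (fun _ h _ => h)
          (show hp ≤ hp + 5 + 5 by omega)
      · refine .inr ⟨by simp [upd]; omega, _, by simpa [upd] using hnode, ?_⟩
        simp [upd, shifts, shift]
    refine Tri.seq (n := 5) (n' := 6) (h1.mono le_rfl fun s₁ ⟨hy, hQ, h2, h3⟩ => ?_)
    have h0 := hy.hp
    refine Tri.seq (n := 4) (n' := 2) ((union_spec (by omega) (fun z hz => hF z (by omega)) h2 h3
      hQ).mono le_rfl fun s₂ ⟨hz, L', hp', h4⟩ => ?_)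
    have h0' := hz.hp
    have e1 := hz.var v_x (by decide)
    rw [hy.var v_x (by decide)] at e1
    have hy' := hy.trans (hz.mono (by decide) subset_rfl)
    refine .of_lwp ?_ (by decide)
    simp only [lwp, Expr.eval_get, Expr.eval_var, Expr.eval_add, Expr.eval_one,
        Expr.eval_two, e1]
    generalize hm : upd (upd s₂.m _ _) _ _ = m
    have hm0 : ∀ z, z < s.v v_x + 1 ∨ s.v v_x + 3 ≤ z → m z = s₂.m z := by
      intro z hz
      rw [← hm, upd_of_ne _ _ (by omega), upd_of_ne _ _ (by omega)]
    refine ⟨by omega, by omega, ⟨_, _, ⟨?_, ?_⟩,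
      (hc.union (cov_singleton_some o q) (fun ρ h1 h2 => hR (by rw [← h2]; exact h1))).perm
      hp'.symm⟩, by dsimp only; omega, fun z hz hz' => ?_, hy'.var⟩
    · rw [hm0 _ (by omega), hy'.mem _ trivial (by omega), he]
      simp
    · have : m (s.v v_x + 1) = s₂.v v_P := by
        rw [← hm, upd_of_ne _ _ (by omega), upd_same]
      rw [this, show m (s.v v_x + 2) = s₂.v v_k by rw [← hm, upd_same]]
      exact h4.agree (fun z hz _ => hm0 z (by have := hFx z hz; omega)) (fun _ h _ => h) le_rfl
    · dsimp only
      rw [hm0 z (by rcases hz with h | h <;> omega), hy'.mem z trivial hz']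
  · obtain rfl : b = none := by
      cases b with
      | none => rfl
      | some o =>
        simp only [Expr.eval_get, Expr.eval_add, Expr.eval_var, Expr.eval_two, hb, code] at hneg
        omega
    refine .of_lwp ?_ (by decide)
    simp only [lwp, Expr.eval_var, Expr.eval_one]
    refine ⟨hx0, ⟨_, _, ⟨?_, ?_⟩, hc.union (cov_singleton_none q)
      (fun ρ h1 h2 => hR (by rw [← h2]; exact h1))⟩, le_rfl, fun z hz hz' => ?_, fun _ _ => rfl⟩
    · rw [upd_same]
      simp
    · rw [upd_of_ne _ _ (by omega), upd_of_ne _ _ (by omega), List.append_nil]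
      exact hL.agree (fun z hz _ => upd_of_ne _ _ (by have := hFx z hz; omega))
        (fun _ h _ => h) le_rfl
    · exact upd_of_ne _ _ (by rcases hz with h | h <;> omega)

/-- Fill the matrices of the letters. -/
def fillCmd : Cmd :=
  seq (assign v_i (var v_nT)) <| seq (assign v_p (var v_tp)) <|
  loop (var v_i) (seq (assign v_x (get (var v_mt + get (var v_p + 1)) + 1 +
      get (var v_ro + get (var v_p)) +
      (get (var v_p + 3) + get (var v_p + 3) + get (var v_p + 3))))
    (seq addRunCmd (seq (assign v_p (var v_p + 4)) (assign v_i (var v_i - 1)))))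

/-- The invariant says that each entry covers the length-one runs of the transitions processed so
far. Each transition changes exactly one entry, and it adds a new run since transitions are listed
without repetition. -/
theorem fill_spec {A : AnnA (Fin nQ) (Fin nσ) (Fin nΩ)} {S : SLP (Fin nN) (Fin nσ)}
    {fs : List (Fin nQ)} {ts : List (Fin nQ × Fin nσ × Option (Fin nΩ) × Fin nQ)} {E : ℕ}
    {s : Conf} {H : ℤ} (hv : Vars A S fs ts E s.v) (ht : Tabs nQ nσ nN E s.v)
    (hm : Inp S fs ts E s.m) (hts : ∀ e, e ∈ ts ↔ e ∈ A.trans) (hnd : ts.Nodup)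
    (hro : ∀ p < nQ, s.m (s.v v_ro + p) = 3 * (nQ * p : ℕ)) (hH : s.v v_ro + nQ ≤ H)
    (hHp : H ≤ s.v v_hp) (hL : LetTab nQ nσ (s.v v_mt) H (s.v v_hp) s.m)
    (hne : ∀ t ∈ ts, s.m (s.v v_mt + (t.2.1 : ℕ)) ≠ 0) :
    Tri fillCmd s (ts.length * 16 + 3) fun s' =>
      (∀ a : Fin nσ, s.m (s.v v_mt + (a : ℕ)) ≠ 0 →
        IsMat s'.m {z | s.v v_ro ≤ z} (s'.v v_hp) nQ (s.m (s.v v_mt + (a : ℕ))) 1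
          (paths A [a])) ∧
      Ext [v_hp, v_x, v_i, v_p, v_P, v_k, v_Q, v_l, v_it, v_c] {z | z < H} s s' := by
  rw [show ts.length * 16 + 3 = 1 + (1 + (ts.length * (15 + 1) + 1)) by ring]
  refine .assign (.assign ?_)
  have hmt : (E : ℤ) ≤ s.v v_mt := by rw [ht.mt]; omega
  have hmro : s.v v_mt + nσ ≤ s.v v_ro := by rw [ht.mt, ht.ro]; omega
  set hp := s.v v_hp with hhp
  -- All letter matrices lie below hp and all records made here above it, so writing entries never
  -- touches a record.
  let F : Set ℤ := {z | hp ≤ z}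
  refine (Tri.loop_list (n := 15)
    (fun (l : List (Fin nQ × Fin nσ × Option (Fin nΩ) × Fin nQ)) s' =>
      s'.v v_i = l.length ∧ At s.m (s'.v v_p) (l.flatMap encT) ∧
      s'.v v_p + (l.flatMap encT).length ≤ E ∧
      Ext [v_hp, v_x, v_i, v_p, v_P, v_k, v_Q, v_l, v_it, v_c]
        {z | ∀ a : Fin nσ, s.m (s.v v_mt + (a : ℕ)) ≠ 0 → z ≤ s.m (s.v v_mt + (a : ℕ)) ∨
          s.m (s.v v_mt + (a : ℕ)) + (3 * (nQ * nQ : ℕ) + 1) ≤ z} s s' ∧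
      ∃ d, ts = d ++ l ∧ ∀ a : Fin nσ, s.m (s.v v_mt + (a : ℕ)) ≠ 0 → ∀ p < nQ, ∀ q < nQ,
        EntC s'.m F (s'.v v_hp) (s.m (s.v v_mt + (a : ℕ)) + 1 + 3 * (nQ * p + q : ℕ))
          (single d a p q)) ?_ ?_ (l := ts) ?_).mono le_rfl ?_
  · rintro s' ⟨h, -⟩
    simp [h]
  · rintro t l s' ⟨hi, hat, hle, hx, d, hd, hE⟩
    refine ⟨by simp only [Expr.eval_var, hi, List.length_cons]; omega, ?_⟩
    rw [List.flatMap_cons] at hat hle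
    rw [at_append] at hat
    obtain ⟨ht0, ht1, ht2, ht3⟩ := at_encT hat.1
    have hlen := length_encT t
    rw [List.length_append, hlen] at hle
    push_cast at hle
    obtain ⟨hat0, hat⟩ := hat
    rw [hlen] at hat
    have h0 := hx.hp
    have hlow : ∀ z < H, s'.m z = s.m z := by
      intro z hz
      refine hx.mem z (fun a ha => ?_) (by omega)
      rcases hL.region a with h | h
      · exact absurd h ha
      · exact .inl (by omega)
    have hMne := hne t (by simp [hd])
    have hσ := t.2.1.2
    obtain ⟨hM1, hM2⟩ : H ≤ s.m (s.v v_mt + (t.2.1 : ℕ)) ∧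
        s.m (s.v v_mt + (t.2.1 : ℕ)) + (3 * (nQ * nQ : ℕ) + 1) ≤ hp :=
      (hL.region t.2.1).resolve_left hMne
    set M := s.m (s.v v_mt + (t.2.1 : ℕ)) with hM
    have hpq := mul_add_lt t.1.2 t.2.2.2.2
    have e1 := hx.var v_mt (by decide)
    have e2 := hx.var v_ro (by decide)
    have hpQ := t.1.2
    have hxe : (get (var v_mt + get (var v_p + 1)) + 1 + get (var v_ro + get (var v_p)) +
      (get (var v_p + 3) + get (var v_p + 3) + get (var v_p + 3))).eval s' =
        M + 1 + 3 * (nQ * (t.1 : ℕ) + (t.2.2.2 : ℕ) : ℕ) := by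
      simp only [Expr.eval_add, Expr.eval_get, Expr.eval_var, Expr.eval_one, Expr.eval_three]
      rw [hlow (s'.v v_p) (by omega), hlow (s'.v v_p + 1) (by omega),
        hlow (s'.v v_p + 3) (by omega), ht0, ht1, ht3, e1, e2, hlow _ (by omega),
        hlow _ (by omega), ← hM, hro _ hpQ]
      push_cast
      ring
    refine (Tri.assign (n := 14) ?_).mono (by omega) fun _ h => h
    rw [hxe]
    set X := M + 1 + 3 * ((nQ * (t.1 : ℕ) + (t.2.2.2 : ℕ) : ℕ) : ℤ) with hX
    -- Letter, source and the single step of the run determine the transition, which has not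
    -- occurred before.
    have hnot : [(t.2.2.1, t.2.2.2)] ∉ single d t.2.1 t.1 t.2.2.2 := by
      rintro ⟨t', h1, h2, h3, h4, h5⟩
      have : t' = t := by
        have h5 : t.2.2 = t'.2.2 := by simpa using h5
        exact Prod.ext (Fin.ext h2) (Prod.ext h3 h5.symm)
      subst this
      rw [hd, List.nodup_append] at hnd
      exact hnd.2.2 t' h1 t' (by simp) rfl
    refine Tri.seq (n := 12) (n' := 2) ((addRun_spec (F := F) (b := t.2.2.1) (q := t.2.2.2)
      (R := single d t.2.1 t.1 t.2.2.2)
      ?_ ?_ ?_ ?_ ?_ ?_ ?_ hnot).mono le_rfl fun s₁ ⟨hE₁, hx₁⟩ => .of_lwp ?_ (by decide))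
    · simp [upd]; omega
    · intro z hz
      simp [upd] at hz
      show hp ≤ z
      omega
    · have := hE t.2.1 hMne t.1 t.1.2 t.2.2.2 t.2.2.2.2
      rw [← hM, ← hX] at this
      dsimp only
      rw [upd_of_ne _ _ (by decide), upd_same]
      exact this
    · simp [upd]; omega
    · simp [upd]; omega
    · intro z hz
      have hz : hp ≤ z := hz
      simp [upd]
      omega
    · dsimp only
      rw [upd_of_ne _ _ (by decide), hlow _ (by omega), ht2]
    simp only [upd_same] at hE₁ hx₁
    have h1 := hx₁.hp
    have e3 := hx₁.var v_p (by decide)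
    have e4 := hx₁.var v_i (by decide)
    dsimp only at h1 e3 e4
    rw [upd_of_ne _ _ (by decide)] at h1 e3 e4
    have hmem₁ : ∀ z, z < X ∨ X + 3 ≤ z → z < s'.v v_hp → s₁.m z = s'.m z := by
      intro z hz hz'
      refine hx₁.mem z hz ?_
      dsimp only
      rw [upd_of_ne _ _ (by decide)]
      exact hz'
    simp only [lwp, Expr.eval_var, Expr.eval_add, Expr.eval_sub, Expr.eval_one, Expr.eval_four]
    refine ⟨?_, ?_, ?_, ⟨?_, fun z hz hz' => ?_, fun y hy => ?_⟩, d ++ [t], by simp [hd],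
      fun a ha p hp q hq => ?_⟩
    · simp [upd, e4, hi]
    · rw [upd_of_ne _ _ (by decide), upd_same, e3]
      exact hat
    · rw [upd_of_ne _ _ (by decide), upd_same, e3]
      omega
    · simp [upd]
      omega
    · rw [← hx.mem z hz hz']
      refine hmem₁ z ?_ (by omega)
      have := hz t.2.1 hMne
      rw [← hM] at this
      omega
    · rw [← hx.var y hy]
      have h3 := hx₁.var y (fun h => hy (by revert h; simp; omega))
      simp at hy
      simp [upd, hy] at h3 ⊢
      exact h3
    · rw [upd_of_ne _ _ (by decide), upd_of_ne _ _ (by decide)]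
      by_cases haa : a = t.2.1 ∧ p = t.1 ∧ q = t.2.2.2
      · obtain ⟨rfl, rfl, rfl⟩ := haa
        rw [← hM, ← hX]
        convert hE₁ using 1
        ext ρ
        constructor
        · rintro ⟨t', h1, h2, h3, h4, rfl⟩
          rcases List.mem_append.1 h1 with h1 | h1
          · exact .inl ⟨t', h1, h2, h3, h4, rfl⟩
          · rw [List.mem_singleton] at h1
            subst h1
            exact .inr rfl
        · rintro (⟨t', h1, h2⟩ | h)
          · exact ⟨t', List.mem_append_left _ h1, h2⟩
          · exact ⟨t, by simp, rfl, rfl, rfl, h⟩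
      · have hs : single (d ++ [t]) a p q = single d a p q := by
          ext ρ
          constructor
          · rintro ⟨t', h1, h2, h3, h4, rfl⟩
            rcases List.mem_append.1 h1 with h1 | h1
            · exact ⟨t', h1, h2, h3, h4, rfl⟩
            · rw [List.mem_singleton] at h1
              subst h1
              exact absurd ⟨h3.symm, h2.symm, h4.symm⟩ haa
          · rintro ⟨t', h1, h2⟩
            exact ⟨t', List.mem_append_left _ h1, h2⟩
        rw [hs]
        have hpq' := mul_add_lt hp hq
        obtain ⟨hM1', hM2'⟩ : H ≤ s.m (s.v v_mt + (a : ℕ)) ∧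
            s.m (s.v v_mt + (a : ℕ)) + (3 * (nQ * nQ : ℕ) + 1) ≤ s.v v_hp :=
          (hL.region a).resolve_left ha
        -- The cells of different entries are disjoint: within one matrix by uniqueness of the index
        -- pair, across matrices by `LetTab.disj`.
        have hsep : s.m (s.v v_mt + (a : ℕ)) + 1 + 3 * ((nQ * p + q : ℕ) : ℤ) + 3 ≤ X ∨
            X + 3 ≤ s.m (s.v v_mt + (a : ℕ)) + 1 + 3 * ((nQ * p + q : ℕ) : ℤ) := by
          by_cases hae : a = t.2.1
          · subst hae
            rw [← hM, hX]
            by_contra hcon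
            have := mul_add_inj (n := nQ) (p := p) (q := q) (r := t.1) (t := t.2.2.2) hq
              t.2.2.2.2 (by omega)
            exact haa ⟨rfl, this⟩
          · have := hL.disj a t.2.1 hae ha hMne
            rw [← hM] at this
            omega
        refine (hE a ha p hp q hq).agree (fun z hz hz' => hmem₁ z ?_ hz')
          (fun z h1 h2 => hmem₁ z (by omega) (by omega)) (fun _ h _ => h) (by omega)
        have hz : s.v v_hp ≤ z := hz
        omega
  · have h1 := hm.tsle
    have h2 := hv.htp
    refine ⟨?_, ?_, ?_, .of_var rfl (by simp [upd]) fun x hx => ?_, [], rfl,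
      fun a ha p hp q hq => ?_⟩
    · simp [upd, hv.hnT]
    · dsimp only
      rw [upd_same, Expr.eval_var]
      dsimp only
      rw [upd_of_ne _ _ (by decide), h2]
      exact hm.hts
    · dsimp only
      rw [upd_same, Expr.eval_var]
      dsimp only
      rw [upd_of_ne _ _ (by decide), h2]
      omega
    · simp at hx
      simp [upd, hx]
    · have := mul_add_lt hp hq
      have hz := hL.zero a ha
      have : single (nΩ := nΩ) (nQ := nQ) [] a p q = ∅ := by
        ext ρ
        simp [single]
      rw [this]
      exact .of_zero (hz _ (by omega) (by omega)) (hz _ (by omega) (by omega))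
  · rintro s' ⟨-, -, -, hx, d, hd, hE⟩
    rw [List.append_nil] at hd
    subst hd
    have h0 := hx.hp
    refine ⟨fun a ha => ?_, hx.hp, fun z hz hz' => hx.mem z (fun a ha => ?_) hz', hx.var⟩
    · obtain ⟨hM1, hM2⟩ : H ≤ s.m (s.v v_mt + (a : ℕ)) ∧
            s.m (s.v v_mt + (a : ℕ)) + (3 * (nQ * nQ : ℕ) + 1) ≤ s.v v_hp :=
          (hL.region a).resolve_left ha
      refine ⟨by omega, fun z h1 _ => show s.v v_ro ≤ z by omega, by omega, ?_,
        fun p hp q hq => ?_⟩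
      · rw [hx.mem _ (fun b hb => ?_) (by omega), hL.one a ha]
        by_cases hab : a = b
        · subst hab
          exact .inl le_rfl
        · have := hL.disj a b hab ha hb
          omega
      · rw [paths_single A hts]
        exact (hE a ha p hp q hq).agree (fun _ _ _ => rfl) (fun _ _ _ => rfl)
          (fun z hz _ => show s.v v_ro ≤ z from by
            have hz : s.v v_hp ≤ z := hz
            omega) le_rfl
    · have hz : z < H := hz
      rcases hL.region a with h | h
      · exact absurd h ha
      · exact .inl (by omega)

end Pre

section Dfs

variable {nQ nσ nΩ nN : ℕ}

/-! ## Preprocessing: the matrices of the nonterminals -/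

/-- The addresses behind the tables for the letters and the nonterminals. -/
def heap (nσ nN E : ℕ) : Set ℤ := {z | (E : ℤ) + nN + nσ + nN ≤ z}

/-- All addresses outside the table for the nonterminals. -/
def stable (nσ nN E : ℕ) : Set ℤ := {z | z < (E : ℤ) + nN + nσ ∨ (E : ℤ) + nN + nσ + nN ≤ z}

theorem heap_subset_stable (nσ nN E : ℕ) : heap nσ nN E ⊆ stable nσ nN E := fun _ h => .inr h

/-- The invariant of the depth-first search; `T` is the set of the finished nonterminals. -/
structure Dfs (A : AnnA (Fin nQ) (Fin nσ) (Fin nΩ)) (S : SLP (Fin nN) (Fin nσ))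
    (fs : List (Fin nQ)) (ts : List (Fin nQ × Fin nσ × Option (Fin nΩ) × Fin nQ)) (E : ℕ)
    (T : Finset (Fin nN)) (s : Conf) : Prop where
  vars : Vars A S fs ts E s.v
  tabs : Tabs nQ nσ nN E s.v
  rules : ∀ B, RuleTab S E s.m B
  sz : s.v v_sz = 3 * (nQ * nQ : ℕ) + 1
  hp : (E : ℤ) + nN + nσ + nN < s.v v_hp
  zm : IsMat s.m (heap nσ nN E) (s.v v_hp) nQ (s.v v_zm) 1
    (fun _ _ => (∅ : Set (List (Option (Fin nΩ) × Fin nQ))))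
  id : IsMat s.m (heap nσ nN E) (s.v v_hp) nQ (s.v v_id) 0 (paths A [])
  letters : ∀ a : Fin nσ,
    (s.m (s.v v_mt + (a : ℕ)) = 0 ∧ ∀ p q, paths A [a] p q = ∅) ∨
    IsMat s.m (heap nσ nN E) (s.v v_hp) nQ (s.m (s.v v_mt + (a : ℕ))) 1 (paths A [a])
  done : ∀ B ∈ T, IsMat s.m (heap nσ nN E) (s.v v_hp) nQ (s.m (s.v v_mt + nσ + (B : ℕ)))
    (S.expand B).length (paths A (S.expand B))
  todo : ∀ B ∉ T, s.m (s.v v_mt + nσ + (B : ℕ)) = 0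

variable {A : AnnA (Fin nQ) (Fin nσ) (Fin nΩ)} {S : SLP (Fin nN) (Fin nσ)}
  {fs : List (Fin nQ)} {ts : List (Fin nQ × Fin nσ × Option (Fin nΩ) × Fin nQ)} {E : ℕ}
  {T : Finset (Fin nN)} {s s' : Conf}

/-- The variables that are modified in the depth-first search. -/
abbrev dfsVars : List ℕ :=
  [v_hp, v_e, v_P, v_k, v_Q, v_l, v_it, v_c, v_a, v_b, v_r, v_x, v_pb, v_j, v_C, v_la, v_pa, v_i,
    v_A, v_B, v_nb, v_pp, v_n, v_stk, v_sym]

/-- Multiplying and pushing leave all cells below the heap pointer unchanged, so they preserve the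
invariant with the same set T. Only a pop writes into the table. -/
theorem Dfs.ext (h : Dfs A S fs ts E T s) (hs : Ext dfsVars Set.univ s s') :
    Dfs A S fs ts E T s' := by
  have hp := h.hp
  have hE : Ext dfsVars (heap nσ nN E) s s' := hs.mono (List.Subset.refl _) (Set.subset_univ _)
  have hmt := h.tabs.mt
  have e1 := hs.var v_mt (by decide)
  have e2 := hs.var v_zm (by decide)
  have e3 := hs.var v_id (by decide)
  have hm : ∀ z < s.v v_hp, s'.m z = s.m z := fun z hz => hs.mem z trivial hz
  have hma : ∀ a : Fin nσ, s'.m (s'.v v_mt + (a : ℕ)) = s.m (s.v v_mt + (a : ℕ)) := by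
    intro a
    have := a.2
    rw [e1, hm _ (by omega)]
  have hmB : ∀ B : Fin nN, s'.m (s'.v v_mt + nσ + (B : ℕ)) = s.m (s.v v_mt + nσ + (B : ℕ)) := by
    intro B
    have := B.2
    rw [e1, hm _ (by omega)]
  refine ⟨h.vars.congr fun x hx => hs.var x (by revert x; decide),
    h.tabs.congr fun x hx => hs.var x (by revert x; decide), fun B => (h.rules B).agree fun z hz =>
    hm z (by omega), (hs.var v_sz (by decide)).trans h.sz, hp.trans_le hs.hp,
    ?_, ?_, fun a => ?_, fun B hB => ?_, fun B hB => ?_⟩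
  · rw [e2]; exact hE.isMat h.zm
  · rw [e3]; exact hE.isMat h.id
  · rw [hma]
    exact (h.letters a).imp_right hE.isMat
  · rw [hmB]; exact hE.isMat (h.done B hB)
  · rw [hmB]; exact h.todo B hB

/-- Start with the rule of the nonterminal `nb`. -/
def enterCmd : Cmd :=
  seq (assign v_pp (get (var v_rt + var v_nb) + 1)) <|
  seq (assign v_n (get (get (var v_rt + var v_nb)))) (assign v_A (var v_id))

/-- One step of the depth-first search. -/
def dfsBody : Cmd :=
  ite (var v_n)
    (seq (assign v_sym (get (var v_pp))) <|
      seq (assign v_B (get (var v_mt + var v_sym))) <|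
      seq (ite (var v_B) skip (ite (var v_nS - var v_sym) (assign v_B (var v_zm)) skip)) <|
      ite (var v_B)
        (seq mulCmd (seq (assign v_A (var v_C)) (seq (assign v_pp (var v_pp + 1))
          (assign v_n (var v_n - 1)))))
        (seq (alloc v_stk (var v_nb) (var v_pp) (var v_n) (var v_A) (var v_stk))
          (seq (assign v_nb (var v_sym - var v_nS)) enterCmd)))
    (seq (store (var v_mt + var v_nS + var v_nb) (var v_A)) <|
      seq (assign v_nb (get (var v_stk))) <| seq (assign v_pp (get (var v_stk + 1))) <|
      seq (assign v_n (get (var v_stk + 2))) <| seq (assign v_A (get (var v_stk + 3))) <|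
      assign v_stk (get (var v_stk + 4)))

/-- Running time of one step of the depth-first search. -/
def stepTime (nQ : ℕ) : ℕ := nQ * (nQ * (nQ * 44 + 14) + 6) + 20

/-- The document derived from a symbol. -/
noncomputable def symDoc (S : SLP (Fin nN) (Fin nσ)) (x : Fin nσ ⊕ Fin nN) : List (Fin nσ) :=
  Sum.elim (fun a => [a]) S.expand x

theorem isMat_append {m : ℤ → ℤ} {F : Set ℤ} {hi M : ℤ} {d d' : List (Fin nσ)}
    (h : IsMat m F hi nQ M (d.length + d'.length)
      fun p q => {ρ | ∃ r < nQ, ∃ ρ₁ ∈ paths A d p r, ∃ ρ₂ ∈ paths A d' r q, ρ = ρ₁ ++ ρ₂}) :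
    IsMat m F hi nQ M (d ++ d').length (paths A (d ++ d')) := by
  rw [show paths A (d ++ d') = _ from funext fun p => funext fun q => paths_append A d d' p q]
  simpa using h

/-- The case in which the matrix of the next symbol is available. The partial product A, the matrix
of the part d of the rule already read, is replaced by its product with that matrix. -/
theorem dfs_mul {x : Fin nσ ⊕ Fin nN} {d : List (Fin nσ)} (h : Dfs A S fs ts E T s)
    (hn : 0 < s.v v_n) (hx : s.m (s.v v_pp) = (encodeSymbol x : ℕ))
    (hT : ∀ C, x = .inr C → C ∈ T)
    (hA : IsMat s.m (heap nσ nN E) (s.v v_hp) nQ (s.v v_A) d.length (paths A d)) :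
    Tri dfsBody s (stepTime nQ) fun s' => Ext dfsVars Set.univ s s' ∧ s'.v v_pp = s.v v_pp + 1 ∧
      s'.v v_n = s.v v_n - 1 ∧ s'.v v_nb = s.v v_nb ∧ s'.v v_stk = s.v v_stk ∧
      IsMat s'.m (heap nσ nN E) (s'.v v_hp) nQ (s'.v v_A) (d ++ symDoc S x).length
        (paths A (d ++ symDoc S x)) := by
  have hp := h.hp
  -- Letters and nonterminals share one table, as nonterminal B has the code nσ + B. A zero entry at
  -- a code below nσ is a letter without transitions, for which the common empty matrix is taken; at
  -- other codes it means an unfinished nonterminal.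
  have hB : ∃ (B : ℤ), (seq (assign v_sym (get (var v_pp))) <|
      seq (assign v_B (get (var v_mt + var v_sym))) <|
      (ite (var v_B) skip (ite (var v_nS - var v_sym) (assign v_B (var v_zm)) skip))).lwp
      (fun s' => s' = ⟨upd (upd s.v v_sym (encodeSymbol x : ℕ)) v_B B, s.m⟩) s ∧
      IsMat s.m (heap nσ nN E) (s.v v_hp) nQ B (symDoc S x).length (paths A (symDoc S x)) := by
    simp only [lwp, Expr.eval_get, Expr.eval_var, Expr.eval_add, Expr.eval_sub, hx]
    simp only [upd_same, upd_of_ne _ _ (show v_mt ≠ v_sym by decide),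
      upd_of_ne _ _ (show v_nS ≠ v_B by decide), upd_of_ne _ _ (show v_nS ≠ v_sym by decide),
      upd_of_ne _ _ (show v_sym ≠ v_B by decide), upd_of_ne _ _ (show v_zm ≠ v_B by decide),
      upd_of_ne _ _ (show v_zm ≠ v_sym by decide)]
    have huu : ∀ (v : ℕ → ℤ) (a b : ℤ), upd (upd v v_B a) v_B b = upd v v_B b := by
      intro v a b
      funext y
      simp only [upd]
      split_ifs <;> rfl
    rcases x with a | C
    · rcases h.letters a with ⟨h0, h1⟩ | h1
      · have hnS := h.vars.hnS
        have ha := a.2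
        refine ⟨s.v v_zm, ?_, ?_⟩
        · simp only [encodeSymbol, h0, huu, implies_true, hnS]
          exact ⟨fun h => absurd h (by omega), fun _ => ⟨trivial, fun h => by omega⟩⟩
        · have := h.zm
          rw [show paths A (symDoc S (.inl a)) = fun _ _ => ∅ from
            funext fun p => funext fun q => h1 p q]
          exact this
      · refine ⟨_, ?_, h1⟩
        have h2 := h1.pos
        simp only [encodeSymbol, implies_true, true_and]
        exact fun h => by omega
    · have h1 := h.done C (hT C rfl)
      refine ⟨_, ?_, h1⟩
      have h2 := h1.pos
      simp only [encodeSymbol, Nat.cast_add, ← add_assoc, implies_true, true_and]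
      exact fun h => by omega
  obtain ⟨B, hB1, hB2⟩ := hB
  refine (Tri.ite (n := nQ * (nQ * (nQ * 44 + 14) + 6) + 18) (fun _ => ?_)
    fun h0 => ?_).mono (by unfold stepTime; omega) fun _ h => h
  · have h1 := Tri.of_lwp hB1 (n := 5) (by decide)
    obtain ⟨t, s₁, h2, h3, h4, rfl⟩ := h1
    cases h2 with | seq h21 h22 => cases h22 with | seq h22 h23 =>
    have hpos := hB2.pos
    set s₁ : Conf := ⟨upd (upd s.v v_sym (encodeSymbol x : ℕ)) v_B B, s.m⟩ with hs₁
    have hE₁ : Ext dfsVars Set.univ s s₁ := by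
      refine .of_var rfl (by simp [s₁, upd]) fun y hy => ?_
      simp at hy
      simp [s₁, upd, hy]
    have h' := h.ext hE₁
    have e1 := hE₁.var
    have hm := mul_spec (F := heap nσ nN E) (l := d.length) (l' := (symDoc S x).length)
      (RA := paths A d) (RB := paths A (symDoc S x)) (s := s₁)
      (by have := h'.hp; omega)
      (fun z hz => by have := h'.hp; simp only [heap, Set.mem_ofPred_eq]; omega) h'.vars.hnQ
      h'.vars.hw h'.sz (by simpa [s₁, upd] using hA) (by simpa [s₁, upd] using hB2)
      (fun p r ρ hρ => length_of_mem_paths A hρ) (fun p r r' ρ h1 h2 => paths_unique A h1 h2)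
    have hm' : Tri (ite (var v_B)
        (seq mulCmd (seq (assign v_A (var v_C)) (seq (assign v_pp (var v_pp + 1))
          (assign v_n (var v_n - 1)))))
        (seq (alloc v_stk (var v_nb) (var v_pp) (var v_n) (var v_A) (var v_stk))
          (seq (assign v_nb (var v_sym - var v_nS)) enterCmd))) s₁
        (nQ * (nQ * (nQ * 44 + 14) + 6) + 12) fun s' => Ext dfsVars Set.univ s s' ∧
        s'.v v_pp = s.v v_pp + 1 ∧
        s'.v v_n = s.v v_n - 1 ∧ s'.v v_nb = s.v v_nb ∧ s'.v v_stk = s.v v_stk ∧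
        IsMat s'.m (heap nσ nN E) (s'.v v_hp) nQ (s'.v v_A) (d ++ symDoc S x).length
          (paths A (d ++ symDoc S x)) := by
      refine (Tri.ite (n := nQ * (nQ * (nQ * 44 + 14) + 6) + 11) (fun _ => ?_)
        fun h0 => ?_)
      · refine (Tri.seq (n' := 3) (hm.mono le_rfl fun s₂ ⟨hE₂, hC⟩ => ?_)).mono
          (by omega) fun _ h => h
        refine .of_lwp ?_ (by decide)
        simp only [lwp, Expr.eval_get, Expr.eval_var, Expr.eval_add, Expr.eval_sub, Expr.eval_one]
        have f1 := hE₂.var v_pp (by decide)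
        have f2 := hE₂.var v_n (by decide)
        have f3 := hE₂.var v_nb (by decide)
        have f4 := hE₂.var v_stk (by decide)
        simp only [s₁, upd, Nat.reduceEqDiff, if_false, reduceIte] at f1 f2 f3 f4
        refine ⟨hE₁.trans ((hE₂.mono (by decide) subset_rfl).trans (.of_var rfl ?_ ?_)),
          ?_, ?_, ?_, ?_, ?_⟩
        · simp [upd]
        · intro y hy
          simp at hy
          simp [upd, hy]
        · simp [upd, f1]
        · simp [upd, f2]
        · simp [upd, f3]
        · simp [upd, f4]
        · have := isMat_append hC
          simpa [upd] using this
      · simp [s₁, upd] at h0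
        omega
    obtain ⟨t', s₂, g1, g2, g3, g4⟩ := hm'
    exact ⟨_, s₂, .seq h21 (.seq h22 (.seq h23 g1)), by
      simpa using h3.append g2, by simp at h4 ⊢; omega, g4⟩
  · simp only [Expr.eval_var] at h0
    omega

/-- The frame saves the nonterminal, the reading position, the number of symbols left, the partial
product and the previous frame. The reading position stays on C, so C is looked up again after the
return. -/
theorem dfs_push {C : Fin nN} (h : Dfs A S fs ts E T s)
    (hn : 0 < s.v v_n) (hx : s.m (s.v v_pp) = (nσ + C : ℕ)) (hT : C ∉ T) :
    Tri dfsBody s (stepTime nQ) fun s' => Ext dfsVars Set.univ s s' ∧ s'.v v_nb = (C : ℕ) ∧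
      s'.v v_pp = s.m (E + (C : ℕ)) + 1 ∧ s'.v v_n = (S.rule C).length ∧ s'.v v_A = s'.v v_id ∧
      s'.v v_stk = s.v v_hp ∧ s'.v v_hp = s.v v_hp + 5 ∧ s'.m (s.v v_hp) = s.v v_nb ∧
      s'.m (s.v v_hp + 1) = s.v v_pp ∧ s'.m (s.v v_hp + 2) = s.v v_n ∧
      s'.m (s.v v_hp + 3) = s.v v_A ∧ s'.m (s.v v_hp + 4) = s.v v_stk := by
  have hp := h.hp
  obtain ⟨r1, r2, r3⟩ := h.rules C
  have r4 : s.m (s.m (E + (C : ℕ))) = (S.rule C).length := r3.1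
  have hl : ((encR S C).length : ℤ) = (S.rule C).length + 1 := by simp [encR]
  have hC := C.2
  refine .mono (.ite (n := 14) (fun _ => ?_) fun h0 => ?_) (by unfold stepTime; omega) fun _ h => h
  · refine .assign (n := 13) (.assign (n := 12) ?_)
    have h0 := h.todo C hT
    rw [add_assoc] at h0
    refine .seq (n := 3) (n' := 9) ((?_ : Tri _ _ _ fun s₁ => s₁ =
      ⟨upd (upd s.v v_sym (nσ + C : ℕ)) v_B 0, s.m⟩).mono le_rfl ?_)
    · refine .of_lwp ?_ (by decide)
      simp only [lwp, Expr.eval_get, Expr.eval_var, Expr.eval_add, Expr.eval_sub, hx]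
      simp only [upd_same, upd_of_ne _ _ (show v_mt ≠ v_sym by decide),
        upd_of_ne _ _ (show v_nS ≠ v_B by decide), upd_of_ne _ _ (show v_nS ≠ v_sym by decide),
        upd_of_ne _ _ (show v_sym ≠ v_B by decide), Nat.cast_add, h0, h.vars.hnS]
      simp
    · rintro _ rfl
      refine .ite (n := 8) (fun h1 => ?_) fun _ => ?_
      · simp [upd] at h1
      · refine .of_lwp ?_ (by decide)
        simp only [lwp, enterCmd, Expr.eval_get, Expr.eval_var, Expr.eval_add, Expr.eval_sub,
          Expr.eval_one]
        have hm := fun z (hz : z < s.v v_hp) => block_of_lt s.m (s.v v_nb) (s.v v_pp) (s.v v_n)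
          (s.v v_A) (s.v v_stk) hz
        have g1 := h.vars.hnS
        have g2 := h.tabs.rt
        simp only [upd, Nat.reduceEqDiff, if_false, reduceIte, if_true, OfNat.zero_ne_ofNat,
          OfNat.ofNat_ne_zero, g1, g2, Nat.cast_add, add_sub_cancel_left]
        rw [hm _ (by omega), hm _ (by omega), r4]
        simp only [block_0, block_1, block_2, block_3, block_4, and_true, true_and]
        refine ⟨by omega, by dsimp only; simp [upd], fun z _ hz => hm z hz, fun y hy => ?_⟩
        simp at hy
        simp [upd, hy]
  · simp only [Expr.eval_var] at h0
    omega

/-- The rule is read completely, so the partial product is entered in the table for B and the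
caller's frame is restored. The frame lies behind the table (`hstk`), hence it is not affected by
this write. -/
theorem dfs_pop {B : Fin nN} (h : Dfs A S fs ts E T s) (hB : s.v v_nb = (B : ℕ))
    (hn : s.v v_n ≤ 0) (hstk : (E : ℤ) + nN + nσ + nN ≤ s.v v_stk)
    (hA : IsMat s.m (heap nσ nN E) (s.v v_hp) nQ (s.v v_A) (S.expand B).length
      (paths A (S.expand B))) :
    Tri dfsBody s (stepTime nQ) fun s' => Dfs A S fs ts E (insert B T) s' ∧
      s'.v v_nb = s.m (s.v v_stk) ∧ s'.v v_pp = s.m (s.v v_stk + 1) ∧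
      s'.v v_n = s.m (s.v v_stk + 2) ∧ s'.v v_A = s.m (s.v v_stk + 3) ∧
      s'.v v_stk = s.m (s.v v_stk + 4) ∧ s.v v_hp ≤ s'.v v_hp ∧
      ∀ z ∈ stable nσ nN E, z < s.v v_hp → s'.m z = s.m z := by
  have hp := h.hp
  have hBN := B.2
  have g1 := h.vars.hnS
  have g2 := h.tabs.mt
  refine .mono (.ite (n := 6) (fun h0 => ?_) fun _ => ?_) (by unfold stepTime; omega) fun _ h => h
  · simp only [Expr.eval_var] at h0
    omega
  · refine .of_lwp ?_ (by decide)
    simp only [lwp, Expr.eval_get, Expr.eval_var, Expr.eval_add, Expr.eval_sub, Expr.eval_one,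
      Expr.eval_two, Expr.eval_three, Expr.eval_four, g1, hB]
    generalize hm : upd s.m (s.v v_mt + nσ + (B : ℕ)) (s.v v_A) = m
    have hne : ∀ z, z ≠ s.v v_mt + nσ + (B : ℕ) → m z = s.m z := fun z hz => by
      rw [← hm, upd_of_ne _ _ hz]
    have heq : m (s.v v_mt + nσ + (B : ℕ)) = s.v v_A := by rw [← hm, upd_same]
    have hst : Agree (stable nσ nN E) (s.v v_hp) s.m m := fun z hz _ => hne z (by
      simp only [stable, Set.mem_ofPred_eq] at hz; omega)
    have hag : Agree (heap nσ nN E) (s.v v_hp) s.m m := fun z hz =>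
      hst z (heap_subset_stable _ _ _ hz)
    have hmat : ∀ {M len} {R : ℕ → ℕ → Set (List (Option (Fin nΩ) × Fin nQ))},
        IsMat s.m (heap nσ nN E) (s.v v_hp) nQ M len R →
        IsMat m (heap nσ nN E) (s.v v_hp) nQ M len R :=
      fun hM => hM.agree hag (fun _ h _ => h) le_rfl
    simp only [upd, Nat.reduceEqDiff, if_false, reduceIte, if_true, OfNat.zero_ne_ofNat,
          OfNat.ofNat_ne_zero]
    rw [hne (s.v v_stk) (by omega), hne (s.v v_stk + 1) (by omega), hne (s.v v_stk + 2) (by omega),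
      hne (s.v v_stk + 3) (by omega), hne (s.v v_stk + 4) (by omega)]
    refine ⟨by omega, ⟨?_, ?_, fun C => (h.rules C).agree fun z hz => hne z (by omega), ?_, ?_, ?_,
      ?_, ?_, ?_, ?_⟩, rfl, rfl, rfl, rfl, rfl, by rfl, fun z hz hz' => hst z hz hz'⟩
    · exact h.vars.congr fun x hx => by revert x; simp [upd]
    · exact h.tabs.congr fun x hx => by revert x; simp [upd]
    · simpa [upd] using h.sz
    · simpa [upd] using hp
    · simpa [upd] using hmat h.zm
    · simpa [upd] using hmat h.id
    · intro a
      have := a.2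
      simp only [upd, Nat.reduceEqDiff, if_false, reduceIte, OfNat.zero_ne_ofNat,
          OfNat.ofNat_ne_zero]
      rw [hne _ (by omega)]
      exact (h.letters a).imp_right hmat
    · intro C hC
      simp only [upd, Nat.reduceEqDiff, if_false, reduceIte, OfNat.zero_ne_ofNat,
          OfNat.ofNat_ne_zero]
      by_cases hCB : C = B
      · subst hCB
        rw [heq]
        exact hmat hA
      · rw [hne _ (fun h => hCB (Fin.ext (by omega)))]
        exact hmat (h.done C ((Finset.mem_insert.1 hC).resolve_left hCB))
    · intro C hC
      simp only [upd, Nat.reduceEqDiff, if_false, reduceIte, OfNat.zero_ne_ofNat,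
          OfNat.ofNat_ne_zero]
      rw [Finset.mem_insert, not_or] at hC
      rw [hne _ (fun h => hC.1 (Fin.ext (by omega)))]
      exact h.todo C hC.2

end Dfs

/-! ### Termination and number of iterations of the depth-first search. -/

section Dfs

variable {nQ nσ nΩ nN : ℕ} {A : AnnA (Fin nQ) (Fin nσ) (Fin nΩ)} {S : SLP (Fin nN) (Fin nσ)}
  {fs : List (Fin nQ)} {ts : List (Fin nQ × Fin nσ × Option (Fin nΩ) × Fin nQ)} {E : ℕ}

/-- The number of iterations of the depth-first search for the nonterminals in `D`. -/
def work (S : SLP (Fin nN) (Fin nσ)) (D : Finset (Fin nN)) : ℕ :=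
  ∑ B ∈ D, ((S.rule B).length + 2)

/-- From `s`, the depth-first search finishes the nonterminals in `D` and reaches `s'`
in `k` iterations. -/
structure Visit (A : AnnA (Fin nQ) (Fin nσ) (Fin nΩ)) (S : SLP (Fin nN) (Fin nσ))
    (fs : List (Fin nQ)) (ts : List (Fin nQ × Fin nσ × Option (Fin nΩ) × Fin nQ)) (E : ℕ)
    (T D : Finset (Fin nN)) (k : ℕ) (s s' : Conf) : Prop where
  steps : Steps (var v_stk) dfsBody s (k * (stepTime nQ + 1)) s'
  inv : Dfs A S fs ts E (T ∪ D) s'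
  disj : Disjoint T D
  hp : s.v v_hp ≤ s'.v v_hp
  mem : ∀ z ∈ stable nσ nN E, z < s.v v_hp → s'.m z = s.m z

/-- The frame on top of the stack of the depth-first search in `s` has been popped in `s'`. -/
def Popped (s s' : Conf) : Prop :=
  s'.v v_nb = s.m (s.v v_stk) ∧ s'.v v_pp = s.m (s.v v_stk + 1) ∧
      s'.v v_n = s.m (s.v v_stk + 2) ∧ s'.v v_A = s.m (s.v v_stk + 3) ∧
      s'.v v_stk = s.m (s.v v_stk + 4)

theorem Visit.trans {T D D' : Finset (Fin nN)} {k k' : ℕ} {s s' s'' : Conf}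
    (h : Visit A S fs ts E T D k s s') (h' : Visit A S fs ts E (T ∪ D) D' k' s' s'') :
    Visit A S fs ts E T (D ∪ D') (k + k') s s'' := by
  refine ⟨?_, ?_, ?_, h.hp.trans h'.hp, fun z hz hz' => ?_⟩
  · rw [add_mul]
    exact h.steps.trans h'.steps
  · rw [← Finset.union_assoc]
    exact h'.inv
  · rw [Finset.disjoint_union_right]
    exact ⟨h.disj, (Finset.disjoint_union_left.1 h'.disj).1⟩
  · rw [h'.mem z hz (hz'.trans_le h.hp), h.mem z hz hz']

theorem work_union {D D' : Finset (Fin nN)} (h : Disjoint D D') :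
    work S (D ∪ D') = work S D + work S D' := Finset.sum_union h

theorem visit_step {T : Finset (Fin nN)} {s : Conf} {P : Conf → Prop} (h : Dfs A S fs ts E T s)
    (hstk : 0 < s.v v_stk)
    (hb : Tri dfsBody s (stepTime nQ) fun s' => Ext dfsVars Set.univ s s' ∧ P s') :
    ∃ s', Visit A S fs ts E T ∅ 1 s s' ∧ P s' := by
  obtain ⟨s', h1, h2, h3⟩ := hb.steps (e := var v_stk) hstk
  exact ⟨s', ⟨by simpa using h1, by simpa using h.ext h2, by simp, h2.hp,
    fun z _ hz => h2.mem z trivial hz⟩, h3⟩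

/-- Induction on the unread part r of the rule of B. The count says that k is at most one
multiplication for each symbol of r, one pop, and the work for the newly finished nonterminals other
than B; the contribution of B to `work S D` is put on the other side to avoid subtraction. -/
theorem visit_rule {B : Fin nN} {d : List (Fin nσ)} {r : List (Fin nσ ⊕ Fin nN)}
    {T : Finset (Fin nN)} {s : Conf}
    (ih : ∀ C, Sum.inr C ∈ r → ∀ T s, C ∉ T → Dfs A S fs ts E T s → s.v v_nb = (C : ℕ) →
      s.v v_pp = s.m (E + (C : ℕ)) + 1 → s.v v_n = (S.rule C).length → s.v v_A = s.v v_id →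
      (E : ℤ) + nN + nσ + nN < s.v v_stk → s.v v_stk + 5 ≤ s.v v_hp →
      ∃ D k s', Visit A S fs ts E T D k s s' ∧ Popped s s' ∧ C ∈ D ∧
        (∀ X ∈ D, Relation.ReflTransGen (fun X Y => Sum.inr X ∈ S.rule Y) X C) ∧
        k + 1 ≤ work S D)
    (hr : ∀ C, Sum.inr C ∈ r → Sum.inr C ∈ S.rule B)
    (h : Dfs A S fs ts E T s) (hB : B ∉ T) (hnb : s.v v_nb = (B : ℕ))
    (hpp : At s.m (s.v v_pp) (r.map fun x => (encodeSymbol x : ℤ)))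
    (hpE : s.v v_pp + r.length ≤ E)
    (hn : s.v v_n = r.length)
    (hA : IsMat s.m (heap nσ nN E) (s.v v_hp) nQ (s.v v_A) d.length (paths A d))
    (hd : d ++ r.flatMap (symDoc S) = S.expand B)
    (hk : (E : ℤ) + nN + nσ + nN < s.v v_stk) (hk' : s.v v_stk + 5 ≤ s.v v_hp) :
    ∃ D k s', Visit A S fs ts E T D k s s' ∧ Popped s s' ∧ B ∈ D ∧
      (∀ X ∈ D, Relation.ReflTransGen (fun X Y => Sum.inr X ∈ S.rule Y) X B) ∧
      k + (S.rule B).length + 1 ≤ work S D + r.length := by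
  induction r generalizing d T s with
  | nil =>
    simp only [List.flatMap_nil, List.append_nil] at hd
    subst hd
    obtain ⟨s', h1, h2, h3, h4, h5, h6, h7, h8, h9⟩ :=
      (dfs_pop h hnb (by simpa using hn.le) hk.le hA).steps (e := var v_stk)
        (by simp only [Expr.eval_var]; omega)
    refine ⟨{B}, 1, s', ⟨by simpa using h1, ?_, by simpa using hB, h8, h9⟩,
      ⟨h3, h4, h5, h6, h7⟩, by simp, ?_, ?_⟩
    · rw [Finset.union_comm]
      exact h2
    · intro X hX
      rw [Finset.mem_singleton.1 hX]
    · simp [work]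
      omega
  | cons x r ihr =>
    have hstk : 0 < s.v v_stk := by omega
    have hn0 : 0 < s.v v_n := by rw [hn, List.length_cons]; omega
    rw [List.length_cons] at hpE
    push_cast at hpE
    -- The case in which the first symbol is a letter or finished. It is stated for arbitrary T and
    -- s, because it is used again after a visit to an unfinished nonterminal.
    have key : ∀ (T : Finset (Fin nN)) (s : Conf), (∀ C, x = .inr C → C ∈ T) →
        Dfs A S fs ts E T s → B ∉ T → s.v v_nb = (B : ℕ) →
        At s.m (s.v v_pp) ((x :: r).map fun x => (encodeSymbol x : ℤ)) →
        s.v v_pp + r.length + 1 ≤ E → s.v v_n = (x :: r).length →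
        IsMat s.m (heap nσ nN E) (s.v v_hp) nQ (s.v v_A) d.length (paths A d) →
        (E : ℤ) + nN + nσ + nN < s.v v_stk → s.v v_stk + 5 ≤ s.v v_hp →
        ∃ D k s', Visit A S fs ts E T D k s s' ∧ Popped s s' ∧ B ∈ D ∧
        (∀ X ∈ D, Relation.ReflTransGen (fun X Y => Sum.inr X ∈ S.rule Y) X B) ∧
        k + (S.rule B).length + 1 ≤ work S D + (x :: r).length := by
      intro T s hxT h hB hnb hpp hpE hn hA hk hk'
      have hp := h.hp
      obtain ⟨s₁, h1, h2, h3, h4, h5, h6⟩ := visit_step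
        (P := fun s' => s'.v v_pp = s.v v_pp + 1 ∧
          s'.v v_n = s.v v_n - 1 ∧ s'.v v_nb = s.v v_nb ∧ s'.v v_stk = s.v v_stk ∧
          IsMat s'.m (heap nσ nN E) (s'.v v_hp) nQ (s'.v v_A) (d ++ symDoc S x).length
          (paths A (d ++ symDoc S x)) ∧ ∀ z < s.v v_hp, s'.m z = s.m z) h (by omega)
        ((dfs_mul h (by rw [hn, List.length_cons]; omega) hpp.1 hxT hA).mono le_rfl
          fun s' ⟨g1, g2, g3, g4, g5, g6⟩ => ⟨g1, g2, g3, g4, g5, g6, fun z hz =>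
            g1.mem z trivial hz⟩)
      have h7 := h6.2
      have hv := h1.hp
      obtain ⟨D, k, s', g1, g2, g3, g4, g5⟩ := ihr (fun C hC => ih C (by simp [hC]))
        (fun C hC => hr C (by simp [hC])) h1.inv (by simpa using hB) (h4.trans hnb)
        (d := d ++ symDoc S x) (by
          rw [h2]
          exact hpp.2.agree fun z hz hz' => h7 z (by rw [List.length_map] at hz'; omega))
        (by omega) (by rw [h3, hn, List.length_cons]; push_cast; ring) h6.1 (by simpa using hd)
        (by omega) (by omega)
      refine ⟨D, 1 + k, s', by simpa using h1.trans g1, ?_, g3, g4, by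
        rw [List.length_cons]; omega⟩
      unfold Popped at g2 ⊢
      rw [h5, h7 _ (by omega), h7 _ (by omega), h7 _ (by omega), h7 _ (by omega),
        h7 _ (by omega)] at g2
      exact g2
    by_cases hC : ∃ C, x = .inr C ∧ C ∉ T
    · obtain ⟨C, rfl, hCT⟩ := hC
      have hp := h.hp
      obtain ⟨s₁, h1, h2, h3, h4, h5, h6, h7, h8, h9, h10, h11, h12, h13⟩ := visit_step
        (P := fun s' => s'.v v_nb = (C : ℕ) ∧
          s'.v v_pp = s.m (E + (C : ℕ)) + 1 ∧ s'.v v_n = (S.rule C).length ∧ s'.v v_A = s'.v v_id ∧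
          s'.v v_stk = s.v v_hp ∧ s'.v v_hp = s.v v_hp + 5 ∧ s'.m (s.v v_hp) = s.v v_nb ∧
          s'.m (s.v v_hp + 1) = s.v v_pp ∧ s'.m (s.v v_hp + 2) = s.v v_n ∧
          s'.m (s.v v_hp + 3) = s.v v_A ∧ s'.m (s.v v_hp + 4) = s.v v_stk ∧
          ∀ z < s.v v_hp, s'.m z = s.m z) h hstk
        ((dfs_push h hn0 hpp.1 hCT).mono le_rfl
          fun s' ⟨g0, g1, g2, g3, g4, g5, g6, g7, g8, g9, g10, g11⟩ => ⟨g0, g1, g2, g3, g4, g5, g6,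
            g7, g8, g9, g10, g11, fun z hz => g0.mem z trivial hz⟩)
      have hCN := C.2
      obtain ⟨D, k, s₂, g1, ⟨e1, e2, e3, e4, e5⟩, g3, g4, g5⟩ := ih C (by simp) _ s₁
        (by simpa using hCT) h1.inv h2 (by rw [h3, h13 _ (by omega)]) h4 h5 (by omega) (by omega)
      rw [h6] at e1 e2 e3 e4 e5
      rw [h8] at e1
      rw [h9] at e2
      rw [h10] at e3
      rw [h11] at e4
      rw [h12] at e5
      have hv := h1.trans g1
      rw [Finset.empty_union] at hv
      -- Everything finished on the way is reachable from C, and C occurs in the rule of B;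
      -- finishing B there would close a cycle.
      have hBD : B ∉ D := fun hBD => S.acyclic B
        (Relation.TransGen.tail' (g4 B hBD) (hr C (by simp)))
      have hpv := hv.hp
      have hpp' : At s₂.m (s₂.v v_pp) ((Sum.inr C :: r).map fun x => (encodeSymbol x : ℤ)) := by
        rw [e2]
        refine hpp.agree fun z hz hz' => hv.mem z (.inl ?_) ?_
        all_goals rw [List.length_map, List.length_cons] at hz'; push_cast at hz'; omega
      have hA' : IsMat s₂.m (heap nσ nN E) (s₂.v v_hp) nQ (s₂.v v_A) d.length (paths A d) := by
        rw [e4]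
        exact hA.agree (fun z hz => hv.mem z (heap_subset_stable _ _ _ hz)) (fun _ h _ => h) hpv
      -- After the return the reading position points to C once more, whose matrix is now in the
      -- table.
      obtain ⟨D', k', s', f1, f2, f3, f4, f5⟩ := key (T ∪ D) s₂ (fun C' hC' => by
        cases hC'
        exact Finset.mem_union_right _ g3) hv.inv (by simp [hB, hBD]) (e1.trans hnb) hpp' (by omega)
        (e3.trans hn) hA' (by omega) (by omega)
      refine ⟨D ∪ D', 1 + k + k', s', hv.trans f1, ?_, Finset.mem_union_right _ f3, ?_, ?_⟩
      · unfold Popped at f2 ⊢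
        have hm : ∀ z, (E : ℤ) + nN + nσ + nN ≤ z → z < s.v v_hp → s₂.m z = s.m z :=
          fun z hz hz' => hv.mem z (.inr hz) hz'
        rw [e5, hm _ (by omega) (by omega), hm _ (by omega) (by omega), hm _ (by omega) (by omega),
          hm _ (by omega) (by omega), hm _ (by omega) (by omega)] at f2
        exact f2
      · intro X hX
        rcases Finset.mem_union.1 hX with hX | hX
        · exact (g4 X hX).tail (hr C (by simp))
        · exact f4 X hX
      · rw [work_union (Finset.disjoint_union_left.1 f1.disj).2]
        omega
    · push Not at hC
      exact key T s hC h hB hnb hpp (by omega) hn hA hk hk'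

/-- Well-founded induction along the acyclic grammar. A nonterminal B accounts for |R(B)|
multiplications, one push and one pop; the 1 in the bound is left for the push that led here. -/
theorem visit_nonterminal (B : Fin nN) : ∀ (T : Finset (Fin nN)) (s : Conf), B ∉ T →
    Dfs A S fs ts E T s → s.v v_nb = (B : ℕ) →
    s.v v_pp = s.m (E + (B : ℕ)) + 1 → s.v v_n = (S.rule B).length → s.v v_A = s.v v_id →
    (E : ℤ) + nN + nσ + nN < s.v v_stk → s.v v_stk + 5 ≤ s.v v_hp →
    ∃ D k s', Visit A S fs ts E T D k s s' ∧ Popped s s' ∧ B ∈ D ∧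
      (∀ X ∈ D, Relation.ReflTransGen (fun X Y => Sum.inr X ∈ S.rule Y) X B) ∧
      k + 1 ≤ work S D := by
  induction B using S.wf.induction with
  | _ B ih =>
    intro T s hB h hnb hpp hn hA hk hk'
    obtain ⟨r1, r2, r3⟩ := h.rules B
    have hl : ((encR S B).length : ℤ) = (S.rule B).length + 1 := by simp [encR]
    obtain ⟨D, k, s', h1, h2, h3, h4, h5⟩ := visit_rule (d := []) (r := S.rule B)
      (fun C hC => ih C hC) (fun C hC => hC) h hB hnb (hpp ▸ r3.2) (by omega) hn (hA ▸ h.id)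
      (by rw [S.expand_eq B]; rfl) hk hk'
    exact ⟨D, k, s', h1, h2, h3, h4, by omega⟩

/-- Compute the matrices of the start symbol and of the nonterminals that occur below it. -/
def dfsCmd : Cmd :=
  seq (alloc v_stk 0 0 0 0 0) <| seq (assign v_nb (var v_st)) <| seq enterCmd <|
  loop (var v_stk) dfsBody

/-- Each nonterminal is entered at most once, since the visited sets are disjoint. This gives at
most twice |S| iterations, each dominated by one matrix product. -/
theorem dfs_spec {s : Conf} (h : Dfs A S fs ts E ∅ s) :
    Tri dfsCmd s (S.size * 2 * (stepTime nQ + 1) + 6) fun s' =>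
      IsMat s'.m (heap nσ nN E) (s'.v v_hp) nQ (s'.m (s'.v v_mt + s'.v v_nS + s'.v v_st))
        S.doc.length (paths A S.doc) ∧ Vars A S fs ts E s'.v ∧ Tabs nQ nσ nN E s'.v ∧
      s.v v_hp ≤ s'.v v_hp ∧ ∀ z ∈ stable nσ nN E, z < s.v v_hp → s'.m z = s.m z := by
  obtain ⟨r1, r2, r3⟩ := h.rules S.start
  have r4 : s.m (s.m (E + (S.start : ℕ))) = (S.rule S.start).length := r3.1
  have hl : ((encR S S.start).length : ℤ) = (S.rule S.start).length + 1 := by simp [encR]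
  have hp := h.hp
  have hst := S.start.2
  have h1 : Tri (seq (alloc v_stk 0 0 0 0 0) <| seq (assign v_nb (var v_st)) enterCmd) s 5
      fun s' => Ext dfsVars Set.univ s s' ∧ s'.v v_nb = (S.start : ℕ) ∧
        s'.v v_pp = s.m (E + (S.start : ℕ)) + 1 ∧ s'.v v_n = (S.rule S.start).length ∧
        s'.v v_A = s'.v v_id ∧ s'.v v_stk = s.v v_hp ∧ s'.v v_hp = s.v v_hp + 5 ∧
        s'.m (s.v v_hp + 4) = 0 := by
    refine .of_lwp ?_ (by decide)
    simp only [lwp, enterCmd, Expr.eval_get, Expr.eval_var, Expr.eval_add, Expr.eval_zero,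
      Expr.eval_one]
    have hm := fun z (hz : z < s.v v_hp) => block_of_lt s.m 0 0 0 0 0 hz
    have g1 := h.vars.hst
    have g2 := h.tabs.rt
    simp only [upd, Nat.reduceEqDiff, if_false, reduceIte, if_true, OfNat.zero_ne_ofNat,
      OfNat.ofNat_ne_zero, g1, g2]
    rw [hm _ (by omega), hm _ (by omega), r4]
    simp only [block_4, and_true, true_and]
    refine ⟨by omega, by dsimp only; simp [upd], fun z _ hz => hm z hz, fun y hy => ?_⟩
    simp at hy
    simp [upd, hy]
  obtain ⟨t, s₁, h2, h3, h4, h5, h6, h7, h8, h9, h10, h11, h12⟩ := h1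
  obtain ⟨D, k, s₂, g1, ⟨-, -, -, -, g2⟩, g3, g4, g5⟩ := visit_nonterminal S.start ∅ s₁ (by simp)
    (h.ext h5) h6 (by rw [h7, h5.mem _ trivial (by omega)]) h8 h9 (by omega) (by omega)
  -- The frame at the bottom has 0 as its link, so popping it ends the loop.
  rw [h10, h12] at g2
  have hT : Tri (loop (var v_stk) dfsBody) s₁ _ _ := g1.steps.tri (by simp [g2])
  obtain ⟨t', _, f1, f2, f3, rfl⟩ := hT
  cases h2 with | seq h21 h22 => cases h22 with | seq h22 h23 =>
  refine ⟨_, _, .seq h21 (.seq h22 (.seq h23 f1)), by simpa using h3.append f2, ?_, ?_,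
    g1.inv.vars, g1.inv.tabs, h5.hp.trans g1.hp, fun z hz hz' => ?_⟩
  -- Termwise, |R(B)| + 2 ≤ 2(|R(B)| + 1).
  · have hw : work S D ≤ S.size * 2 := by
      refine (Finset.sum_le_sum_of_subset (Finset.subset_univ D)).trans ?_
      rw [SLP.size, Finset.sum_mul]
      exact Finset.sum_le_sum fun B _ => by omega
    have : k * (stepTime nQ + 1) ≤ S.size * 2 * (stepTime nQ + 1) :=
      Nat.mul_le_mul_right _ (by omega)
    simp at h4 ⊢
    omega
  · rw [g1.inv.vars.hnS, g1.inv.vars.hst]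
    exact g1.inv.done S.start (by simp [g3])
  · rw [g1.mem z hz (by omega), h5.mem z trivial hz']

end Dfs

section Root

variable {nQ nσ nΩ nN : ℕ} {A : AnnA (Fin nQ) (Fin nσ) (Fin nΩ)} {S : SLP (Fin nN) (Fin nσ)}
  {fs : List (Fin nQ)} {ts : List (Fin nQ × Fin nσ × Option (Fin nΩ) × Fin nQ)} {E : ℕ}

/-! ## Preprocessing: the union over the final states -/

/-- Collect the entries for the final states in a list. -/
def rootCmd : Cmd :=
  seq (assign v_x (get (var v_mt + var v_nS + var v_st) + 1 + get (var v_ro + var v_q0))) <|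
  seq (assign v_eps 0) <| seq (assign v_root 0) <| seq (assign v_i (var v_nF)) <|
  seq (assign v_p 5) <|
  loop (var v_i) (seq (assign v_a (var v_x + (get (var v_p) + get (var v_p) + get (var v_p)))) <|
    seq (ite (get (var v_a)) (assign v_eps 1) skip) <|
    seq (ite (get (var v_a + 1))
      (alloc v_root (get (var v_a + 1)) (get (var v_a + 2)) (var v_root) 0 0) skip) <|
    seq (assign v_p (var v_p + 1)) (assign v_i (var v_i - 1)))

/-- The runs over `d` from the start state to a state in the list `fs`. -/
def runsTo (A : AnnA (Fin nQ) (Fin nσ) (Fin nΩ)) (d : List (Fin nσ)) (fs : List (Fin nQ)) :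
    Set (List (Option (Fin nΩ) × Fin nQ)) :=
  {ρ | ∃ f ∈ fs, ρ ∈ paths A d (A.start : ℕ) (f : ℕ)}

/-- In the row of the initial state, entries at different final states cover disjoint sets of runs.
Their sets are collected as a record of kind `rest`, which unlike a node may be empty. Empty sets
are skipped, so the list has nonempty members only. -/
theorem root_spec {s : Conf} {d : List (Fin nσ)} {len : ℤ} (hv : Vars A S fs ts E s.v)
    (hfs : At s.m 5 (fs.map fun q : Fin nQ => ((q : ℕ) : ℤ))) (hfl : 5 + fs.length ≤ E)
    (hnd : fs.Nodup) (hro : s.m (s.v v_ro + (A.start : ℕ)) = 3 * (nQ * (A.start : ℕ) : ℕ))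
    (hM : IsMat s.m (heap nσ nN E) (s.v v_hp) nQ (s.m (s.v v_mt + s.v v_nS + s.v v_st)) len
      (paths A d)) (hp : (E : ℤ) + nN + nσ + nN < s.v v_hp) :
    Tri rootCmd s (fs.length * 8 + 6) fun s' => ∃ e L, (0 < s'.v v_eps ↔ e = true) ∧
      Rep s'.m (heap nσ nN E) (s'.v v_hp) .rest (s'.v v_root) L ∧ Cov (runsTo A d fs) e L ∧
      0 < s'.v v_hp := by
  rw [show fs.length * 8 + 6 = 1 + (1 + (1 + (1 + (1 + (fs.length * (7 + 1) + 1))))) by ring]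
  refine .assign (.assign (.assign (.assign (.assign ?_))))
  generalize hs₀ : Conf.mk _ _ = s₀
  generalize hMe : s.m (s.v v_mt + s.v v_nS + s.v v_st) = M at *
  have hm₀ : s₀.m = s.m := by rw [← hs₀]
  have w0 : s₀.v v_hp = s.v v_hp := by rw [← hs₀]; simp [upd]
  have w1 : s₀.v v_x = M + 1 + 3 * (nQ * (A.start : ℕ) : ℕ) := by
    rw [← hs₀]; simp [upd, hMe, hv.hq0, hro]
  have w2 : s₀.v v_eps = 0 := by rw [← hs₀]; simp [upd]
  have w3 : s₀.v v_root = 0 := by rw [← hs₀]; simp [upd]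
  have w4 : s₀.v v_i = fs.length := by rw [← hs₀]; simp [upd, hv.hnF]
  have w5 : s₀.v v_p = 5 := by rw [← hs₀]; simp [upd]
  refine (Tri.loop_list (n := 7) (fun (l : List (Fin nQ)) s' =>
    s'.v v_i = l.length ∧ At s.m (s'.v v_p) (l.map fun q : Fin nQ => ((q : ℕ) : ℤ)) ∧
    s'.v v_p + l.length ≤ E ∧ s'.v v_x = M + 1 + 3 * (nQ * (A.start : ℕ) : ℕ) ∧
    s.v v_hp ≤ s'.v v_hp ∧ (∀ z < s.v v_hp, s'.m z = s.m z) ∧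
    ∃ c, fs = c ++ l ∧ ∃ e L, (0 < s'.v v_eps ↔ e = true) ∧
      Rep s'.m (heap nσ nN E) (s'.v v_hp) .rest (s'.v v_root) L ∧ Cov (runsTo A d c) e L)
      ?_ ?_ (l := fs) ?_).mono le_rfl ?_
  · rintro s' ⟨h, -⟩
    simp [h]
  · rintro f l s' ⟨h1, h2, h3, h4, h5, h6, c, h7, e, L, h8, h9, h10⟩
    refine ⟨by simp only [Expr.eval_var, h1, List.length_cons]; omega, ?_⟩
    obtain ⟨e', L', ⟨g1, g2⟩, g3⟩ := hM.ent A.start A.start.2 f f.2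
    have g4 := mul_add_lt A.start.2 f.2
    have g5 := hM.le
    have hlen : s'.v v_p + l.length + 1 ≤ E := by
      rw [List.length_cons] at h3; push_cast at h3; omega
    have hpf : s'.m (s'.v v_p) = (f : ℕ) := (h6 _ (by omega)).trans h2.1
    have hX : M + 1 + 3 * ((nQ * (A.start : ℕ) + (f : ℕ) : ℕ) : ℤ) =
      s'.v v_x + ((f : ℕ) + (f : ℕ) + (f : ℕ)) := by rw [h4]; push_cast; ring
    rw [hX] at g1 g2
    have hXl : s'.v v_x + ((f : ℕ) + (f : ℕ) + (f : ℕ)) + 3 ≤ s.v v_hp := by omega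
    generalize hX' : s'.v v_x + ((f : ℕ) + (f : ℕ) + (f : ℕ)) = X at g1 g2 hX hXl
    rw [← h6 X (by omega)] at g1
    rw [← h6 (X + 1) (by omega), ← h6 (X + 2) (by omega)] at g2
    have g2' := g2.agree (m' := s'.m) (fun z _ hz => h6 z hz) (fun _ h _ => h) h5
    have hcov : Cov (runsTo A d (c ++ [f])) (e || e') (L' ++ L) := by
      refine (show runsTo A d (c ++ [f]) = runsTo A d c ∪ paths A d (A.start : ℕ) (f : ℕ) by
        ext ρ; simp [runsTo, or_and_right, exists_or]) ▸
          (h10.union g3 ?_).perm List.perm_append_comm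
      rintro ρ ⟨f', hf', h11⟩ h12
      have : f' = f := Fin.ext (paths_unique A h11 h12)
      subst this
      rw [h7, List.nodup_append] at hnd
      exact hnd.2.2 f' hf' f' (by simp) rfl
    have hx : (var v_x + (get (var v_p) + get (var v_p) + get (var v_p))).eval s' = X := by
      simp [hpf, hX']
    refine .assign (n := 6) ?_
    rw [hx]
    have heps : Tri (ite (get (var v_a)) (assign v_eps 1) skip) ⟨upd s'.v v_a X, s'.m⟩ 2
        fun s₁ => s₁.m = s'.m ∧ (0 < s₁.v v_eps ↔ (e || e') = true) ∧ s₁.v v_a = X ∧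
          ∀ y, y ∉ [v_eps, v_a] → s₁.v y = s'.v y := by
      refine .of_lwp ?_ (by decide)
      simp only [lwp, Expr.eval_get, Expr.eval_var, Expr.eval_one, upd_same]
      refine ⟨fun h => ⟨trivial, ?_, ?_, ?_⟩, fun h => ⟨trivial, ?_, ?_, ?_⟩⟩
      · simp [upd, g1.1 h]
      · simp [upd]
      · intro y hy
        simp at hy
        simp [upd, hy]
      · have : e' = false := by rw [← Bool.not_eq_true, ← g1]; omega
        simp [upd, this, h8]
      · trivial
      · intro y hy
        simp at hy
        simp [upd, hy]
    refine .seq (n := 2) (n' := 4) (heps.mono le_rfl ?_)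
    rintro s₁ ⟨i1, i2, i3, i4⟩
    have e0 := i4 v_hp (by decide)
    have e1 := i4 v_root (by decide)
    have hroot : Tri (ite (get (var v_a + 1))
        (alloc v_root (get (var v_a + 1)) (get (var v_a + 2)) (var v_root) 0 0) skip) s₁ 2
        fun s₂ => Ext [v_hp, v_root] Set.univ s₁ s₂ ∧
          Rep s₂.m (heap nσ nN E) (s₂.v v_hp) .rest (s₂.v v_root) (L' ++ L) := by
      refine .of_lwp ?_ (by decide)
      simp only [lwp, Expr.eval_get, Expr.eval_var, Expr.eval_one, Expr.eval_add, Expr.eval_two,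
        Expr.eval_zero, i1, i3, e0, e1]
      refine ⟨fun h => ⟨by omega, ⟨by simp [upd, e0], fun z _ hz => ?_, fun y hy => ?_⟩, ?_⟩,
        fun h => ⟨.refl _ _ _, ?_⟩⟩
      · rw [e0] at hz
        simp only [i1]
        exact block_of_lt _ _ _ _ _ _ hz
      · simp at hy
        simp [upd, hy]
      · rcases g2' with ⟨h0, -⟩ | ⟨-, W, hW, rfl⟩
        · omega
        generalize hm : block s'.m _ _ _ _ _ _ = m
        have hag : Agree (heap nσ nN E) (s'.v v_hp) s'.m m := fun z _ hz => by
          rw [← hm, block_of_lt _ _ _ _ _ _ hz]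
        have c0 : m (s'.v v_hp) = s'.m (X + 1) := by rw [← hm, block_0]
        have c1 : m (s'.v v_hp + 1) = s'.m (X + 2) := by rw [← hm, block_1]
        have c2 : m (s'.v v_hp + 2) = s'.v v_root := by rw [← hm, block_2]
        have c3 : m (s'.v v_hp + 3) = 0 := by rw [← hm, block_3]
        have := Rep.cell (m := m) (F := heap nσ nN E) (hi := s'.v v_hp + 5) (a := s'.v v_hp)
          (N := W) (R := L) (by omega)
          (fun z hz _ => by simp only [heap, Set.mem_ofPred_eq]; omega) le_rfl
        rw [c0, c1, c2, c3, shifts_zero] at this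
        simp only [upd, Nat.reduceEqDiff, if_false, reduceIte, if_true, OfNat.zero_ne_ofNat,
          OfNat.ofNat_ne_zero]
        exact this (hW.agree hag (fun _ h _ => h) (by omega))
          (h9.agree hag (fun _ h _ => h) (by omega))
      · rcases g2' with ⟨-, rfl⟩ | ⟨h0, -⟩
        · rw [List.nil_append]
          simpa [i1, e0, e1] using h9
        · omega
    refine .seq (n := 2) (n' := 2) (hroot.mono le_rfl ?_)
    rintro s₂ ⟨j1, j2⟩
    have f1 := j1.var v_i (by decide)
    have f2 := j1.var v_p (by decide)
    have f3 := j1.var v_x (by decide)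
    have f4 := j1.var v_eps (by decide)
    rw [i4 _ (by decide)] at f1 f2 f3
    have f5 := j1.hp
    rw [e0] at f5
    refine .of_lwp ?_ (by decide)
    simp only [lwp, Expr.eval_var, Expr.eval_one, Expr.eval_add, Expr.eval_sub]
    simp only [upd, Nat.reduceEqDiff, if_false, reduceIte, if_true, OfNat.zero_ne_ofNat,
          OfNat.ofNat_ne_zero, f1, f2, f3, f4]
    refine ⟨by rw [h1, List.length_cons]; push_cast; ring, h2.2, by omega, h4, h5.trans f5,
      fun z hz => ?_, c ++ [f], by rw [h7]; simp, _, _, i2, j2, hcov⟩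
    rw [j1.mem z trivial (by rw [e0]; omega), i1, h6 z hz]
  · refine ⟨w4, w5 ▸ hfs, by omega, w1, w0.ge, fun z _ => by rw [hm₀], [], rfl, false, [],
      by simp [w2], w3 ▸ .nil, ?_⟩
    rw [show runsTo A d [] = ∅ by ext; simp [runsTo]]
    exact .empty
  · rintro s' ⟨-, -, -, -, h5, -, c, h7, e, L, h8, h9, h10⟩
    rw [List.append_nil] at h7
    exact ⟨e, L, h8, h9, h7 ▸ h10, by omega⟩

end Root

/-! ## Enumeration -/

section Enumeration

/-- All outputs that arise by prepending elements of the lists in `K`, one after the other,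
to `w`. -/
def prepend : List (List Out) → Out → List Out
  | [], w => [w]
  | X :: K, w => X.flatMap fun x => prepend K (x ++ w)

/-- A stored output. -/
inductive Acc (m : ℤ → ℤ) (hi : ℤ) : ℤ → Out → Prop
  | nil : Acc m hi 0 []
  | cons {a : ℤ} {w : Out} : 0 < a → a + 5 ≤ hi → Acc m hi (m (a + 2)) w →
      Acc m hi a ((m a, m (a + 1)) :: w)

/-- A stored list of nodes with shifts. -/
inductive Cont (m : ℤ → ℤ) (F : Set ℤ) (hi : ℤ) : ℤ → List (List Out) → Prop
  | nil : Cont m F hi 0 []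
  | cons {a : ℤ} {X : List Out} {K : List (List Out)} : 0 < a → a + 5 ≤ hi →
      Rep m F hi .node (m a) X → Cont m F hi (m (a + 2)) K →
      Cont m F hi a (shifts (m (a + 1)) X :: K)

/-- A stored stack of alternatives, representing the list of the outputs to come. -/
inductive Stk (m : ℤ → ℤ) (F : Set ℤ) (hi : ℤ) : ℤ → List Out → Prop
  | nil : Stk m F hi 0 []
  | cons {a : ℤ} {R L : List Out} {K : List (List Out)} {w : Out} : 0 < a → a + 5 ≤ hi →
      0 < m a → Rep m F hi .rest (m a) R → Cont m F hi (m (a + 2)) K → Acc m hi (m (a + 3)) w →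
      Stk m F hi (m (a + 4)) L →
      Stk m F hi a (((shifts (m (a + 1)) R).flatMap fun x => prepend K (x ++ w)) ++ L)

variable {m m' : ℤ → ℤ} {F : Set ℤ} {hi hi' : ℤ}

theorem Acc.agree {a : ℤ} {w : Out} (h : Acc m hi a w) (hm : ∀ z < hi, m' z = m z)
    (hh : hi ≤ hi') : Acc m' hi' a w := by
  induction h with
  | nil => exact .nil
  | cons h1 h2 _ ih =>
    rw [← hm _ (by omega)] at ih ⊢
    rw [← hm _ (by omega)]
    exact .cons h1 (by omega) ih

theorem Cont.agree {a : ℤ} {K : List (List Out)} (h : Cont m F hi a K)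
    (hm : ∀ z < hi, m' z = m z) (hh : hi ≤ hi') : Cont m' F hi' a K := by
  induction h with
  | nil => exact .nil
  | cons h1 h2 h3 _ ih =>
    rw [← hm _ (by omega)] at ih ⊢
    have h3 := h3.agree (m' := m') (fun z _ hz => hm z hz) (fun _ h _ => h) hh
    rw [← hm _ (by omega)] at h3
    exact .cons h1 (by omega) h3 ih

theorem Stk.agree {a : ℤ} {L : List Out} (h : Stk m F hi a L)
    (hm : ∀ z < hi, m' z = m z) (hh : hi ≤ hi') : Stk m' F hi' a L := by
  induction h with
  | nil => exact .nil
  | @cons a _ _ _ _ h1 h2 h3 h4 h5 h6 _ ih =>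
    rw [← hm _ (by omega)] at ih h3
    have h4 := h4.agree (m' := m') (fun z _ hz => hm z hz) (fun _ h _ => h) hh
    have h5 := h5.agree hm hh
    have h6 := h6.agree hm hh
    rw [← hm _ (by omega)] at h4 h5 h6
    rw [← hm (a + 1) (by omega)]
    exact .cons h1 (by omega) h3 h4 h5 h6 ih

/-- The configuration `s` of the enumeration: `K` is still to be prepended to `w`, and `L` lists
the outputs that come after that. -/
structure Enum (F : Set ℤ) (s : Conf) (K : List (List Out)) (w : Out) (L : List Out) : Prop where
  hp : 0 < s.v v_hp
  cont : Cont s.m F (s.v v_hp) (s.v v_cont) K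
  acc : Acc s.m (s.v v_hp) (s.v v_acc) w
  stk : Stk s.m F (s.v v_hp) (s.v v_stk) L

variable {s s' : Conf} {K : List (List Out)} {w : Out} {L : List Out}

/-- Put the alternatives of the record at `y` on the stack. -/
def pushCmd (y : ℕ) : Cmd :=
  ite (get (var y + 2))
    (alloc v_stk (get (var y + 2)) (get (var y + 3) + var v_off) (var v_cont) (var v_acc)
      (var v_stk)) skip

/-- An alternative without outputs is not saved. The saved record carries the current continuation
and the output built so far, both persistent lists, so it can be resumed later in constant time. -/
theorem push_spec {y : ℕ} {R : List Out} (h : Enum F s K w L)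
    (hR : Rep s.m F (s.v v_hp) .rest (s.m (s.v y + 2)) R) :
    Tri (pushCmd y) s 2 fun s' => Ext [v_hp, v_stk] Set.univ s s' ∧ Enum F s' K w
      (((shifts (s.m (s.v y + 3) + s.v v_off) R).flatMap fun x => prepend K (x ++ w)) ++ L) := by
  have hp := h.hp
  refine .of_lwp ?_ le_rfl
  simp only [pushCmd, lwp, Expr.eval_get, Expr.eval_var, Expr.eval_add, Expr.eval_two,
    Expr.eval_three]
  refine ⟨fun h0 => ⟨by omega, ⟨by simp [upd], fun z _ hz => block_of_lt _ _ _ _ _ _ hz,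
    fun x hx => ?_⟩, ?_⟩, fun h0 => ⟨.refl _ _ _, ?_⟩⟩
  · simp at hx
    simp [upd, hx]
  · generalize hm : block s.m _ _ _ _ _ _ = m
    have hlt : ∀ z < s.v v_hp, m z = s.m z := fun z hz => by
      rw [← hm, block_of_lt _ _ _ _ _ _ hz]
    have c0 : m (s.v v_hp) = s.m (s.v y + 2) := by rw [← hm, block_0]
    have c1 : m (s.v v_hp + 1) = s.m (s.v y + 3) + s.v v_off := by rw [← hm, block_1]
    have c2 : m (s.v v_hp + 2) = s.v v_cont := by rw [← hm, block_2]
    have c3 : m (s.v v_hp + 3) = s.v v_acc := by rw [← hm, block_3]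
    have c4 : m (s.v v_hp + 4) = s.v v_stk := by rw [← hm, block_4]
    have hcont := h.cont.agree hlt (show s.v v_hp ≤ s.v v_hp + 5 by omega)
    have hacc := h.acc.agree hlt (show s.v v_hp ≤ s.v v_hp + 5 by omega)
    have hstk := h.stk.agree hlt (show s.v v_hp ≤ s.v v_hp + 5 by omega)
    have hR := hR.agree (m' := m) (fun z _ hz => hlt z hz) (fun _ h _ => h)
      (show s.v v_hp ≤ s.v v_hp + 5 by omega)
    have := Stk.cons (m := m) (F := F) (hi := s.v v_hp + 5) (a := s.v v_hp) (R := R) (K := K)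
      (w := w) (L := L) hp le_rfl (by omega)
    rw [c0, c1, c2, c3, c4] at this
    have := this hR hcont hacc hstk
    refine ⟨?_, ?_, ?_, ?_⟩ <;> simp only [upd, Nat.reduceEqDiff, if_false, reduceIte, if_true,
      OfNat.zero_ne_ofNat, OfNat.ofNat_ne_zero]
    · omega
    · exact hcont
    · exact hacc
    · exact this
  · generalize s.m (s.v y + 2) = r at *
    cases hR with
    | nil => exact h
    | cell h1 => omega

/-- Handle the node `cur`: the alternatives are put on the stack, and the item yields an output
symbol or two nodes. -/
def descendCmd : Cmd :=
  seq (pushCmd v_cur) <| seq (assign v_off (var v_off + get (var v_cur + 1))) <|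
  seq (assign v_it (get (var v_cur))) <|
  ite (get (var v_it))
    (seq (alloc v_cont (get (var v_it)) (get (var v_it + 1) + var v_off) (var v_cont) 0 0) <|
      seq (assign v_off (var v_off + get (var v_it + 3))) (assign v_cur (get (var v_it + 2))))
    (seq (alloc v_acc (get (var v_it + 1)) (var v_off) (var v_acc) 0 0) <|
      ite (var v_cont)
        (seq (assign v_cur (get (var v_cont))) <| seq (assign v_off (get (var v_cont + 1)))
          (assign v_cont (get (var v_cont + 2))))
        (assign v_cur 0))

/-- The first node on the list at address `κ` has been taken from the list. -/
def Next (m : ℤ → ℤ) (κ : ℤ) (s' : Conf) : Prop :=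
  (κ ≤ 0 ∧ s'.v v_cur = 0) ∨
    (0 < κ ∧ s'.v v_cur = m κ ∧ s'.v v_off = m (κ + 1) ∧ s'.v v_cont = m (κ + 2))

/-- From `s`, a first output of the list `W` is prepended to `w` in `n` steps. -/
structure Descent (F : Set ℤ) (W : List Out) (s : Conf) (K : List (List Out)) (w : Out)
    (L : List Out) (x : Out) (L' : List Out) (n : ℕ) (s' : Conf) : Prop where
  steps : Steps (var v_cur) descendCmd s n s'
  le : n + 11 ≤ 22 * x.length
  hp : s.v v_hp ≤ s'.v v_hp
  mem : ∀ z < s.v v_hp, s'.m z = s.m z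
  next : Next s.m (s.v v_cont) s'
  acc : Acc s'.m (s'.v v_hp) (s'.v v_acc) (x ++ w)
  stk : Stk s'.m F (s'.v v_hp) (s'.v v_stk) L'
  eq : ((W.flatMap fun x => prepend K (x ++ w)) ++ L) = prepend K (x ++ w) ++ L'

theorem shifts_prodL (k : ℤ) (X Y : List Out) :
    shifts k (prodL X Y) = prodL (shifts k X) (shifts k Y) := by
  simp [shifts, prodL, List.map_flatMap, List.flatMap_map, Function.comp_def, shift_append]

/-- The identity behind the treatment of products: to prepend elements of XY is to prepend an
element of Y, with X put in front of the continuation. -/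
theorem flatMap_prodL (X Y : List Out) (K : List (List Out)) (w : Out) :
    ((prodL X Y).flatMap fun x => prepend K (x ++ w)) =
      Y.flatMap fun y => prepend (X :: K) (y ++ w) := by
  simp [prodL, prepend, List.flatMap_assoc, List.flatMap_map]

/-- The symbol is prepended with its accumulated position, and the next node is taken from the
continuation. The 11 steps are 10 for the body and one for the loop test. -/
theorem descend_leaf {R : List Out} (h : Enum F s K w L) (hcur : 0 < s.v v_cur)
    (hle : s.v v_cur + 5 ≤ s.v v_hp) (hi : s.m (s.m (s.v v_cur)) = 0)
    (hile : s.m (s.v v_cur) + 5 ≤ s.v v_hp)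
    (hR : Rep s.m F (s.v v_hp) .rest (s.m (s.v v_cur + 2)) R) :
    ∃ x L' s', Descent F (shifts (s.v v_off) (shifts (s.m (s.v v_cur + 1))
      [[(s.m (s.m (s.v v_cur) + 1), 0)]] ++ shifts (s.m (s.v v_cur + 3)) R))
      s K w L x L' 11 s' := by
  have hp := h.hp
  suffices hT : Tri descendCmd s 10 fun s' => s.v v_hp ≤ s'.v v_hp ∧
      (∀ z < s.v v_hp, s'.m z = s.m z) ∧ Next s.m (s.v v_cont) s' ∧
      Acc s'.m (s'.v v_hp) (s'.v v_acc)
        ([(s.m (s.m (s.v v_cur) + 1), s.v v_off + s.m (s.v v_cur + 1))] ++ w) ∧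
      Stk s'.m F (s'.v v_hp) (s'.v v_stk)
        (((shifts (s.m (s.v v_cur + 3) + s.v v_off) R).flatMap fun x => prepend K (x ++ w)) ++ L) by
    obtain ⟨s', h1, h2, h3, h4, h5, h6⟩ := hT.steps (e := var v_cur) hcur
    refine ⟨_, _, s', ⟨h1, by simp, h2, h3, h4, h5, h6, ?_⟩⟩
    rw [shifts_append, shifts_shifts, shifts_shifts, List.flatMap_append]
    simp [shifts, shift, add_comm]
  refine .seq (n := 2) (n' := 8) ((push_spec h hR).mono le_rfl fun s₁ ⟨hE, h₁⟩ =>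
      .of_lwp ?_ (by decide))
  have hp₁ := h₁.hp
  have hm := fun z hz => hE.mem z trivial hz
  have e1 := hE.hp
  have e2 := hE.var v_cur (by decide)
  have e3 := hE.var v_off (by decide)
  have e4 := hE.var v_cont (by decide)
  have g0 := hm (s.v v_cur) (by omega)
  have g1 := hm (s.v v_cur + 1) (by omega)
  have g2 := hm (s.m (s.v v_cur)) (by omega)
  have g3 := hm (s.m (s.v v_cur) + 1) (by omega)
  simp only [lwp, Expr.eval_get, Expr.eval_var, Expr.eval_add, Expr.eval_one, Expr.eval_two,
    Expr.eval_three, Expr.eval_zero]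
  simp only [upd, Nat.reduceEqDiff, if_false, reduceIte, if_true,
    OfNat.zero_ne_ofNat, OfNat.ofNat_ne_zero, e2, e3, e4, g0, g1, g2, g3, hi]
  refine ⟨fun h0 => absurd h0 (by omega), fun _ => ⟨by omega, ?_⟩⟩
  generalize hmm : block s₁.m _ _ _ _ _ _ = m
  have hlt₁ : ∀ z < s₁.v v_hp, m z = s₁.m z := fun z hz => by
    rw [← hmm, block_of_lt _ _ _ _ _ _ hz]
  have hlt : ∀ z < s.v v_hp, m z = s.m z := fun z hz => by
    rw [hlt₁ z (by omega), hm z hz]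
  have c0 : m (s₁.v v_hp) = s.m (s.m (s.v v_cur) + 1) := by rw [← hmm, block_0]
  have c1 : m (s₁.v v_hp + 1) = s.v v_off + s.m (s.v v_cur + 1) := by rw [← hmm, block_1]
  have c2 : m (s₁.v v_hp + 2) = s₁.v v_acc := by rw [← hmm, block_2]
  have hstk := h₁.stk.agree hlt₁ (show s₁.v v_hp ≤ s₁.v v_hp + 5 by omega)
  have hacc := Acc.cons (m := m) (hi := s₁.v v_hp + 5) (a := s₁.v v_hp) (w := w) hp₁ le_rfl
    (by rw [c2]; exact h₁.acc.agree hlt₁ (by omega))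
  rw [c0, c1] at hacc
  refine ⟨fun h0 => ⟨by omega, hlt, .inr ⟨h0, ?_⟩, hacc, hstk⟩,
    fun h0 => ⟨by omega, hlt, .inl ⟨h0, ?_⟩, hacc, hstk⟩⟩
  · have hc := h.cont
    have hcl : s.v v_cont + 5 ≤ s.v v_hp := by
      generalize s.v v_cont = κ at *
      cases hc with
      | nil => omega
      | cons h1 h2 => exact h2
    simp only [upd, Nat.reduceEqDiff, if_false, reduceIte, if_true,
      OfNat.zero_ne_ofNat, OfNat.ofNat_ne_zero]
    exact ⟨hlt _ (by omega), hlt _ (by omega), hlt _ (by omega)⟩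
  · simp [upd]

/-- The left factor goes to the continuation together with its accumulated shift, and the right
factor becomes the current node. Nothing is prepended yet. -/
theorem descend_prod {X R : List Out} (h : Enum F s K w L) (hcur : 0 < s.v v_cur)
    (hle : s.v v_cur + 5 ≤ s.v v_hp) (hi : 0 < s.m (s.m (s.v v_cur)))
    (hile : s.m (s.v v_cur) + 5 ≤ s.v v_hp)
    (hX : Rep s.m F (s.v v_hp) .node (s.m (s.m (s.v v_cur))) X)
    (hR : Rep s.m F (s.v v_hp) .rest (s.m (s.v v_cur + 2)) R) :
    ∃ s', Steps (var v_cur) descendCmd s 11 s' ∧ Enum F s'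
        (shifts (s.m (s.m (s.v v_cur) + 1) + (s.v v_off + s.m (s.v v_cur + 1))) X :: K) w
        (((shifts (s.m (s.v v_cur + 3) + s.v v_off) R).flatMap fun x => prepend K (x ++ w)) ++ L) ∧
      s.v v_hp ≤ s'.v v_hp ∧ (∀ z < s.v v_hp, s'.m z = s.m z) ∧
      s'.v v_cur = s.m (s.m (s.v v_cur) + 2) ∧
      s'.v v_off = s.v v_off + s.m (s.v v_cur + 1) + s.m (s.m (s.v v_cur) + 3) ∧
      0 < s'.v v_cont ∧ s'.m (s'.v v_cont) = s.m (s.m (s.v v_cur)) ∧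
      s'.m (s'.v v_cont + 1) = s.m (s.m (s.v v_cur) + 1) + (s.v v_off + s.m (s.v v_cur + 1)) ∧
      s'.m (s'.v v_cont + 2) = s.v v_cont := by
  have hp := h.hp
  refine Tri.steps (e := var v_cur) (p := descendCmd) (n := 10)
    (s := s) hcur (.seq (n := 2) (n' := 8) ((push_spec h hR).mono le_rfl fun s₁ ⟨hE, h₁⟩ =>
      .of_lwp ?_ (by decide)))
  have hp₁ := h₁.hp
  have hm := fun z hz => hE.mem z trivial hz
  have e1 := hE.hp
  have e2 := hE.var v_cur (by decide)
  have e3 := hE.var v_off (by decide)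
  have e4 := hE.var v_cont (by decide)
  have g0 := hm (s.v v_cur) (by omega)
  have g1 := hm (s.v v_cur + 1) (by omega)
  have g2 := hm (s.m (s.v v_cur)) (by omega)
  have g3 := hm (s.m (s.v v_cur) + 1) (by omega)
  have g4 := hm (s.m (s.v v_cur) + 2) (by omega)
  have g5 := hm (s.m (s.v v_cur) + 3) (by omega)
  simp only [lwp, Expr.eval_get, Expr.eval_var, Expr.eval_add, Expr.eval_one, Expr.eval_two,
    Expr.eval_three, Expr.eval_zero]
  simp only [upd, Nat.reduceEqDiff, if_false, reduceIte, if_true,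
    OfNat.zero_ne_ofNat, OfNat.ofNat_ne_zero, e2, e3, e4, g0, g1, g2, g3]
  refine ⟨fun _ => ⟨by omega, ?_⟩, fun h0 => absurd h0 (by omega)⟩
  generalize hmm : block s₁.m _ _ _ _ _ _ = m
  have hlt₁ : ∀ z < s₁.v v_hp, m z = s₁.m z := fun z hz => by
    rw [← hmm, block_of_lt _ _ _ _ _ _ hz]
  have hlt : ∀ z < s.v v_hp, m z = s.m z := fun z hz => by
    rw [hlt₁ z (by omega), hm z hz]
  have c0 : m (s₁.v v_hp) = s.m (s.m (s.v v_cur)) := by rw [← hmm, block_0]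
  have c1 : m (s₁.v v_hp + 1) = s.m (s.m (s.v v_cur) + 1) + (s.v v_off + s.m (s.v v_cur + 1)) := by
    rw [← hmm, block_1]
  have c2 : m (s₁.v v_hp + 2) = s.v v_cont := by rw [← hmm, block_2]
  have hcont := Cont.cons (m := m) (F := F) (hi := s₁.v v_hp + 5) (a := s₁.v v_hp) (X := X) (K := K)
    hp₁ le_rfl (by
      rw [c0]
      exact hX.agree (fun z _ hz => hlt z hz) (fun _ h _ => h) (by omega))
    (by rw [c2]; exact h.cont.agree hlt (by omega))
  rw [c1] at hcont
  rw [hlt (s.m (s.v v_cur) + 2) (by omega), hlt (s.m (s.v v_cur) + 3) (by omega)]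
  refine ⟨⟨?_, ?_, ?_, ?_⟩, by omega, hlt, rfl, rfl, hp₁, c0, c1, c2⟩ <;>
    simp only [upd, Nat.reduceEqDiff, if_false, reduceIte, if_true,
      OfNat.zero_ne_ofNat, OfNat.ofNat_ne_zero]
  · omega
  · exact hcont
  · exact h₁.acc.agree hlt₁ (by omega)
  · exact h₁.stk.agree hlt₁ (by omega)

/-- What the enumeration does with a record that represents the list `W`. -/
def Explores (m : ℤ → ℤ) (F : Set ℤ) (hi : ℤ) : Kind → ℤ → List Out → Prop
  | .item, a, W => ∀ (s : Conf) (K : List (List Out)) (w : Out) (L R : List Out), Enum F s K w L →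
      hi ≤ s.v v_hp → (∀ z < hi, s.m z = m z) → 0 < s.v v_cur → s.v v_cur + 5 ≤ s.v v_hp →
      s.m (s.v v_cur) = a → Rep s.m F (s.v v_hp) .rest (s.m (s.v v_cur + 2)) R →
      ∃ x L' n s', Descent F (shifts (s.v v_off) (shifts (s.m (s.v v_cur + 1)) W ++
        shifts (s.m (s.v v_cur + 3)) R)) s K w L x L' n s'
  | .node, a, W => ∀ (s : Conf) (K : List (List Out)) (w : Out) (L : List Out), Enum F s K w L →
      hi ≤ s.v v_hp → (∀ z < hi, s.m z = m z) → s.v v_cur = a →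
      ∃ x L' n s', Descent F (shifts (s.v v_off) W) s K w L x L' n s'
  | .rest, _, _ => True

/-- Induction on the representation. Following items only, the descent finds one output x of the
set; all other outputs are accounted for, in order, by the new stack. Since nodes never represent
the empty output, the cost can be charged to the symbols of x. -/
theorem Rep.explores {κ : Kind} {a : ℤ} {W : List Out} (h : Rep m F hi κ a W)
    (hF : ∀ z ∈ F, 0 < z) : Explores m F hi κ a W := by
  induction h with
  | @leaf a h1 h2 h3 =>
    intro s K w L R h hh hm hcur hle ha hR
    have := descend_leaf h hcur hle (by rw [ha, hm _ (by omega), h3]) (by omega) hR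
    rw [ha, hm (a + 1) (by omega)] at this
    obtain ⟨x, L', s', h⟩ := this
    exact ⟨x, L', 11, s', h⟩
  | @prod a X Y h1 h2 h3 hX hY ihX ihY =>
    intro s K w L R h hh hm hcur hle ha hR
    have e0 := hm a (by omega)
    have e1 := hm (a + 1) (by omega)
    have e2 := hm (a + 2) (by omega)
    have e3 := hm (a + 3) (by omega)
    have := descend_prod (X := X) h hcur hle (by rw [ha, e0]; exact h3) (by omega)
      (by rw [ha, e0]; exact hX.agree (fun z _ hz => hm z hz) (fun _ h _ => h) hh) hR
    rw [ha, e0, e1, e2, e3] at this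
    obtain ⟨s₁, g1, g2, g3, g4, g5, g6, g7, g8, g9, g10⟩ := this
    -- The right factor is explored first, with the left one on top of the continuation; `Next` then
    -- hands the left one to the second exploration.
    obtain ⟨y, L₁, n₁, s₂, f⟩ := ihY s₁ _ _ _ g2 (by omega)
      (fun z hz => (g4 z (by omega)).trans (hm z hz)) g5
    rcases f.next with ⟨f1, -⟩ | ⟨-, f2, f3, f4⟩
    · omega
    rw [g8] at f2
    rw [g9] at f3
    rw [g10] at f4
    have hm₂ : ∀ z < s.v v_hp, s₂.m z = s.m z := fun z hz => by
      rw [f.mem z (by omega), g4 z hz]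
    have hhp := f.hp
    have hp := h.hp
    obtain ⟨x, L₂, n₂, s₃, d⟩ := ihX s₂ K (y ++ w) L₁
      ⟨by omega, f4 ▸ h.cont.agree hm₂ (by omega), f.acc, f.stk⟩ (by omega)
      (fun z hz => (hm₂ z (by omega)).trans (hm z hz)) f2
    refine ⟨x ++ y, L₂, 11 + (n₁ + n₂), s₃, ⟨g1.trans (f.steps.trans d.steps), ?_,
      g3.trans (f.hp.trans d.hp), fun z hz => by rw [d.mem z (by omega), hm₂ z hz], ?_,
      by simpa using d.acc, d.stk, ?_⟩⟩
    -- An output of length ℓ meets ℓ leaves and ℓ - 1 products, at 11 steps each: 11(2ℓ - 1) = 22ℓ -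
    -- 11. The slack 11 in one of the two factors pays for the present product.
    · have i1 := f.le
      have i2 := d.le
      rw [List.length_append]
      omega
    · have := d.next
      rw [f4] at this
      have hc := h.cont
      generalize s.v v_cont = κ at *
      cases hc with
      | nil => exact this.imp_right fun h => absurd h.1 (lt_irrefl _)
      | cons c1 c2 =>
        rcases this with h | ⟨h, i1, i2, i3⟩
        · exact .inl h
        · exact .inr ⟨h, by rw [i1, hm₂ _ (by omega)], by rw [i2, hm₂ _ (by omega)],
            by rw [i3, hm₂ _ (by omega)]⟩
    · have i1 := f.eq
      have i2 := d.eq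
      rw [List.append_assoc, ← i2, f3, shifts_append, shifts_shifts, shifts_shifts,
        List.flatMap_append, shifts_prodL, flatMap_prodL, shifts_shifts, shifts_shifts,
        List.append_assoc, add_comm (s.m (s.v v_cur + 1)), add_comm (m (a + 3)), ← g6]
      exact i1
  | @node a I R h1 h2 _ hR ih _ =>
    intro s K w L h hh hm ha
    have e0 := hm a (by omega)
    have e1 := hm (a + 1) (by omega)
    have e2 := hm (a + 2) (by omega)
    have e3 := hm (a + 3) (by omega)
    -- The assumption on F makes the node address positive, so the loop test succeeds.
    have := ih s K w L R h hh hm (ha ▸ hF a (h1 a le_rfl (by omega))) (by omega) (by rw [ha, e0])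
      (by rw [ha, e2]; exact hR.agree (fun z _ hz => hm z hz) (fun _ h _ => h) hh)
    rw [ha, e1, e3] at this
    exact this
  | nil => trivial
  | cell => trivial

end Enumeration

/-! ### Complete outputs and the delay. -/

section Enumeration

variable {m : ℤ → ℤ} {F : Set ℤ} {hi : ℤ} {s : Conf} {K : List (List Out)} {w : Out} {L : List Out}

/-- Exploring the nodes of the continuation one after the other completes the output. The costs add
up to at most 22 steps for each prepended symbol, and the loop stops when the continuation is empty.
-/
theorem Cont.run {κ : ℤ} (h : Cont m F hi κ K) (hF : ∀ z ∈ F, 0 < z) (hN : Next m κ s)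
    (hh : hi ≤ s.v v_hp) (hm : ∀ z < hi, s.m z = m z) (hp : 0 < s.v v_hp)
    (hacc : Acc s.m (s.v v_hp) (s.v v_acc) w) (hstk : Stk s.m F (s.v v_hp) (s.v v_stk) L) :
    ∃ w' L' n s', Steps (var v_cur) descendCmd s n s' ∧ s'.v v_cur = 0 ∧
      n + 22 * w.length ≤ 22 * w'.length ∧ 0 < s'.v v_hp ∧
      Acc s'.m (s'.v v_hp) (s'.v v_acc) w' ∧ Stk s'.m F (s'.v v_hp) (s'.v v_stk) L' ∧
      prepend K w ++ L = w' :: L' := by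
  induction K generalizing κ m hi s w L with
  | nil =>
    cases h
    rcases hN with ⟨-, h⟩ | ⟨h, -⟩
    · exact ⟨w, L, 0, s, .refl s, h, by omega, hp, hacc, hstk, rfl⟩
    · exact absurd h (lt_irrefl _)
  | cons W K ih =>
    cases h with
    | @cons _ X _ h1 h2 h3 h4 =>
      rcases hN with ⟨h, -⟩ | ⟨-, h5, h6, h7⟩
      · omega
      have hc : Cont s.m F (s.v v_hp) (s.v v_cont) K := h7 ▸ h4.agree hm hh
      obtain ⟨x, L₁, n₁, s₁, d⟩ := h3.explores hF s K w L ⟨hp, hc, hacc, hstk⟩ hh hm h5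
      have hhp := d.hp
      obtain ⟨w', L', n₂, s₂, g1, g2, g3, g4, g5, g6, g7⟩ := ih hc d.next d.hp d.mem (by omega)
        d.acc d.stk
      refine ⟨w', L', n₁ + n₂, s₂, d.steps.trans g1, g2, ?_, g4, g5, g6, ?_⟩
      · have := d.le
        rw [List.length_append] at g3
        omega
      · rw [prepend, ← h6, d.eq, g7]

/-- Find the next output. -/
def findCmd : Cmd :=
  seq (assign v_x (get (var v_stk))) <| seq (assign v_off (get (var v_stk + 1))) <|
  seq (assign v_cont (get (var v_stk + 2))) <| seq (assign v_acc (get (var v_stk + 3))) <|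
  seq (assign v_stk (get (var v_stk + 4))) <| seq (pushCmd v_x) <|
  seq (assign v_off (var v_off + get (var v_x + 1))) <| seq (assign v_cur (get (var v_x))) <|
  loop (var v_cur) descendCmd

/-- The rest on top of the stack is nonempty, so it starts with a node. Its tail is saved again and
the node is explored; hence a nonempty stack always yields an output. -/
theorem find_spec (hF : ∀ z ∈ F, 0 < z) (hp : 0 < s.v v_hp)
    (h : Stk s.m F (s.v v_hp) (s.v v_stk) L) (hpos : 0 < s.v v_stk) :
    ∃ w L', L = w :: L' ∧ Tri findCmd s (22 * w.length + 10) fun s' => 0 < s'.v v_hp ∧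
      Acc s'.m (s'.v v_hp) (s'.v v_acc) w ∧ Stk s'.m F (s'.v v_hp) (s'.v v_stk) L' := by
  generalize hκ : s.v v_stk = κ at *
  cases h with
  | nil => exact absurd hpos (lt_irrefl _)
  | @cons _ R L K w h1 h2 h3 h4 h5 h6 h7 =>
    generalize hr : s.m κ = r at *
    cases h4 with
    | nil => exact absurd h3 (lt_irrefl _)
    | @cell _ N R a1 a2 a3 a4 a5 =>
      let s₁ : Conf := ⟨upd (upd (upd (upd (upd s.v v_x r) v_off (s.m (κ + 1))) v_cont
        (s.m (κ + 2))) v_acc (s.m (κ + 3))) v_stk (s.m (κ + 4)), s.m⟩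
      have b0 : s₁.v v_x = r := by simp [s₁, upd]
      have b1 : s₁.v v_off = s.m (κ + 1) := by simp [s₁, upd]
      have b2 : s₁.v v_hp = s.v v_hp := by simp [s₁, upd]
      have hE₁ : Enum F s₁ K w L := by
        refine ⟨?_, ?_, ?_, ?_⟩ <;> simpa [s₁, upd]
      have hpush := push_spec (y := v_x) (R := R) hE₁ (by rw [b0, b2]; exact a5)
      obtain ⟨t, s₂, c1, c2, c3, c4, c5⟩ := hpush
      rw [b0] at c5
      have hm : ∀ z < s.v v_hp, s₂.m z = s.m z := fun z hz => c4.mem z trivial (b2 ▸ hz)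
      have hhp := c4.hp
      rw [b2] at hhp
      have b3 := c4.var v_x (by decide)
      have b4 := c4.var v_off (by decide)
      rw [b0] at b3
      rw [b1] at b4
      let s₃ : Conf := ⟨upd (upd s₂.v v_off (s.m (κ + 1) + s.m (r + 1))) v_cur (s.m r), s₂.m⟩
      obtain ⟨x, L₁, n₁, s₄, d⟩ := a4.explores hF s₃ K w
        (((shifts (s.m (r + 3) + s.m (κ + 1)) R).flatMap fun x => prepend K (x ++ w)) ++ L) (by
          refine ⟨?_, ?_, ?_, ?_⟩
          · simpa [s₃, upd] using c5.hp
          · simpa [s₃, upd] using c5.cont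
          · simpa [s₃, upd] using c5.acc
          · have := c5.stk
            rw [b1] at this
            simpa [s₃, upd] using this) (by simpa [s₃, upd] using hhp) hm (by simp [s₃, upd])
      have e1 : s₃.v v_cont = s.m (κ + 2) := by
        have := c4.var v_cont (by decide)
        simpa [s₁, s₃, upd] using this
      have e2 : s₃.v v_hp = s₂.v v_hp := by simp [s₃, upd]
      have e3 : s₃.v v_off = s.m (κ + 1) + s.m (r + 1) := by simp [s₃, upd]
      have hd := d.hp
      obtain ⟨w', L', n₂, s₅, g1, g2, g3, g4, g5, g6, g7⟩ := Cont.run (m := s₃.m) (hi := s₃.v v_hp)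
        (κ := s₃.v v_cont)
        (by rw [e1, e2]; exact h5.agree hm hhp) hF d.next d.hp d.mem (by omega) d.acc d.stk
      refine ⟨w', L', ?_, ?_⟩
      · rw [← g7, ← d.eq, shifts_append, shifts_shifts, shifts_shifts, List.flatMap_append,
          List.append_assoc, e3, add_comm (s.m (κ + 1))]
      · have := (d.steps.trans g1).tri g2.le
        refine (Tri.assign (.assign (.assign (.assign (.assign (n := 5 + 22 * w'.length)
          ?_))))).mono (by omega) fun _ h => h
        generalize hs : Conf.mk _ _ = s₀
        obtain rfl : s₀ = s₁ := by
          rw [← hs]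
          simp [s₁, upd, hκ, hr]
        refine (Tri.seq (n := 2) (n' := 3 + 22 * w'.length)
          ⟨t, s₂, c1, c2, c3, ?_⟩).mono (by omega) fun _ h => h
        refine (Tri.assign (.assign (n := 1 + 22 * w'.length) ?_)).mono
          (by omega) fun _ h => h
        generalize hs : Conf.mk _ _ = s₆
        obtain rfl : s₆ = s₃ := by
          rw [← hs]
          simp [s₃, upd, b3, b4, hm _ (show r < s.v v_hp by omega),
            hm _ (show r + 1 < s.v v_hp by omega)]
        exact this.mono (by have := d.le; rw [List.length_append] at g3; omega)
          fun _ h => h ▸ ⟨g4, g5, g6⟩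

/-- Print the stored output. -/
def printCmd : Cmd :=
  loop (var v_acc) (seq (print (get (var v_acc))) (seq (print (get (var v_acc + 1)))
    (assign v_acc (get (var v_acc + 2)))))

/-- How an output is printed. -/
def printedZ (w : Out) : List Event := w.flatMap fun x => [.val x.1, .val x.2]

theorem print_spec {a : ℤ} (h : Acc s.m hi a w) (ha : s.v v_acc = a) :
    ∃ t s', HExec printCmd s t s' ∧ printed t = printedZ w ∧ t.length ≤ 4 * w.length + 1 ∧
      s'.m = s.m ∧ ∀ x, x ∉ [v_acc] → s'.v x = s.v x := by
  generalize hm : s.m = m at h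
  induction h generalizing s with
  | nil => exact ⟨_, _, .loop_neg (by simp [ha]), rfl, by simp, hm, fun _ _ => rfl⟩
  | @cons a w h1 h2 h3 ih =>
    obtain ⟨t, s', g1, g2, g3, g4, g5⟩ := ih (s := ⟨upd s.v v_acc (m (a + 2)), m⟩)
      (by simp [upd]) rfl
    refine ⟨_, s', .loop_pos (by simpa [ha] using h1) (.seq (.print _ _) (.seq (.print _ _)
      (.assign _ _ _))) (t' := t) (by simpa [printCmd, ha, hm] using g1), ?_, ?_, g4,
      fun x hx => ?_⟩
    · simp only [printedZ, List.flatMap_cons] at g2 ⊢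
      rw [← g2]
      simp [printed, ha, hm]
    · simp; omega
    · rw [g5 x hx]
      simp at hx
      simp [upd, hx]

/-- As `PrintsWithDelay`, for outputs as printed. -/
def PrintsZ (c : ℕ) : List Out → List Event → Prop
  | [], t => Silent t ∧ t.length ≤ c
  | w :: ws, t => ∃ u t', t = u ++ Event.sep :: t' ∧ printed u = printedZ w ∧
      u.length + 1 ≤ c * (w.length + 1) ∧ PrintsZ c ws t'

theorem PrintsZ.mono {c c' : ℕ} (hc : c ≤ c') {ws : List Out} {t : List Event}
    (h : PrintsZ c ws t) : PrintsZ c' ws t := by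
  induction ws generalizing t with
  | nil => exact ⟨h.1, h.2.trans hc⟩
  | cons w ws ih =>
    obtain ⟨u, t', h1, h2, h3, h4⟩ := h
    exact ⟨u, t', h1, h2, h3.trans (Nat.mul_le_mul_right _ hc), ih h4⟩

theorem PrintsZ.silent_append {c k : ℕ} {ws : List Out} {t u : List Event} (h : PrintsZ c ws t)
    (hu : Silent u) (hk : u.length ≤ k) : PrintsZ (c + k) ws (u ++ t) := by
  cases ws with
  | nil => exact ⟨hu.append h.1, by have := h.2; simp; omega⟩
  | cons w ws =>
    obtain ⟨v, t', rfl, h2, h3, h4⟩ := h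
    refine ⟨u ++ v, t', by simp, by rw [printed_append, hu.printed_eq, List.nil_append, h2], ?_,
      h4.mono (by omega)⟩
    rw [List.length_append, add_mul]
    have := Nat.mul_le_mul hk (show 1 ≤ w.length + 1 by omega)
    omega

/-- Print the outputs. -/
def enumCmd : Cmd :=
  seq (ite (var v_eps) sep skip) <| seq (assign v_stk 0) <|
  seq (ite (var v_root) (alloc v_stk (var v_root) 0 0 0 0) skip) <|
  loop (var v_stk) (seq findCmd (seq printCmd sep))

/-- Induction on the number of outputs to come, which is zero exactly if the stack is empty. After
the last separator only the failing loop test remains. -/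
theorem enum_loop (hF : ∀ z ∈ F, 0 < z) (hp : 0 < s.v v_hp)
    (h : Stk s.m F (s.v v_hp) (s.v v_stk) L) :
    ∃ t s', HExec (loop (var v_stk) (seq findCmd (seq printCmd sep))) s t s' ∧
      PrintsZ 26 L t := by
  induction hn : L.length generalizing s L with
  | zero =>
    rw [List.length_eq_zero_iff] at hn
    subst hn
    refine ⟨_, _, .loop_neg ?_, silent_tick, by simp⟩
    -- A nonempty stack would produce a further output.
    by_contra h0
    obtain ⟨w, L', h1, -⟩ := find_spec hF hp h (by simpa using h0)
    cases h1
  | succ n ih =>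
    have hpos : 0 < s.v v_stk := by
      by_contra h0
      generalize s.v v_stk = κ at *
      cases h with
      | nil => simp at hn
      | cons h1 => exact h0 h1
    obtain ⟨w, L', rfl, t₁, s₁, h1, h2, h3, h4, h5, h6⟩ := find_spec hF hp h hpos
    obtain ⟨t₂, s₂, g1, g2, g3, g4, g5⟩ := print_spec h5 rfl
    have e0 := g5 v_hp (by decide)
    have e1 := g5 v_stk (by decide)
    obtain ⟨t₃, s₃, i1, i2⟩ := ih (s := s₂) (L := L') (by omega) (by rw [g4, e0, e1]; exact h6)
      (by simpa using hn)
    refine ⟨_, _, .loop_pos hpos (.seq h1 (.seq g1 (.sep _))) i1, .tick :: (t₁ ++ t₂), t₃, by simp,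
      ?_, ?_, i2⟩
    · rw [← List.cons_append, printed_append, h2.tick_cons.printed_eq, List.nil_append, g2]
    -- With ℓ symbols: 22ℓ + 10 steps for finding, 4ℓ + 1 for printing, one for the loop test and
    -- one for the separator, in total 26ℓ + 13.
    · simp; omega

/-- The empty output is printed first, governed by the flag. The silent steps at the start, at most
3 + 2, are charged to the next output or to the final halt, whence 31 = 26 + 5. -/
theorem enum_spec {e : Bool} (hF : ∀ z ∈ F, 0 < z) (hp : 0 < s.v v_hp)
    (he : 0 < s.v v_eps ↔ e = true) (h : Rep s.m F (s.v v_hp) .rest (s.v v_root) L) :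
    ∃ t s', HExec enumCmd s t s' ∧ PrintsZ 31 ((if e then [[]] else []) ++ L) t := by
  have h1 : Tri (seq (assign v_stk 0) (ite (var v_root) (alloc v_stk (var v_root) 0 0 0 0) skip))
      s 3 fun s' => 0 < s'.v v_hp ∧ Stk s'.m F (s'.v v_hp) (s'.v v_stk) L := by
    refine .of_lwp ?_ (by decide)
    simp only [lwp, Expr.eval_var, Expr.eval_zero]
    simp only [upd, Nat.reduceEqDiff, if_false, reduceIte, if_true,
      OfNat.zero_ne_ofNat, OfNat.ofNat_ne_zero]
    refine ⟨fun h0 => ⟨by omega, by omega, ?_⟩, fun h0 => ⟨hp, ?_⟩⟩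
    · generalize hmm : block s.m _ _ _ _ _ _ = m
      have hlt : ∀ z < s.v v_hp, m z = s.m z := fun z hz => by
        rw [← hmm, block_of_lt _ _ _ _ _ _ hz]
      have := Stk.cons (m := m) (F := F) (hi := s.v v_hp + 5) (a := s.v v_hp) (R := L) (K := [])
        (w := []) (L := []) hp le_rfl
      rw [show m (s.v v_hp) = s.v v_root by rw [← hmm, block_0],
        show m (s.v v_hp + 1) = 0 by rw [← hmm, block_1],
        show m (s.v v_hp + 2) = 0 by rw [← hmm, block_2],
        show m (s.v v_hp + 3) = 0 by rw [← hmm, block_3],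
        show m (s.v v_hp + 4) = 0 by rw [← hmm, block_4]] at this
      have := this h0 (h.agree (fun z _ hz => hlt z hz) (fun _ h _ => h) (by omega)) .nil .nil .nil
      simpa [prepend] using this
    · generalize s.v v_root = r at *
      cases h with
      | nil => exact .nil
      | cell h => omega
  obtain ⟨t, s₁, g1, g2, g3, g4, g5⟩ := h1
  obtain ⟨t', s₂, i1, i2⟩ := enum_loop hF g4 g5
  cases g1 with | seq g11 g12 =>
  cases e with
  | true =>
    refine ⟨_, s₂, .seq (.ite_pos (he.2 rfl) (.sep _)) (.seq g11 (.seq g12 i1)), [.tick], _, rfl,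
      rfl, by simp, ?_⟩
    have := (i2.silent_append g2 g3).mono (c' := 31) (by omega)
    simpa using this
  | false =>
    refine ⟨_, s₂, .seq (.ite_neg (not_lt.1 fun h => by simpa using he.1 h) (.skip _))
      (.seq g11 (.seq g12 i1)), ?_⟩
    have := (i2.silent_append g2 g3).silent_append (silent_tick.append silent_tick)
      (k := 2) (by simp)
    simpa using this

end Enumeration

section Main

variable {nQ nσ nΩ nN : ℕ} {A : AnnA (Fin nQ) (Fin nσ) (Fin nΩ)} {S : SLP (Fin nN) (Fin nσ)}
  {fs : List (Fin nQ)} {ts : List (Fin nQ × Fin nσ × Option (Fin nΩ) × Fin nQ)}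

/-! ## The two phases -/

/-- Build the tables and the matrices of the letters. -/
def tablesCmd : Cmd :=
  seq headCmd <| seq endCmd <| seq scanCmd <| seq offCmd <| seq unitCmd <| seq letCmd fillCmd

theorem tables_spec {input : List ℕ} (hts : ∀ e, e ∈ ts ↔ e ∈ A.trans) (hnd : ts.Nodup)
    (h : input = [nσ, nΩ, nQ, (A.start : ℕ)] ++ (fs.length :: fs.map Fin.val) ++
      (ts.length :: ts.flatMap encodeTransition) ++ encodeSLP S) :
    Tri tablesCmd (initConf input) (nN * 8 + nQ * 9 + ts.length * 24 + 40) fun s =>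
      Dfs A S fs ts input.length ∅ s ∧ Inp S fs ts input.length s.m ∧
      s.m (s.v v_ro + (A.start : ℕ)) = 3 * (nQ * (A.start : ℕ) : ℕ) ∧
      s.v v_ro + (A.start : ℕ) < s.v v_hp := by
  rw [show nN * 8 + nQ * 9 + ts.length * 24 + 40 = 10 + ((nN * 3 + 7) + ((nN * 5 + 4) +
    ((nQ * 5 + 5) + ((nQ * 4 + 8) + ((ts.length * 8 + 3) + (ts.length * 16 + 3)))))) by ring]
  have hz := initConf_zero input
  generalize hE : input.length = E at *
  refine .seq ((head_spec h).mono le_rfl ?_)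
  rw [hE]
  rintro s₁ ⟨hv₁, hi₁, hm₁⟩
  rw [← hm₁] at hz
  refine .seq ((end_spec hv₁ hi₁).mono le_rfl ?_)
  rintro s₂ ⟨ht₂, hp₂, hm₂, hx₂⟩
  have hv₂ := hv₁.congr fun x hx => hx₂ x (by revert x; decide)
  refine .seq ((scan_spec hv₂ ht₂ (hm₂ ▸ hi₁)).mono le_rfl ?_)
  rintro s₃ ⟨hr₃, hm₃, hx₃⟩
  rw [hm₂] at hm₃
  have hv₃ := hv₂.congr fun x hx => hx₃ x (by revert x; decide)
  have ht₃ := ht₂.congr fun x hx => hx₃ x (by revert x; decide)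
  have hp₃ := (hx₃ v_hp (by decide)).trans hp₂
  have hro₃ := ht₃.ro
  refine .seq ((off_spec hv₃.hnQ hv₃.hw (by omega)).mono le_rfl ?_)
  rintro s₄ ⟨ho₄, hsz₄, hm₄, hx₄⟩
  have hv₄ := hv₃.congr fun x hx => hx₄ x (by revert x; decide)
  have ht₄ := ht₃.congr fun x hx => hx₄ x (by revert x; decide)
  have hp₄ := (hx₄ v_hp (by decide)).trans hp₃
  have hle := hi₁.fsle
  refine .seq ((unit_spec A (F := heap nσ nN E) hv₄.hnQ hv₄.hw hsz₄ (by omega) (fun z hz' => ?_)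
    fun z hz' => ?_).mono le_rfl ?_)
  · rw [hm₄ z (by omega), hm₃ z (by omega), hz z (by omega)]
  · simp only [heap, Set.mem_ofPred_eq]; omega
  rintro s₅ ⟨hzm₅, hid₅, hE₅, hz₅⟩
  have hv₅ := hv₄.congr fun x hx => hE₅.var x (by revert x; decide)
  have ht₅ := ht₄.congr fun x hx => hE₅.var x (by revert x; decide)
  have hm₅ := fun z hz => hE₅.mem z trivial hz
  have hp₅ := hE₅.hp
  have hmt₅ := ht₅.mt
  have hro₅ := ht₅.ro
  have hi₅ : Inp S fs ts E s₅.m := hi₁.agree fun z hz' => by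
    rw [hm₅ z (by omega), hm₄ z (by omega), hm₃ z (by omega)]
  have hsz₅ := (hE₅.var v_sz (by decide)).trans hsz₄
  refine .seq ((let_spec hv₅ ht₅ hi₅ hsz₅ (by omega) hz₅ fun a ha => ?_).mono le_rfl ?_)
  · rw [hm₅ _ (by omega), hm₄ _ (by omega), hm₃ _ (by omega), hz _ (by omega)]
  rintro s₆ ⟨hL₆, hne₆, hp₆, -, hm₆, hx₆⟩
  have hv₆ := hv₅.congr fun x hx => hx₆ x (by revert x; decide)
  have ht₆ := ht₅.congr fun x hx => hx₆ x (by revert x; decide)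
  have hi₆ : Inp S fs ts E s₆.m := hi₅.agree fun z hz' => by rw [hm₆ z (by omega)]
  have hmt₆ := hx₆ v_mt (by decide)
  have hro₆ := hx₆ v_ro (by decide)
  rw [← hmt₆] at hL₆ hne₆
  have ho₆ : ∀ p < nQ, s₆.m (s₆.v v_ro + p) = 3 * (nQ * p : ℕ) := fun p hp => by
    rw [hro₆, hm₆ _ (by omega), hro₅, hm₅ _ (by omega), ← hro₃, ho₄ p hp]
  refine (fill_spec hv₆ ht₆ hi₆ hts hnd ho₆ (by omega) hp₆ hL₆ hne₆).mono le_rfl ?_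
  rintro s₇ ⟨hl₇, hE₇⟩
  have hv₇ := hv₆.congr fun x hx => hE₇.var x (by revert x; decide)
  have ht₇ := ht₆.congr fun x hx => hE₇.var x (by revert x; decide)
  have hp₇ := hE₇.hp
  have hm₇ : ∀ z, z < s₅.v v_hp → s₇.m z = s₆.m z := fun z hz => hE₇.mem z hz (by omega)
  have hmt₇ := hE₇.var v_mt (by decide)
  have hro₇ := hE₇.var v_ro (by decide)
  have hheap : {z | s₆.v v_ro ≤ z} = heap nσ nN E := by rw [ht₆.ro]; rfl
  have hag : Agree (heap nσ nN E) (s₅.v v_hp) s₅.m s₇.m := fun z hz hz' => by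
    simp only [heap, Set.mem_ofPred_eq] at hz
    rw [hm₇ z hz', hm₆ z (by omega)]
  rw [hheap] at hl₇
  have hq := A.start.2
  have hvar : ∀ x, x ∈ [v_zm, v_id] → s₇.v x = s₅.v x := fun x hx => by
    rw [hE₇.var x (by revert x; decide), hx₆ x (by revert x; decide)]
  refine ⟨⟨hv₇, ht₇, fun B => (hr₃ B).agree fun z hz' => ?_, ?_, by omega, ?_, ?_, fun a => ?_,
    by simp, fun B _ => ?_⟩, hi₆.agree fun z hz' => hm₇ z (by omega), ?_, by omega⟩
  · rw [hm₇ z (by omega), hm₆ z (by omega), hm₅ z (by omega), hm₄ z (by omega)]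
  · rw [hE₇.var v_sz (by decide), hx₆ v_sz (by decide), hsz₅]
  · rw [hvar v_zm (by decide)]
    exact hzm₅.agree hag (fun _ h _ => h) (by omega)
  · rw [hvar v_id (by decide)]
    exact hid₅.agree hag (fun _ h _ => h) (by omega)
  · have ha := a.2
    rw [hmt₇, hm₇ _ (by omega)]
    by_cases h0 : s₆.m (s₆.v v_mt + (a : ℕ)) = 0
    · refine .inl ⟨h0, fun p q => ?_⟩
      rw [paths_single A hts, Set.eq_empty_iff_forall_notMem]
      rintro ρ ⟨t, ht, -, rfl, -⟩
      exact hne₆ t ht h0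
    · exact .inr (hl₇ a h0)
  · have hB := B.2
    rw [hmt₇, hm₇ _ (by omega), hm₆ _ (by omega), hm₅ _ (by omega), hm₄ _ (by omega),
      hm₃ _ (by omega), hz _ (by omega)]
  · rw [hro₇, hm₇ _ (by omega), ho₆ _ hq]

/-- The preprocessing. -/
def preCmd : Cmd := seq tablesCmd (seq dfsCmd rootCmd)

/-- The tables cost time linear in |A| and the number of nonterminals, the search at most 2|S|
matrix products, and the final states time linear in |Q|. -/
theorem pre_spec {input : List ℕ} (hnf : fs.Nodup)
    (hts : ∀ e, e ∈ ts ↔ e ∈ A.trans) (hnd : ts.Nodup)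
    (h : input = [nσ, nΩ, nQ, (A.start : ℕ)] ++ (fs.length :: fs.map Fin.val) ++
      (ts.length :: ts.flatMap encodeTransition) ++ encodeSLP S) :
    Tri preCmd (initConf input) (230 * (A.size + S.size * nQ ^ 3)) fun s' =>
      ∃ e L, (0 < s'.v v_eps ↔ e = true) ∧
      Rep s'.m (heap nσ nN input.length) (s'.v v_hp) .rest (s'.v v_root) L ∧
      Cov (runsTo A S.doc fs) e L ∧ 0 < s'.v v_hp := by
  have hfl : fs.length ≤ nQ := by simpa using hnf.length_le_card
  refine .mono (.seq (n' := (S.size * 2 * (stepTime nQ + 1) + 6) + (fs.length * 8 + 6))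
    ((tables_spec hts hnd h).mono le_rfl
    fun s ⟨h1, h2, h3, h4⟩ => .seq ((dfs_spec h1).mono le_rfl
      fun s₁ ⟨g1, g2, g3, g4, g5⟩ => ?_))) ?_ fun _ h => h
  · have hp := h1.hp
    have e0 := h1.tabs.ro
    have hle := h2.fsle
    refine root_spec g2 (h2.hfs.agree fun z hz hz' => g5 z (.inl ?_) ?_) h2.fsle hnf ?_ g1
      (by omega)
    · rw [List.length_map] at hz'; omega
    · rw [List.length_map] at hz'; omega
    · rw [g3.ro, ← e0, g5 _ (.inr (by omega)) h4, h3]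
  · have hQ : 1 ≤ nQ := A.start.pos
    have hN : nN ≤ S.size := by
      have : ∑ _B : Fin nN, 1 ≤ S.size := Finset.sum_le_sum fun B _ => by omega
      simpa using this
    have hS : 1 ≤ S.size := le_trans S.start.pos hN
    have hA : A.size = nQ + ts.length := by
      have : A.trans = ts.toFinset := by ext e; simp [hts]
      rw [AnnA.size, Fintype.card_fin, this, List.toFinset_card_of_nodup hnd]
    have h1 : nQ ≤ nQ ^ 3 := Nat.le_self_pow (by norm_num) nQ
    have h2 : nQ ^ 2 ≤ nQ ^ 3 := Nat.pow_le_pow_right hQ (by norm_num)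
    have h3 : 1 ≤ nQ ^ 3 := hQ.trans h1
    -- Here 85 = 44 + 14 + 6 + 20 + 1, as lower powers of nQ are at most nQ³.
    have h4 : stepTime nQ + 1 ≤ 85 * nQ ^ 3 := by
      have : stepTime nQ = 44 * nQ ^ 3 + 14 * nQ ^ 2 + 6 * nQ + 20 := by unfold stepTime; ring
      omega
    have h5 : S.size * 2 * (stepTime nQ + 1) ≤ 170 * (S.size * nQ ^ 3) := by
      calc _ ≤ S.size * 2 * (85 * nQ ^ 3) := Nat.mul_le_mul_left _ h4
        _ = _ := by ring
    have h6 : S.size ≤ S.size * nQ ^ 3 := Nat.le_mul_of_pos_right _ h3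
    rw [hA]
    -- The coefficient 230 of |S|·|Q|³ is 170 for the products, 8 for the rule tables and 52 for the
    -- additive constants.
    omega

/-- The output as it is printed. -/
def toOut {n : ℕ} (w : List (Fin n × ℕ)) : Out := w.map fun x => (((x.1 : ℕ) : ℤ), (x.2 : ℤ))

theorem toOut_injective {n : ℕ} : Function.Injective (toOut (n := n)) := by
  refine List.map_injective_iff.2 fun x y h => ?_
  simp only [Prod.mk.injEq, Nat.cast_inj] at h
  exact Prod.ext (Fin.ext h.1) h.2

theorem PrintsZ.printsWithDelay {n c : ℕ} {ws : List (List (Fin n × ℕ))} {t : List Event}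
    (h : PrintsZ c (ws.map toOut) t) : PrintsWithDelay c ws t := by
  induction ws generalizing t with
  | nil => exact h
  | cons w ws ih =>
    obtain ⟨u, t', h1, h2, h3, h4⟩ := h
    refine ⟨u, t', h1, ?_, by simpa [toOut] using h3, ih h4⟩
    rw [h2, printedZ, printedForm, toOut, List.flatMap_map]

theorem mem_runsTo (hfs : ∀ q, q ∈ fs ↔ q ∈ A.final) {d : List (Fin nσ)}
    {ρ : List (Option (Fin nΩ) × Fin nQ)} :
    ρ ∈ runsTo A d fs ↔ A.IsAcceptingRun d ρ :=
  ⟨fun ⟨f, hf, _, _, h⟩ => ⟨f, (hfs f).1 hf, h⟩,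
    fun ⟨f, hf, h⟩ => ⟨f, (hfs f).2 hf, A.start.2, f.2, h⟩⟩

/-- This is the only place where unambiguity enters. The listed annotations come from distinct
accepting runs, so they are distinct outputs. The empty output is not among them and is added
according to the flag. -/
theorem Cov.outputs {d : List (Fin nσ)} {e : Bool} {L : List Out} (h : Cov (runsTo A d fs) e L)
    (hA : A.Unambiguous) (hfs : ∀ q, q ∈ fs ↔ q ∈ A.final) :
    ∃ ws : List (List (Fin nΩ × ℕ)), ws.map toOut = (if e then [[]] else []) ++ L ∧ ws.Nodup ∧
      ∀ w, w ∈ ws ↔ w ∈ A.outputs d := by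
  obtain ⟨l, h1, h2, h3⟩ := h.runs
  have hann : (annZ 1 : List (Option (Fin nΩ) × Fin nQ) → Out) = toOut ∘ AnnA.ann := rfl
  have hnil : ∀ ρ : List (Option (Fin nΩ) × Fin nQ), annZ 1 ρ = [] ↔ AnnA.ann ρ = [] := fun ρ => by
    simp [hann, toOut]
  obtain ⟨ws, hws⟩ : L ∈ Set.range (List.map (toOut (n := nΩ))) := by
    rw [Set.range_list_map]
    intro x hx
    obtain ⟨ρ, -, rfl⟩ := List.mem_map.1 (h3.mem_iff.2 hx)
    exact ⟨AnnA.ann ρ, rfl⟩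
  have hperm : (l.map AnnA.ann).Perm ws := by
    rw [← List.map_perm_map_iff toOut_injective, hws, List.map_map]
    exact h3
  have hnd : ws.Nodup := by
    refine hperm.nodup_iff.1 (h1.map_on fun ρ hρ ρ' hρ' hh => ?_)
    -- Two listed accepting runs with the same annotation coincide.
    exact (hA d _ ⟨ρ', (mem_runsTo hfs).1 (h2 ρ' hρ').1, rfl⟩).unique
      ⟨(mem_runsTo hfs).1 (h2 ρ hρ).1, hh⟩ ⟨(mem_runsTo hfs).1 (h2 ρ' hρ').1, rfl⟩
  have hne : [] ∉ ws := fun h0 => by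
    obtain ⟨ρ, hρ, h4⟩ := List.mem_map.1 (hperm.mem_iff.2 h0)
    exact (h2 ρ hρ).2 ((hnil ρ).2 h4)
  refine ⟨(if e then [[]] else []) ++ ws, ?_, ?_, fun w => ?_⟩
  · rw [List.map_append, hws]
    split_ifs <;> rfl
  · split_ifs
    · exact List.nodup_cons.2 ⟨hne, hnd⟩
    · exact hnd
  · constructor
    · intro hw
      rcases List.mem_append.1 hw with hw | hw
      · split_ifs at hw with he
        · obtain ⟨ρ, hρ, h4⟩ := h.eps.1 he
          exact ⟨ρ, (mem_runsTo hfs).1 hρ, by rw [List.mem_singleton.1 hw, ← hnil, h4]⟩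
        · cases hw
      · obtain ⟨ρ, hρ, rfl⟩ := List.mem_map.1 (hperm.mem_iff.2 hw)
        exact ⟨ρ, (mem_runsTo hfs).1 (h2 ρ hρ).1, rfl⟩
    · rintro ⟨ρ, hρ, rfl⟩
      have hρ := (mem_runsTo hfs).2 hρ
      by_cases h0 : annZ 1 ρ = []
      · rw [h.eps.2 ⟨ρ, hρ, h0⟩, (hnil ρ).1 h0]
        simp
      · refine List.mem_append_right _ ?_
        have := h.mem ρ hρ h0
        rw [← hws] at this
        obtain ⟨w, hw, hw'⟩ := List.mem_map.1 this
        rwa [← toOut_injective (hw'.trans (congrFun hann ρ))]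

end Main

end RAM

theorem mainTheorem1 :
    ∃ (pre enum : RAM.Prog) (c : ℕ),
      ∀ (nQ nσ nΩ nN : ℕ) (A : AnnA (Fin nQ) (Fin nσ) (Fin nΩ)) (S : SLP (Fin nN) (Fin nσ)),
        A.Unambiguous →
        ∀ input : List ℕ, Encodes A S input →
          RAM.Enumerates pre enum c (c * (A.size + S.size * nQ ^ 3)) input
            (A.outputs S.doc) := by
  -- One constant for both phases: the factor 230 of the preprocessing also exceeds the delay
  -- constant 31, and the two overheads come from the compilation.
  refine ⟨RAM.preCmd.comp, RAM.enumCmd.comp,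
    (RAM.enumCmd.overhead + 1) * ((RAM.preCmd.overhead + 1) * 230), ?_⟩
  rintro nQ nσ nΩ nN A S hA input ⟨fs, ts, hnf, hfs, hnd, hts, h⟩
  obtain ⟨t, s, h1, h2, h3, e, L, h4, h5, h6, h7⟩ := RAM.pre_spec hnf hts hnd h
  obtain ⟨t₁, r, g1, g2, g3⟩ := h1.exec_comp _ (RAM.sim_initConf input)
  obtain ⟨ws, i1, i2, i3⟩ := h6.outputs hA hfs
  -- The heap lies behind the input, so a nonempty input makes all record addresses positive and
  -- keeps 0 free as the null pointer.
  have hlen : 0 < input.length := by rw [h]; simp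
  obtain ⟨t', s', j1, j2⟩ := RAM.enum_spec
    (fun z hz => by simp only [RAM.heap, Set.mem_ofPred_eq] at hz; omega) h7 h4 h5
  obtain ⟨t₂, r', k1, k2, k3⟩ := j1.exec_comp _ g2
  rw [← i1] at j2
  refine ⟨t₁, t₂, r, r', ws, g1, g3.silent h2, ?_, k1, i2, i3,
    (j2.mono (by omega)).printsWithDelay.stretch k3⟩
  refine g3.length_le.trans ((Nat.mul_le_mul_left _ h3).trans ?_)
  rw [← mul_assoc, mul_assoc (RAM.enumCmd.overhead + 1)]
  exact Nat.le_mul_of_pos_left _ (Nat.succ_pos _)
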